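/- **Setting.** Let $Q$ be a finite quiver with vertex set $I$ (loops and multiple arrows are allowed). On $\mathbb{Z}^I$ put $(\beta,\gamma)=2\sum_{i}\beta_i\gamma_i-\sum_{a:i\to j}(\beta_i\gamma_j+\beta_j\gamma_i)$, the second sum being over the arrows $a$ of $Q$, and $s_i(\beta)=\beta-(\beta,\varepsilon_i)\varepsilon_i$ for each loop-free vertex $i$. The *roots* of $Q$ are the real roots $w(\varepsilon_i)$ with $i$ loop-free and the imaginary roots $\pm w(\beta)$; here $w$ runs over the group generated by the $s_i$, and $\beta$ over the nonzero vectors in $\mathbb{N}^I$ with connected support such that $(\beta,\varepsilon_i)\le 0$ for all $i\in I$. A parameter $q\in(\mathbb{C}^\times)^I$ is *regular* if $q^\beta:=\prod_{i} q_i^{\beta_i}\neq 1$ for every root $\beta$ of $Q$. A *framing* $\widetilde Q$ of $Q$ is a quiver obtained by adding one vertex $\infty$ and finitely many arrows from vertices of $Q$ to $\infty$. For $\alpha\in\mathbb{N}^I$ put $\widetilde\alpha=(1,\alpha)$, i.e. $\widetilde\alpha_\infty=1$ and $\widetilde\alpha_i=\alpha_i$ for $i\in I$. Put $\widetilde q_\infty=q^{-\alpha}=\prod_i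 q_i^{-\alpha_i}$ and $\widetilde q_i=q_i$ for $i\in I$. Let $\overline Q$ be the double of $\widetilde Q$, with an opposite arrow $a^*$ for each arrow $a$ of $\widetilde Q$, and $(a^*)^*=a$. Put $\epsilon(a)=1$ if $a$ is an arrow of $\widetilde Q$, and $\epsilon(a)=-1$ if $a$ is one of the added opposite arrows. Let $A$ be obtained from the path algebra $\mathbb{C}\overline Q$ (paths composed from left to right, with idempotents $e_i$) by inverting all elements $1+aa^*$, $a\in\overline Q$. Fix any total ordering of the arrows of $\overline Q$. The *multiplicative preprojective algebra* is $$\Lambda^{\widetilde q}=A\Big/\Big(\prod_{a\in\overline Q}(1+aa^*)^{\epsilon(a)}-\sum_{i\in I\sqcup\{\infty\}}\widetilde q_i e_i\Big),$$ where the product is taken in the chosen order. A $\Lambda^{\widetilde q}$-module $V$ has dimension $\widetilde\alpha$ if $\dim_{\mathbb{C}} e_iV=\widetilde\alpha_i$ for all $i\in I\sqcup\{\infty\}$. Let $N=1+\sum_{i\in I}\alpha_i$, and let $\operatorname{Rep}(\Lambda^{\widetilde q},\widetilde\alpha)$ be the affine scheme over $\mathbb{C}$ that parametrises algebra homomorphisms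 $\Lambda^{\widetilde q}\to\operatorname{Mat}_N$ sending each $e_i$ to the $i$-th block of the identity matrix, for the block decomposition of $N$ into the sizes $\widetilde\alpha_i$. The group $\prod_{i\in I\sqcup\{\infty\}}\operatorname{GL}_{\widetilde\alpha_i}(\mathbb{C})$ acts on it by conjugation, with the diagonal scalars $\mathbb{C}^\times$ acting trivially. Let $G(\widetilde\alpha)$ be the quotient of this group by $\mathbb{C}^\times$; it is identified with $\operatorname{GL}_\alpha=\prod_{i\in I}\operatorname{GL}_{\alpha_i}(\mathbb{C})$, embedded with component $1$ at $\infty$. The *multiplicative quiver variety* is $$\mathcal{M}_{\alpha,q}(Q)=\operatorname{Rep}(\Lambda^{\widetilde q},\widetilde\alpha)/\!/G(\widetilde\alpha)=\operatorname{Spec}\,\mathcal{O}\big(\operatorname{Rep}(\Lambda^{\widetilde q},\widetilde\alpha)\big)^{G(\widetilde\alpha)}.$$ **Proposition.** Let $\widetilde Q$ be any framing of $Q$, let $\alpha\in\mathbb{N}^I$, and let $q\in(\mathbb{C}^\times)^I$ be regular. Then: 1. every $\Lambda^{\widetilde q}$-module of dimension $\widetilde\alpha$ is simple; 2. the group $\operatorname{GL}_\alpha$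 acts freely on (the set of $\mathbb{C}$-points of) $\operatorname{Rep}(\Lambda^{\widetilde q},\widetilde\alpha)$; 3. $\mathcal{M}_{\alpha,q}(Q)$ is smooth over $\mathbb{C}$ (possibly empty). -/

import Mathlib

universe u v w

noncomputable section

namespace MultQuiver

/-! ### Quivers: doubles, framings, roots -/

section Quivers

/-- The arrows of the double of a quiver `J`: every arrow `a` of `J` is kept (`fwd a`), and an
opposite arrow (`rev a`) is adjoined for it. -/
inductive DoubledArrow (J : Type u) [Quiver.{v} J] : Type (max u v)
  | fwd (a : Quiver.Total J) : DoubledArrow J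
  | rev (a : Quiver.Total J) : DoubledArrow J

namespace DoubledArrow

variable {J : Type u} [Quiver.{v} J]

/-- The tail of an arrow of the double. -/
def tail : DoubledArrow J → J
  | fwd a => a.left
  | rev a => a.right

/-- The head of an arrow of the double. -/
def head : DoubledArrow J → J
  | fwd a => a.right
  | rev a => a.left

/-- The involution `a ↦ a*` on the arrows of the double. -/
def star : DoubledArrow J → DoubledArrow J
  | fwd a => rev a
  | rev a => fwd a

end DoubledArrow

/-- The vertices of the framed quiver: those of `I`, and one additional vertex `∞`. The type `W i`
is the set of framing arrows `i → ∞`. -/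
inductive Framed (I : Type u) (W : I → Type v) : Type u
  | vertex (i : I) : Framed I W
  | infty : Framed I W

variable {I : Type u} {W : I → Type v}

/-- The vertex set of the framed quiver is `I ⊔ {∞}`. -/
def framedEquiv : Framed I W ≃ Option I where
  toFun
    | .vertex i => some i
    | .infty => none
  invFun
    | some i => .vertex i
    | none => .infty
  left_inv x := by cases x <;> rfl
  right_inv x := by cases x <;> rfl

instance [Fintype I] : Fintype (Framed I W) := Fintype.ofEquiv _ framedEquiv.symm

instance [DecidableEq I] : DecidableEq (Framed I W) := framedEquiv.decidableEq

/-- The framing of a quiver `I` by the arrows `W i`, from `i` to `∞`. -/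
instance [Quiver.{v} I] : Quiver.{v} (Framed I W) where
  Hom
    | .vertex i, .vertex j => i ⟶ j
    | .vertex i, .infty => W i
    | .infty, _ => PEmpty

variable (W) in
/-- The extended dimension vector `(1, α)`. -/
def framedDim (α : I → ℕ) : Framed I W → ℕ
  | .infty => 1
  | .vertex i => α i

variable (W) in
/-- The extended parameter: `q` on `I`, and `q^{-α} = ∏ i, q i ^ (-α i)` at `∞`. -/
def framedParam [Fintype I] (α : I → ℕ) (q : I → ℂˣ) : Framed I W → ℂˣ
  | .infty => ∏ i, q i ^ (-(α i : ℤ))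
  | .vertex i => q i

section Roots

variable [Fintype I] [DecidableEq I] [Quiver.{v} I]

/-- The symmetric bilinear form of a quiver,
`(β, γ) = 2 ∑ i, β i * γ i - ∑_{a : i → j} (β i * γ j + β j * γ i)`. -/
def cartanForm (β γ : I → ℤ) : ℤ :=
  2 * ∑ i, β i * γ i - ∑ i, ∑ j, (Nat.card (i ⟶ j) : ℤ) * (β i * γ j + β j * γ i)

/-- The reflection `β ↦ β - (β, ε_i) ε_i` at the coordinate vector `ε_i`. -/
def reflect (i : I) (β : I → ℤ) : I → ℤ :=
  β - cartanForm β (Pi.single i 1) • Pi.single i 1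

/-- The fundamental region: nonzero `β` with nonnegative entries and connected support
such that `(β, ε_i) ≤ 0` for every vertex `i`. -/
def InFundamentalRegion (β : I → ℤ) : Prop :=
  β ≠ 0 ∧ (∀ i, 0 ≤ β i) ∧
    ((SimpleGraph.fromRel fun i j : I => Nonempty (i ⟶ j)).induce {i | β i ≠ 0}).Connected ∧
    ∀ i, cartanForm β (Pi.single i 1) ≤ 0

/-- The roots of a quiver (in the sense of Kac). The real roots are the images of the coordinate
vectors at loop-free vertices under the Weyl group, which is generated by the reflections at
loop-free vertices; the imaginary roots are the images of `± β`, `β` in the fundamental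
region, under the Weyl group. (The reflections are involutions, so closing up under the
generators is the same as taking orbits.) -/
inductive IsRoot : (I → ℤ) → Prop
  | coordinate (i : I) (hi : IsEmpty (i ⟶ i)) : IsRoot (Pi.single i 1)
  | fundamental (β : I → ℤ) (hβ : InFundamentalRegion β) : IsRoot β
  | neg (β : I → ℤ) (hβ : IsRoot β) : IsRoot (-β)
  | reflect (i : I) (hi : IsEmpty (i ⟶ i)) (β : I → ℤ) (hβ : IsRoot β) : IsRoot (reflect i β)

/-- `q` is regular if `q^β ≠ 1` for every root `β` of the quiver. -/
def IsRegular (q : I → ℂˣ) : Prop :=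
  ∀ β : I → ℤ, IsRoot β → ∏ i, q i ^ β i ≠ 1

end Roots

end Quivers

/-! ### The multiplicative preprojective algebra -/

section Algebra

variable (J : Type u) [Quiver.{v} J]

/-- Generators: the idempotents `e_i`, the arrows `a` of the double, and the inverses of the
elements `1 + a a*`. -/
inductive Gen : Type (max u v)
  | vertex (i : J) : Gen
  | arrow (a : DoubledArrow J) : Gen
  | inverse (a : DoubledArrow J) : Gen

variable {J}

/-- The element `1 + a a*`. -/
def oneAdd (a : DoubledArrow J) : FreeAlgebra ℂ (Gen J) :=
  1 + FreeAlgebra.ι ℂ (Gen.arrow a) * FreeAlgebra.ι ℂ (Gen.arrow a.star)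

/-- The factor `(1 + a a*)^{ε(a)}` of the moment map, where `ε = 1` on the arrows of the quiver
and `ε = -1` on the opposite arrows. -/
def momentFactor : DoubledArrow J → FreeAlgebra ℂ (Gen J)
  | .fwd a => oneAdd (.fwd a)
  | .rev a => FreeAlgebra.ι ℂ (Gen.inverse (.rev a))

variable [Fintype J]

/-- The defining relations of the multiplicative preprojective algebra. The first five groups
present the path algebra of the double (with paths composed from left to right), the next two
invert all `1 + a a*`, and the last is `Φ = q`, where `Φ` is the product of the
`(1 + a a*)^{ε(a)}` in the order in which `ord` lists the arrows. -/
inductive Rel (ord : List (DoubledArrow J)) (q : J → ℂˣ) :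
    FreeAlgebra ℂ (Gen J) → FreeAlgebra ℂ (Gen J) → Prop
  | idem (i : J) : Rel ord q
      (FreeAlgebra.ι ℂ (Gen.vertex i) * FreeAlgebra.ι ℂ (Gen.vertex i))
      (FreeAlgebra.ι ℂ (Gen.vertex i))
  | orth (i j : J) (hij : i ≠ j) : Rel ord q
      (FreeAlgebra.ι ℂ (Gen.vertex i) * FreeAlgebra.ι ℂ (Gen.vertex j)) 0
  | sum_vertex : Rel ord q (∑ i, FreeAlgebra.ι ℂ (Gen.vertex i)) 1
  | tail_mul (a : DoubledArrow J) : Rel ord q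
      (FreeAlgebra.ι ℂ (Gen.vertex a.tail) * FreeAlgebra.ι ℂ (Gen.arrow a))
      (FreeAlgebra.ι ℂ (Gen.arrow a))
  | mul_head (a : DoubledArrow J) : Rel ord q
      (FreeAlgebra.ι ℂ (Gen.arrow a) * FreeAlgebra.ι ℂ (Gen.vertex a.head))
      (FreeAlgebra.ι ℂ (Gen.arrow a))
  | mul_inverse (a : DoubledArrow J) : Rel ord q
      (oneAdd a * FreeAlgebra.ι ℂ (Gen.inverse a)) 1
  | inverse_mul (a : DoubledArrow J) : Rel ord q
      (FreeAlgebra.ι ℂ (Gen.inverse a) * oneAdd a) 1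
  | moment : Rel ord q (ord.map momentFactor).prod
      (∑ i, (q i : ℂ) • FreeAlgebra.ι ℂ (Gen.vertex i))

/-- The multiplicative preprojective algebra `Λ^q` of the quiver `J`, for the ordering `ord` of the
arrows of its double. -/
abbrev MPA (ord : List (DoubledArrow J)) (q : J → ℂˣ) : Type (max u v) :=
  RingQuot (Rel ord q)

/-- The idempotent `e_i` of `Λ^q`. -/
def MPA.vertex (ord : List (DoubledArrow J)) (q : J → ℂˣ) (i : J) : MPA ord q :=
  RingQuot.mkAlgHom ℂ (Rel ord q) (FreeAlgebra.ι ℂ (Gen.vertex i))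

end Algebra

/-! ### Modules and representation spaces

Here `A` is a `ℂ`-algebra with elements `e i` (the images of the idempotents of `B = ⊕ ℂ e_i`). -/

section Rep

variable {J : Type u} {A : Type w} [Ring A] [Algebra ℂ A]

/-- The `A`-module `V` has dimension vector `α`: the space `e i • V` has dimension `α i`. -/
def HasDimVector (e : J → A) (α : J → ℕ) (V : Type*) [AddCommGroup V] [Module ℂ V] [Module A V]
    [IsScalarTower ℂ A V] : Prop :=
  ∀ i, Module.rank ℂ (LinearMap.range (Algebra.lsmul ℂ ℂ V (e i))) = α i

variable [DecidableEq J]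

/-- Square matrices of size `∑ i, α i`, with rows and columns divided into blocks of sizes `α i`. -/
abbrev BlockMat (α : J → ℕ) (S : Type*) : Type _ :=
  Matrix (Σ i, Fin (α i)) (Σ i, Fin (α i)) S

/-- The block-diagonal idempotent matrix which represents `e_i`. -/
def blockIdem (α : J → ℕ) (S : Type*) [CommRing S] (i : J) : BlockMat α S :=
  Matrix.blockDiagonal' (Pi.single i 1)

theorem blockIdem_map (α : J → ℕ) (S : Type*) [CommRing S] [Algebra ℂ S] (i : J) (k l) :
    algebraMap ℂ S (blockIdem α ℂ i k l) = blockIdem α S i k l := by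
  obtain ⟨k, a⟩ := k
  obtain ⟨l, b⟩ := l
  rw [blockIdem, blockIdem, Matrix.blockDiagonal'_apply, Matrix.blockDiagonal'_apply]
  by_cases h : k = l
  · subst h
    simp only [dif_pos, cast_eq]
    by_cases hk : k = i
    · subst hk
      simp [Matrix.one_apply, apply_ite (algebraMap ℂ S)]
    · simp [Pi.single_eq_of_ne hk]
  · simp [h]

variable [Fintype J]

/-- The `S`-points of `Rep(A, α)`: algebra homomorphisms from `A` to matrices over `S` under which
`e i` becomes the `i`-th block idempotent. -/
@[ext]
structure RepPoint (e : J → A) (α : J → ℕ) (S : Type*) [CommRing S] [Algebra ℂ S] where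
  toAlgHom : A →ₐ[ℂ] BlockMat α S
  map_idem : ∀ i, toAlgHom (e i) = blockIdem α S i

/-- The group `∏ i, GL_{α i}(S)`. -/
abbrev GLdim (α : J → ℕ) (S : Type*) [CommRing S] : Type _ :=
  ∀ i, GL (Fin (α i)) S

/-- The embedding of `∏ i, GL_{α i}(S)` as the invertible block-diagonal matrices. -/
def toBlock (α : J → ℕ) (S : Type*) [CommRing S] : GLdim α S →* (BlockMat α S)ˣ :=
  (Units.map (Matrix.blockDiagonal'RingHom (fun i => Fin (α i)) S : _ →* BlockMat α S)).comp
    (MulEquiv.piUnits (M := fun i => Matrix (Fin (α i)) (Fin (α i)) S)).symm.toMonoidHom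

theorem toBlock_val (α : J → ℕ) (S : Type*) [CommRing S] (g : GLdim α S) :
    ((toBlock α S g : (BlockMat α S)ˣ) : BlockMat α S) =
      Matrix.blockDiagonal' fun i => (g i : Matrix (Fin (α i)) (Fin (α i)) S) := rfl

theorem toBlock_mul_blockIdem (α : J → ℕ) (S : Type*) [CommRing S] (g : GLdim α S) (i : J) :
    (toBlock α S g : BlockMat α S) * blockIdem α S i =
      blockIdem α S i * (toBlock α S g : BlockMat α S) := by
  rw [toBlock_val, blockIdem, ← Matrix.blockDiagonal'_mul, ← Matrix.blockDiagonal'_mul]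
  congr 1
  funext j
  by_cases h : j = i
  · subst h; simp
  · simp [Pi.single_eq_of_ne h]

variable (e : J → A) (α : J → ℕ)

/-- The group `∏ i, GL_{α i}(S)` acts on the `S`-points of `Rep(A, α)` by conjugation. -/
instance (S : Type*) [CommRing S] [Algebra ℂ S] : MulAction (GLdim α S) (RepPoint e α S) where
  smul g ρ :=
    { toAlgHom := AlgHom.ofLinearMap
        (LinearMap.mulLeft ℂ (toBlock α S g : BlockMat α S) ∘ₗ
          LinearMap.mulRight ℂ (((toBlock α S g)⁻¹ : (BlockMat α S)ˣ) : BlockMat α S) ∘ₗ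
          ρ.toAlgHom.toLinearMap)
        (by simp)
        (by intro x y; simp [mul_assoc])
      map_idem := by
        intro i
        simp only [AlgHom.ofLinearMap_apply, LinearMap.comp_apply, LinearMap.mulLeft_apply,
          LinearMap.mulRight_apply, AlgHom.toLinearMap_apply, ρ.map_idem]
        rw [← mul_assoc, toBlock_mul_blockIdem, mul_assoc, Units.mul_inv, mul_one] }
  one_smul ρ := by
    ext1; ext1 x
    change (toBlock α S 1 : BlockMat α S) * (ρ.toAlgHom x *
      (((toBlock α S 1)⁻¹ : (BlockMat α S)ˣ) : BlockMat α S)) = _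
    simp
  mul_smul g h ρ := by
    ext1; ext1 x
    change (toBlock α S (g * h) : BlockMat α S) * (ρ.toAlgHom x *
      (((toBlock α S (g * h))⁻¹ : (BlockMat α S)ˣ) : BlockMat α S)) =
      (toBlock α S g : BlockMat α S) * (((toBlock α S h : BlockMat α S) * (ρ.toAlgHom x *
      (((toBlock α S h)⁻¹ : (BlockMat α S)ˣ) : BlockMat α S))) *
      (((toBlock α S g)⁻¹ : (BlockMat α S)ˣ) : BlockMat α S))
    simp [mul_assoc]

theorem smul_toAlgHom_apply {S : Type*} [CommRing S] [Algebra ℂ S] (g : GLdim α S)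
    (ρ : RepPoint e α S) (x : A) :
    (g • ρ).toAlgHom x = (toBlock α S g : BlockMat α S) * (ρ.toAlgHom x *
      (((toBlock α S g)⁻¹ : (BlockMat α S)ˣ) : BlockMat α S)) := rfl

/-- The relations between the coordinate functions `x_{kl}`, for `x` in `A`, on `Rep(A, α)`: they
are linear and multiplicative in `x`, and `e i` (and `1`) have the prescribed matrices. -/
inductive RepRel : MvPolynomial (A × (Σ i, Fin (α i)) × (Σ i, Fin (α i))) ℂ → Prop
  | add (x y : A) (k l) : RepRel
      (MvPolynomial.X (x + y, k, l) - (MvPolynomial.X (x, k, l) + MvPolynomial.X (y, k, l)))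
  | smul (c : ℂ) (x : A) (k l) : RepRel
      (MvPolynomial.X (c • x, k, l) - MvPolynomial.C c * MvPolynomial.X (x, k, l))
  | mul (x y : A) (k l) : RepRel
      (MvPolynomial.X (x * y, k, l) -
        ∑ m, MvPolynomial.X (x, k, m) * MvPolynomial.X (y, m, l))
  | one (k l) : RepRel
      (MvPolynomial.X (1, k, l) - MvPolynomial.C ((1 : BlockMat α ℂ) k l))
  | idem (i : J) (k l) : RepRel
      (MvPolynomial.X (e i, k, l) - MvPolynomial.C (blockIdem α ℂ i k l))

/-- The coordinate ring of the affine scheme `Rep(A, α)`. -/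
abbrev RepRing : Type (max u w) :=
  MvPolynomial (A × (Σ i, Fin (α i)) × (Σ i, Fin (α i))) ℂ ⧸
    Ideal.span {p | RepRel e α p}

/-- The coordinate function `x_{kl}` on `Rep(A, α)`. -/
def coord (x : A) (k l : Σ i, Fin (α i)) : RepRing e α :=
  Ideal.Quotient.mk _ (MvPolynomial.X (x, k, l))

theorem mk_eq_of_rel {p q : MvPolynomial (A × (Σ i, Fin (α i)) × (Σ i, Fin (α i))) ℂ}
    (h : RepRel e α (p - q)) :
    (Ideal.Quotient.mk (Ideal.span {p | RepRel e α p}) p) = Ideal.Quotient.mk _ q :=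
  Ideal.Quotient.eq.mpr (Ideal.subset_span h)

/-- The universal point of `Rep(A, α)`: `x` is sent to the matrix of coordinate functions
`x_{kl}`. -/
def univPoint : RepPoint e α (RepRing e α) where
  toAlgHom := AlgHom.ofLinearMap
    { toFun := fun x => Matrix.of fun k l => coord e α x k l
      map_add' := fun x y => by
        ext k l
        simpa [coord] using mk_eq_of_rel e α (RepRel.add x y k l)
      map_smul' := fun c x => by
        ext k l
        have h := mk_eq_of_rel e α (RepRel.smul c x k l)
        rw [map_mul] at h
        simp only [Matrix.of_apply, Matrix.smul_apply, RingHom.id_apply, coord]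
        rw [h, Algebra.smul_def]
        rfl }
    (by
      ext k l
      have h := mk_eq_of_rel e α (RepRel.one k l)
      simp only [LinearMap.coe_mk, AddHom.coe_mk, Matrix.of_apply, coord]
      rw [h]
      by_cases hkl : k = l
      · subst hkl; simp
      · simp [Matrix.one_apply_ne hkl])
    (by
      intro x y
      ext k l
      have h := mk_eq_of_rel e α (RepRel.mul x y k l)
      simp only [LinearMap.coe_mk, AddHom.coe_mk, Matrix.of_apply, coord, Matrix.mul_apply]
      rw [h]
      simp)
  map_idem := fun i => by
    ext k l
    have h := mk_eq_of_rel e α (RepRel.idem i k l)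
    change coord e α (e i) k l = _
    rw [coord, h, ← blockIdem_map α (RepRing e α), ← MvPolynomial.algebraMap_eq]
    rfl

/-- The algebra homomorphism from the coordinate ring of `Rep(A, α)` given by an `S`-point. -/
def evalPoint {S : Type*} [CommRing S] [Algebra ℂ S] (ρ : RepPoint e α S) :
    RepRing e α →ₐ[ℂ] S :=
  Ideal.Quotient.liftₐ _
    (MvPolynomial.aeval fun t => ρ.toAlgHom t.1 t.2.1 t.2.2)
    (by
      intro p hp
      have key : Ideal.span {p | RepRel e α p} ≤ RingHom.ker (MvPolynomial.aeval (R := ℂ)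
          (fun t : A × (Σ i, Fin (α i)) × (Σ i, Fin (α i)) => ρ.toAlgHom t.1 t.2.1 t.2.2)) := by
        rw [Ideal.span_le]
        rintro p (⟨x, y, k, l⟩ | ⟨c, x, k, l⟩ | ⟨x, y, k, l⟩ | ⟨k, l⟩ | ⟨i, k, l⟩)
        · simp
        · rw [SetLike.mem_coe, RingHom.mem_ker]
          simp only [map_sub, map_mul, MvPolynomial.aeval_X, MvPolynomial.aeval_C, map_smul,
            Matrix.smul_apply]
          rw [Algebra.smul_def, sub_self]
        · simp [Matrix.mul_apply]
        · by_cases hkl : k = l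
          · subst hkl; simp
          · simp [Matrix.one_apply_ne hkl]
        · simp [ρ.map_idem, blockIdem_map]
      exact key hp)

theorem evalPoint_coord {S : Type*} [CommRing S] [Algebra ℂ S] (ρ : RepPoint e α S)
    (x : A) (k l : Σ i, Fin (α i)) :
    evalPoint e α ρ (coord e α x k l) = ρ.toAlgHom x k l := by
  change MvPolynomial.aeval _ (MvPolynomial.X (x, k, l)) = _
  rw [MvPolynomial.aeval_X]

/-- The action of `g` in `∏ i, GL_{α i}(ℂ)` on the coordinate ring of `Rep(A, α)`, which sends the
matrix `X` of the functions `x_{kl}` to `g X g⁻¹`. -/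
def conjRepRing (g : GLdim α ℂ) : RepRing e α →ₐ[ℂ] RepRing e α :=
  evalPoint e α
    ((fun i => Matrix.GeneralLinearGroup.map (algebraMap ℂ (RepRing e α)) (g i) :
      GLdim α (RepRing e α)) • univPoint e α)

/-- The coordinate ring of the affine quotient `Rep(A, α) // G(α)`: the invariant functions on
`Rep(A, α)`. Scalar matrices act trivially, so being invariant under `∏ i, GL_{α i}` is
being invariant under `G(α) = (∏ i, GL_{α i}) / ℂˣ`. -/
def quotientRing : Subalgebra ℂ (RepRing e α) :=
  ⨅ g : GLdim α ℂ, AlgHom.equalizer (conjRepRing e α g) (AlgHom.id ℂ (RepRing e α))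

end Rep

/-! ### Multiplicative quiver varieties -/

section Variety

variable {I : Type u} [Fintype I] [DecidableEq I] [Quiver.{v} I] (W : I → Type v)

/-- The embedding of `GL_α = ∏_{i ∈ I} GL_{α i}` into `∏_{i ∈ I ⊔ {∞}} GL_{α i}` with the
component `1` at `∞`; composed with the projection modulo scalars, it is an isomorphism onto the
group `G(1, α)`. -/
def extendByOne {α : I → ℕ} (g : GLdim α ℂ) : GLdim (framedDim W α) ℂ
  | .infty => (1 : GL (Fin 1) ℂ)
  | .vertex i => g i

variable (ord : List (DoubledArrow (Framed I W))) (α : I → ℕ) (q : I → ℂˣ)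

/-- The multiplicative preprojective algebra of the framed quiver, with the extended parameter. -/
abbrev FramedMPA : Type (max u v) := MPA ord (framedParam W α q)

/-- The idempotents of the multiplicative preprojective algebra of the framed quiver. -/
abbrev framedVertex (j : Framed I W) : FramedMPA W ord α q := MPA.vertex ord (framedParam W α q) j

/-- The closed points of `Rep` of the framed algebra in dimension `(1, α)`. -/
abbrev FramedRep : Type (max u v) :=
  RepPoint (framedVertex W ord α q) (framedDim W α) ℂ

/-- The coordinate ring of the multiplicative quiver variety
`M_{α, q} = Rep(Λ^{q̃}, (1, α)) // G(1, α)`, an affine scheme over `ℂ`. -/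
abbrev QuiverVarietyRing : Type (max u v) :=
  quotientRing (framedVertex W ord α q) (framedDim W α)

end Variety

end MultQuiver

end

open Module

noncomputable section

/-! ### Linear algebra of the reflection at a single vertex -/

namespace MultQuiver

/-! Everything rests on one fact: for regular q, a finite-dimensional module M with e_∞ M = 0 is
zero. If M is nonzero, a simple submodule of it is a representation of the double of Q itself, with
dimension vector β, say. Then β is a root (`IsSimple.isRoot`). Taking determinants in the moment
relation, where det(1 + aa*) = det(1 + a*a) makes opposite factors cancel, gives q^β = 1
(`det_moment`). This contradicts regularity. If now e_∞ M is a line, a submodule N either vanishes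
at ∞, so that N = 0, or contains e_∞ M, so that M/N vanishes at ∞ and N = M (`eq_bot_or_eq_top`).
This is simplicity. Freeness follows: if g has component 1 at ∞ and fixes a representation, the
kernel of g - 1 is a submodule that is nonzero at ∞, hence everything.

That β is a root is proved by induction on the total dimension. If (β, ε_i) ≤ 0 for all i, then β is
in the fundamental region, its support being connected by simplicity. Otherwise some vertex i has
(β, ε_i) > 0, and i is loop-free. The arrows at i give maps from V_i to the sum of the neighbouring
spaces and back, whose composite is q_i - 1 (`Legs.pi_iota`). If q_i = 1, simplicity makes the first
map injective and the second surjective unless V is concentrated at i; so either 2β_i is at most the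
sum of the neighbouring dimensions, which is excluded, or β = ε_i. If q_i ≠ 1, replacing V_i by the
kernel of the second map is a multiplicative reflection functor. It keeps simplicity, reflects β to
a smaller vector, and only changes the scalars in the moment relation (`exists_reflect`,
`isSimple_of_reflect`).

For smoothness, first consider Rep. A matrix ξ that is trace-orthogonal to the logarithmic
differential of the moment map commutes with all arrows (`DoubleRep.commute_of_map_dlog`). If it
also vanishes at ∞, its kernel is a nonzero submodule, so ξ = 0. Hence the differential is onto the
blocks away from ∞ at every complex point, and therefore over the whole coordinate ring by the
Nullstellensatz (`surjective_tangentLin_univPoint`). So points lift along square-zero extensions: a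
first-order correction restores the moment relation away from ∞, and the remaining one-dimensional
block is forced by the determinant (`RepPoint.exists_lift`).

The quotient is treated with slices. The (∞, ∞) matrix entry of every algebra element is invariant.
Vectors and covectors generated from the basis vector at ∞ have a pairing matrix of such invariants.
Where its determinant is invertible, every representation in the given frame has invariant entries,
which makes the localized invariant ring a retract of a localization of the coordinate ring of Rep
(`exists_retraction`), and a retract of a smooth algebra is smooth. By irreducibility these
determinants have no common zero on Rep. Averaging over the compact group of unitary matrices turns
a partition of unity on Rep into one with invariant coefficients (`span_eq_top_of_span_eq_top`), so
the slices cover the quotient. -/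

/-- Endomorphisms `a k`, `b k` between the image of an idempotent `E₀` and the images of
idempotents `F k`, such that the product of all `1 + a k * b k` is the scalar `q` on the image of
`E₀`. -/
structure Legs (V : Type w) [AddCommGroup V] [Module ℂ V] (n : ℕ) where
  E₀ : End ℂ V
  F : Fin n → End ℂ V
  a : Fin n → End ℂ V
  b : Fin n → End ℂ V
  g : Fin n → (End ℂ V)ˣ
  c : Fin n → (End ℂ V)ˣ
  q : ℂˣ
  E₀_idem : E₀ * E₀ = E₀
  F_idem : ∀ k, F k * F k = F k
  E₀_a : ∀ k, E₀ * a k = a k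
  a_F : ∀ k, a k * F k = a k
  F_b : ∀ k, F k * b k = b k
  b_E₀ : ∀ k, b k * E₀ = b k
  g_eq : ∀ k, (g k : End ℂ V) = 1 + a k * b k
  c_eq : ∀ k, (c k : End ℂ V) = 1 + b k * a k
  rel : ((Fin.partialProd g (Fin.last n) : (End ℂ V)ˣ) : End ℂ V) * E₀ = (q : ℂ) • E₀

namespace Legs

variable {V : Type w} [AddCommGroup V] [Module ℂ V] {n : ℕ} (L : Legs V n)

/-- The partial products of the `1 + a k * b k`. -/
def P (m : Fin (n + 1)) : (End ℂ V)ˣ := Fin.partialProd L.g m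

theorem P_zero : L.P 0 = 1 := Fin.partialProd_zero _

theorem P_succ (k : Fin n) : L.P k.succ = L.P k.castSucc * L.g k := Fin.partialProd_succ _ _

theorem P_succ_apply (k : Fin n) (v : V) :
    (L.P k.succ : End ℂ V) v = (L.P k.castSucc : End ℂ V) v +
      (L.P k.castSucc : End ℂ V) (L.a k (L.b k v)) := by
  rw [P_succ, Units.val_mul, g_eq]
  simp

theorem E₀_a_apply (k) (v : V) : L.E₀ (L.a k v) = L.a k v := LinearMap.congr_fun (L.E₀_a k) v
theorem a_F_apply (k) (v : V) : L.a k (L.F k v) = L.a k v := LinearMap.congr_fun (L.a_F k) v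
theorem F_b_apply (k) (v : V) : L.F k (L.b k v) = L.b k v := LinearMap.congr_fun (L.F_b k) v
theorem b_E₀_apply (k) (v : V) : L.b k (L.E₀ v) = L.b k v := LinearMap.congr_fun (L.b_E₀ k) v
theorem F_idem_apply (k) (v : V) : L.F k (L.F k v) = L.F k v := LinearMap.congr_fun (L.F_idem k) v
theorem E₀_idem_apply (v : V) : L.E₀ (L.E₀ v) = L.E₀ v := LinearMap.congr_fun L.E₀_idem v

theorem rel_apply (v : V) (hv : L.E₀ v = v) :
    (L.P (Fin.last n) : End ℂ V) v = (L.q : ℂ) • v := by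
  have := LinearMap.congr_fun L.rel v
  simpa [hv, P] using this

theorem E₀_P (m : Fin (n + 1)) (v : V) :
    L.E₀ ((L.P m : End ℂ V) v) = (L.P m : End ℂ V) (L.E₀ v) := by
  induction m using Fin.induction generalizing v with
  | zero => simp [P_zero]
  | succ k ih => simp [P_succ_apply, ih, E₀_a_apply, b_E₀_apply]

theorem c_inv_F (k) : ((L.c k)⁻¹ : (End ℂ V)ˣ) * L.F k = L.F k * ((L.c k)⁻¹ : (End ℂ V)ˣ) := by
  rw [Units.inv_mul_eq_iff_eq_mul, ← mul_assoc, Units.eq_mul_inv_iff_mul_eq, c_eq]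
  simp only [mul_add, add_mul, mul_one, one_mul]
  rw [mul_assoc, L.a_F, ← mul_assoc, L.F_b]

theorem c_apply (k) (v : V) : (L.c k : End ℂ V) v = v + L.b k (L.a k v) := by
  rw [c_eq]; simp

/-- The total map `V → ⨁ V` with components `b k`. -/
def iota : V →ₗ[ℂ] (Fin n → V) := LinearMap.pi L.b

@[simp] theorem iota_apply (v : V) (k : Fin n) : L.iota v k = L.b k v := rfl

/-- The partial sums of the `P k * a k`. -/
def S (m : Fin (n + 1)) : (Fin n → V) →ₗ[ℂ] V :=
  Fin.partialSum (fun k => ((L.P k.castSucc : End ℂ V) * L.a k) ∘ₗ LinearMap.proj k) m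

theorem S_zero : L.S 0 = 0 := Fin.partialSum_zero _

theorem S_succ (k : Fin n) (x : Fin n → V) :
    L.S k.succ x = L.S k.castSucc x + (L.P k.castSucc : End ℂ V) (L.a k (x k)) := by
  rw [S, Fin.partialSum_succ]
  rfl

/-- The total map `⨁ V → V`. -/
def pi : (Fin n → V) →ₗ[ℂ] V := L.S (Fin.last n)

theorem E₀_S (m) (x : Fin n → V) : L.E₀ (L.S m x) = L.S m x := by
  induction m using Fin.induction with
  | zero => simp [S_zero]
  | succ k ih => simp [S_succ, ih, E₀_P, E₀_a_apply]

theorem E₀_pi (x : Fin n → V) : L.E₀ (L.pi x) = L.pi x := L.E₀_S _ x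

/-- The sum telescopes, because `P k * a k * b k` is the difference of two consecutive partial
products. -/
theorem S_iota (m) (v : V) : L.S m (L.iota v) = (L.P m : End ℂ V) v - v := by
  induction m using Fin.induction with
  | zero => simp [S_zero, P_zero]
  | succ k ih => simp [S_succ, ih, P_succ_apply]; abel

/-- This dichotomy drives the argument at a vertex: for `q ≠ 1` the map `iota` splits `pi` up to a
scalar, and for `q = 1` the two maps form a complex. -/
theorem pi_iota (v : V) (hv : L.E₀ v = v) : L.pi (L.iota v) = ((L.q : ℂ) - 1) • v := by
  rw [pi, S_iota, rel_apply _ _ hv, sub_smul, one_smul]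

/-- The diagonal map with entries `F k`. -/
def D : (Fin n → V) →ₗ[ℂ] (Fin n → V) := LinearMap.pi fun k => L.F k ∘ₗ LinearMap.proj k

@[simp] theorem D_apply (x : Fin n → V) (k) : L.D x k = L.F k (x k) := rfl

theorem S_D (m) (x : Fin n → V) : L.S m (L.D x) = L.S m x := by
  induction m using Fin.induction with
  | zero => simp [S_zero]
  | succ k ih => simp [S_succ, ih, a_F_apply]

theorem D_iota (v : V) : L.D (L.iota v) = L.iota v := by
  ext k; simp [F_b_apply]

/-- The projection onto the kernel of `pi` in the sum of the images of the `F k`. -/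
def e : (Fin n → V) →ₗ[ℂ] (Fin n → V) := L.D - ((L.q : ℂ) - 1)⁻¹ • (L.iota ∘ₗ L.pi)

theorem e_of_mem {x : Fin n → V} (h1 : L.D x = x) (h2 : L.pi x = 0) : L.e x = x := by
  simp [e, h1, h2]

theorem D_e (x : Fin n → V) : L.D (L.e x) = L.e x := by
  have : L.D (L.D x) = L.D x := by ext k; simp [F_idem_apply]
  simp [e, this, D_iota]

theorem pi_e (hq : (L.q : ℂ) ≠ 1) (x : Fin n → V) : L.pi (L.e x) = 0 := by
  have h : (L.q : ℂ) - 1 ≠ 0 := sub_ne_zero.mpr hq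
  simp only [e, LinearMap.sub_apply, LinearMap.smul_apply, LinearMap.comp_apply, map_sub, map_smul]
  rw [pi_iota _ _ (L.E₀_pi x), smul_smul, inv_mul_cancel₀ h, one_smul]
  simp only [pi, S_D, sub_self]

/-- The vector `c k⁻¹ (F k v)`. -/
def y (k : Fin n) : End ℂ V := ((L.c k)⁻¹ : (End ℂ V)ˣ) * L.F k

theorem F_y (k) (v : V) : L.F k (L.y k v) = L.y k v := by
  have : L.F k * L.y k = L.y k := by
    rw [y, c_inv_F, ← mul_assoc, F_idem]
  exact LinearMap.congr_fun this v

theorem y_F (k) (v : V) : L.y k (L.F k v) = L.y k v := by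
  simp [y, F_idem_apply]

theorem c_y (k) (v : V) : L.y k v + L.b k (L.a k (L.y k v)) = L.F k v := by
  rw [← c_apply]
  simp [y, ← Module.End.mul_apply, ← mul_assoc]

/-- The map from the image of `F k` to the sum of all images of the reflected system. -/
def aRefl (k : Fin n) : V →ₗ[ℂ] (Fin n → V) :=
  LinearMap.pi fun j => (if j < k then -(L.q : ℂ) else -1) • (L.b j * L.a k * L.y k) +
    if j = k then ((L.q : ℂ) - 1) • L.y k else 0

theorem aRefl_apply (k j) (v : V) : L.aRefl k v j =
    (if j < k then -(L.q : ℂ) else -1) • L.b j (L.a k (L.y k v)) +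
    if j = k then ((L.q : ℂ) - 1) • L.y k v else 0 := by
  simp only [aRefl, LinearMap.pi_apply, LinearMap.add_apply, LinearMap.smul_apply]
  split_ifs <;> simp

theorem D_aRefl (k) (v : V) : L.D (L.aRefl k v) = L.aRefl k v := by
  ext j
  rw [D_apply, aRefl_apply]
  by_cases h : j = k
  · subst h; simp [F_b_apply, F_y]
  · rw [if_neg h, add_zero, map_smul, F_b_apply]

theorem aRefl_F (k) (v : V) : L.aRefl k (L.F k v) = L.aRefl k v := by
  ext j
  simp [aRefl_apply, y_F]

/-- The coefficients of `aRefl`, namely `-q` before position `k` and `-1` from `k` on, make the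
partial sums telescope on either side of `k`. The diagonal term `(q - 1) y` is the jump that joins
the two expressions. The second one vanishes at the end, where the full product is `q`. -/
theorem S_aRefl (k) (m) (v : V) : L.S m (L.aRefl k v) =
    if k.castSucc < m then (L.q : ℂ) • L.a k (L.y k v) - (L.P m : End ℂ V) (L.a k (L.y k v))
    else -(L.q : ℂ) • ((L.P m : End ℂ V) (L.a k (L.y k v)) - L.a k (L.y k v)) := by
  induction m using Fin.induction with
  | zero => simp [S_zero, P_zero]
  | succ j ih =>
    rw [S_succ, ih, aRefl_apply, P_succ_apply]
    simp only [Fin.castSucc_lt_castSucc_iff, Fin.castSucc_lt_succ_iff]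
    rcases lt_trichotomy j k with h | h | h
    · simp only [h, h.not_gt, h.ne, h.not_ge, if_true, if_false, map_smul, add_zero]
      module
    · subst h
      simp only [lt_irrefl, le_refl, if_true, if_false, map_add, map_smul]
      module
    · simp only [h, h.not_gt, h.ne', h.le, if_true, if_false, map_smul, add_zero]
      module

theorem pi_aRefl (k) (v : V) : L.pi (L.aRefl k v) = 0 := by
  rw [pi, S_aRefl, if_pos (Fin.castSucc_lt_last k), rel_apply _ _ (L.E₀_a_apply _ _), sub_self]

theorem e_aRefl (k) (v : V) : L.e (L.aRefl k v) = L.aRefl k v :=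
  L.e_of_mem (L.D_aRefl k v) (L.pi_aRefl k v)

/-- On the image of `F k` the right side is `q` times the inverse of `c k`. Thus reflection alters
the monodromy at the far end of a leg only by a scalar, and the relations at the neighbouring
vertices survive with new parameters. -/
theorem aRefl_self (k) (v : V) : v + L.aRefl k v k = v - L.F k v + (L.q : ℂ) • L.y k v := by
  rw [aRefl_apply, if_neg (lt_irrefl _), if_pos rfl, ← L.c_y k v]
  module

/-- The vectors `P m⁻¹ (S m x)`. -/
def t (m : Fin (n + 1)) (x : Fin n → V) : V := ((L.P m)⁻¹ : (End ℂ V)ˣ).val (L.S m x)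

theorem P_t (m) (x : Fin n → V) : (L.P m : End ℂ V) (L.t m x) = L.S m x := by
  simp [t, ← Module.End.mul_apply]

theorem t_zero (x : Fin n → V) : L.t 0 x = 0 := by simp [t, S_zero]

theorem t_succ (k) (x : Fin n → V) :
    L.t k.succ x + L.a k (L.b k (L.t k.succ x)) = L.t k.castSucc x + L.a k (x k) := by
  have h := L.P_t k.succ x
  rw [P_succ_apply, S_succ, ← P_t, ← map_add, ← map_add] at h
  have := congrArg ((L.P k.castSucc)⁻¹ : (End ℂ V)ˣ).val h
  simpa [← Module.End.mul_apply] using this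

theorem t_last {x : Fin n → V} (h : L.pi x = 0) : L.t (Fin.last n) x = 0 := by
  rw [t, ← pi, h, map_zero]

/-- The successive images of `x` under the inverse monodromies of the reflected system. -/
def Y (m : Fin (n + 1)) (x : Fin n → V) : Fin n → V :=
  fun j => (if j.castSucc < m then (L.q : ℂ) else 1) • (x j - L.b j (L.t m x))

theorem Y_zero (x : Fin n → V) : L.Y 0 x = x := by
  ext j; simp [Y, t_zero]

theorem Y_last {x : Fin n → V} (h : L.pi x = 0) : L.Y (Fin.last n) x = (L.q : ℂ) • x := by
  ext j; simp [Y, L.t_last h, Fin.castSucc_lt_last]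

/-- By `t_succ`, `c k` sends `x k - b k (t (k+1))` to `x k - b k (t k)`, the `k`-th component of `Y
k`. So the inverse in `y` can be evaluated, and `a k` then yields the difference of consecutive
`t`'s. Each step applies one reflected factor `1 + a b`; all of them together take `x` to `q x`. -/
theorem Y_succ (k) {x : Fin n → V} (h : L.D x = x) :
    L.Y k.castSucc x + L.aRefl k (L.Y k.castSucc x k) = L.Y k.succ x := by
  have hx : L.F k (x k) = x k := congrFun h k
  have hy : L.y k (L.Y k.castSucc x k) = x k - L.b k (L.t k.succ x) := by
    have h1 : L.F k (L.Y k.castSucc x k) =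
        (L.c k : End ℂ V) (x k - L.b k (L.t k.succ x)) := by
      rw [c_apply]
      simp only [Y, lt_irrefl, if_false, one_smul, map_sub, hx, F_b_apply]
      have := congrArg (L.b k) (L.t_succ k x)
      rw [map_add, map_add] at this
      linear_combination (norm := module) this
    rw [y, Module.End.mul_apply, h1, ← Module.End.mul_apply, Units.inv_mul]
    rfl
  have ha : L.a k (L.y k (L.Y k.castSucc x k)) = L.t k.succ x - L.t k.castSucc x := by
    rw [hy, map_sub]
    linear_combination (norm := module) -(L.t_succ k x)
  ext j
  rw [Pi.add_apply, aRefl_apply, ha, hy]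
  rcases lt_trichotomy j k with h | h | h
  · simp only [Y, h, h.le, h.ne, Fin.castSucc_lt_castSucc_iff, map_sub, Fin.castSucc_lt_succ_iff,
      if_true, if_false]
    module
  · subst h
    simp only [Y, lt_irrefl, if_true, if_false, map_sub, Fin.castSucc_lt_succ_iff, le_refl]
    module
  · simp only [Y, h.not_gt, h.ne', h.not_ge, Fin.castSucc_lt_castSucc_iff, map_sub,
      Fin.castSucc_lt_succ_iff, if_false]
    module

end Legs

/-! ### The reflected legs: stability of subspaces, monodromy and dimension -/

namespace Legs

variable {V : Type w} [AddCommGroup V] [Module ℂ V] {n : ℕ} (L : Legs V n)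

theorem pi_eq_sum (x : Fin n → V) :
    L.pi x = ∑ k : Fin n, (L.P k.castSucc : End ℂ V) (L.a k (x k)) := by
  rw [pi, S, Fin.partialSum, List.take_of_length_le (by simp), List.sum_ofFn,
    LinearMap.sum_apply]
  rfl

theorem pi_single (k : Fin n) (v : V) :
    L.pi (Pi.single k v) = (L.P k.castSucc : End ℂ V) (L.a k v) := by
  rw [pi_eq_sum, Finset.sum_eq_single k]
  · simp
  · intro j _ hj; simp [hj]
  · simp

/-- An injective endomorphism that preserves a finite-dimensional subspace restricts to a bijection
of it. This is what allows stability to be tested without the inverses of the `1 + a a*`. -/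
theorem mem_of_unit_apply_mem [FiniteDimensional ℂ V] (f : (End ℂ V)ˣ) {U : Submodule ℂ V}
    (hf : ∀ u ∈ U, (f : End ℂ V) u ∈ U) {v : V} (hv : (f : End ℂ V) v ∈ U) : v ∈ U := by
  have hinj : Function.Injective (f : End ℂ V) := fun a b hab => by
    have := congrArg (f⁻¹ : (End ℂ V)ˣ).val hab
    simpa [← Module.End.mul_apply] using this
  have hs : Function.Surjective ((f : End ℂ V).restrict hf) :=
    LinearMap.surjective_of_injective fun a b hab => Subtype.ext (hinj (congrArg Subtype.val hab))
  obtain ⟨u, hu⟩ := hs ⟨_, hv⟩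
  have : (u : V) = v := hinj (congrArg Subtype.val hu)
  exact this ▸ u.2

theorem unit_inv_mem [FiniteDimensional ℂ V] (f : (End ℂ V)ˣ) {U : Submodule ℂ V}
    (hf : ∀ u ∈ U, (f : End ℂ V) u ∈ U) {v : V} (hv : v ∈ U) : (f⁻¹ : (End ℂ V)ˣ).val v ∈ U :=
  mem_of_unit_apply_mem f hf (by simpa [← Module.End.mul_apply] using hv)

/-- The image of `pi` contains `P k (a k w)` by construction. It is preserved by every partial
product, by induction on the number of factors, so the invertible `P k` can be removed. -/
theorem a_mem_map_pi [FiniteDimensional ℂ V] (U : Fin n → Submodule ℂ V)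
    (hb : ∀ k, ∀ u ∈ (Submodule.pi Set.univ U).map L.pi, L.b k u ∈ U k) (k : Fin n)
    {w : V} (hw : w ∈ U k) : L.a k w ∈ (Submodule.pi Set.univ U).map L.pi := by
  have hs : ∀ k, ∀ w ∈ U k,
      (L.P k.castSucc : End ℂ V) (L.a k w) ∈ (Submodule.pi Set.univ U).map L.pi := by
    intro k w hw
    refine ⟨Pi.single k w, ?_, L.pi_single k w⟩
    intro j _
    by_cases h : j = k
    · subst h; simpa using hw
    · simp [h]
  have hP : ∀ m, ∀ u ∈ (Submodule.pi Set.univ U).map L.pi,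
      (L.P m : End ℂ V) u ∈ (Submodule.pi Set.univ U).map L.pi := by
    intro m
    induction m using Fin.induction with
    | zero => simp [P_zero]
    | succ k ih =>
      intro u hu
      rw [P_succ_apply]
      exact add_mem (ih u hu) (hs k _ (hb k u hu))
  exact mem_of_unit_apply_mem _ (hP _) (hs k w hw)

/-- The maps of the reflected legs. -/
def bProd (k : Fin n) : End ℂ (V × (Fin n → V)) :=
  LinearMap.inl ℂ V (Fin n → V) ∘ₗ LinearMap.proj k ∘ₗ L.e ∘ₗ LinearMap.snd ℂ V (Fin n → V)

/-- The maps of the reflected legs, in the opposite direction. -/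
def aProd (k : Fin n) : End ℂ (V × (Fin n → V)) :=
  LinearMap.inr ℂ V (Fin n → V) ∘ₗ L.aRefl k ∘ₗ LinearMap.fst ℂ V (Fin n → V)

/-- The projection onto the new space of the reflected legs. -/
def eProd : End ℂ (V × (Fin n → V)) :=
  LinearMap.inr ℂ V (Fin n → V) ∘ₗ L.e ∘ₗ LinearMap.snd ℂ V (Fin n → V)

@[simp] theorem bProd_apply (k) (z : V × (Fin n → V)) : L.bProd k z = (L.e z.2 k, 0) := rfl
@[simp] theorem aProd_apply (k) (z : V × (Fin n → V)) : L.aProd k z = (0, L.aRefl k z.1) := rfl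
@[simp] theorem eProd_apply (z : V × (Fin n → V)) : L.eProd z = (0, L.e z.2) := rfl

theorem one_add_bProd_mul_aProd_apply (k) (z : V × (Fin n → V)) :
    (1 + L.bProd k * L.aProd k) z = (z.1 - L.F k z.1 + (L.q : ℂ) • L.y k z.1, z.2) := by
  rw [← aRefl_self]
  ext <;> simp [e_aRefl]

theorem isUnit_one_add_bProd (k) : IsUnit (1 + L.bProd k * L.aProd k) := by
  have hq : (L.q : ℂ) ≠ 0 := L.q.ne_zero
  have hyF : ∀ v, L.F k (L.y k v) = L.y k v := L.F_y k
  -- The operator is `q c⁻¹` on the image of `F k` and the identity on the complement and on the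
  -- second factor; this inverts each piece.
  let inv : End ℂ (V × (Fin n → V)) :=
    LinearMap.prodMap (1 - L.F k + (L.q : ℂ)⁻¹ • (L.F k * (L.c k : End ℂ V) * L.F k)) 1
  have hcy : ∀ v, (L.c k : End ℂ V) (L.y k v) = L.F k v := fun v => by rw [c_apply, c_y]
  have hyc : ∀ v, L.y k ((L.c k : End ℂ V) v) = L.F k v := by
    intro v
    have : L.y k * (L.c k : End ℂ V) = L.F k := by
      rw [y, c_inv_F, mul_assoc, Units.inv_mul, mul_one]
    exact LinearMap.congr_fun this v
  rw [isUnit_iff_exists]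
  refine ⟨inv, LinearMap.ext fun z => ?_, LinearMap.ext fun z => ?_⟩
  · rw [Module.End.mul_apply, one_add_bProd_mul_aProd_apply]
    ext1
    · simp only [inv, LinearMap.prodMap_apply, LinearMap.add_apply, LinearMap.sub_apply,
        LinearMap.smul_apply, Module.End.mul_apply, Module.End.one_apply, map_add, map_sub,
        map_smul, F_idem_apply, y_F, hyc]
      rw [sub_self (L.y k z.1), zero_add, smul_inv_smul₀ hq]
      module
    · rfl
  · rw [Module.End.mul_apply, one_add_bProd_mul_aProd_apply]
    ext1
    · simp only [inv, LinearMap.prodMap_apply, LinearMap.add_apply, LinearMap.sub_apply,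
        LinearMap.smul_apply, Module.End.mul_apply, Module.End.one_apply, map_add, map_sub,
        map_smul, F_idem_apply, hyF, hcy]
      rw [sub_self (L.y k z.1), zero_add, smul_inv_smul₀ hq]
      module
    · rfl

/-- If `i` inverts `1 + b a`, then `1 - a i b` inverts `1 + a b`. -/
theorem isUnit_one_add_aProd (k) : IsUnit (1 + L.aProd k * L.bProd k) := by
  obtain ⟨i, h1, h2⟩ := isUnit_iff_exists.mp (L.isUnit_one_add_bProd k)
  rw [isUnit_iff_exists]
  refine ⟨1 - L.aProd k * i * L.bProd k, ?_, ?_⟩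
  · have : (1 + L.aProd k * L.bProd k) * (1 - L.aProd k * i * L.bProd k) =
        1 + L.aProd k * (1 - (1 + L.bProd k * L.aProd k) * i) * L.bProd k := by
      simp only [mul_add, add_mul, mul_sub, sub_mul, mul_assoc, mul_one, one_mul]
      abel
    rw [this, h1, sub_self, mul_zero, zero_mul, add_zero]
  · have : (1 - L.aProd k * i * L.bProd k) * (1 + L.aProd k * L.bProd k) =
        1 + L.aProd k * (1 - i * (1 + L.bProd k * L.aProd k)) * L.bProd k := by
      simp only [mul_add, add_mul, mul_sub, sub_mul, mul_assoc, mul_one, one_mul]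
      abel
    rw [this, h2, sub_self, mul_zero, zero_mul, add_zero]

/-- The monodromies of the reflected legs. -/
def gProd (k : Fin n) : (End ℂ (V × (Fin n → V)))ˣ := (L.isUnit_one_add_aProd k).unit⁻¹

/-- The monodromies at the other ends of the reflected legs. -/
def cProd (k : Fin n) : (End ℂ (V × (Fin n → V)))ˣ := (L.isUnit_one_add_bProd k).unit

theorem cProd_val (k) : (L.cProd k : End ℂ (V × (Fin n → V))) = 1 + L.bProd k * L.aProd k := rfl

theorem gProd_inv_val (k) :
    ((L.gProd k)⁻¹ : (End ℂ (V × (Fin n → V)))ˣ).val = 1 + L.aProd k * L.bProd k := by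
  rw [gProd, inv_inv]; rfl

/-- By `Y_succ` the inverse of `gProd k` takes one `Y` to the next, so the partial products carry `Y
m x` back to `x`. At the end `Y` is `q x`, which is where the new scalar `q⁻¹` at the vertex comes
from. -/
theorem partialProd_gProd_apply (m) {x : Fin n → V} (hD : L.D x = x) (hx : L.pi x = 0) :
    L.e (L.Y m x) = L.Y m x ∧
      ((Fin.partialProd L.gProd m : (End ℂ (V × (Fin n → V)))ˣ) : End ℂ (V × (Fin n → V)))
        (0, L.Y m x) = (0, x) := by
  induction m using Fin.induction with
  | zero => simp [Y_zero, L.e_of_mem hD hx]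
  | succ k ih =>
    have h := L.Y_succ k hD
    refine ⟨?_, ?_⟩
    · rw [← h, map_add, ih.1, e_aRefl]
    · rw [Fin.partialProd_succ, Units.val_mul, Module.End.mul_apply]
      have : ((0, L.Y k.succ x) : V × (Fin n → V)) =
          ((L.gProd k)⁻¹ : (End ℂ (V × (Fin n → V)))ˣ).val (0, L.Y k.castSucc x) := by
        rw [gProd_inv_val, ← h]
        simp [ih.1]
      rw [this, ← Module.End.mul_apply (L.gProd k).val, Units.mul_inv]
      exact ih.2

theorem rel_eProd (hq : (L.q : ℂ) ≠ 1) :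
    ((Fin.partialProd L.gProd (Fin.last n) : (End ℂ (V × (Fin n → V)))ˣ) :
      End ℂ (V × (Fin n → V))) * L.eProd = ((L.q⁻¹ : ℂˣ) : ℂ) • L.eProd := by
  refine LinearMap.ext fun z => ?_
  have h := (L.partialProd_gProd_apply (Fin.last n) (L.D_e z.2) (L.pi_e hq z.2)).2
  rw [Y_last _ (L.pi_e hq z.2)] at h
  have h' : ((0, (L.q : ℂ) • L.e z.2) : V × (Fin n → V)) = (L.q : ℂ) • (0, L.e z.2) := by simp
  rw [h', map_smul] at h
  rw [Module.End.mul_apply, LinearMap.smul_apply, eProd_apply]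
  refine Eq.trans ?_ (congrArg (((L.q⁻¹ : ℂˣ) : ℂ) • ·) h)
  simp only [smul_smul, Units.inv_mul, one_smul]

theorem eProd_idem (hq : (L.q : ℂ) ≠ 1) : L.eProd * L.eProd = L.eProd :=
  LinearMap.ext fun z => by simp [L.e_of_mem (L.D_e z.2) (L.pi_e hq z.2)]

/-- The steps from `Y 0 x = x` to `Y n x = q x` add vectors in the images of the `aRefl k`, so `(q -
1) x` is a sum of such vectors. The new space is therefore generated by its neighbours. -/
theorem mem_of_aRefl_mem (hq : (L.q : ℂ) ≠ 1) {U : Submodule ℂ (Fin n → V)}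
    (hU : ∀ k v, L.F k v = v → L.aRefl k v ∈ U) {x : Fin n → V} (hD : L.D x = x)
    (hx : L.pi x = 0) : x ∈ U := by
  have key : ∀ m, L.Y m x - x ∈ U := by
    intro m
    induction m using Fin.induction with
    | zero => simp [Y_zero]
    | succ k ih =>
      rw [← L.Y_succ k hD, add_sub_right_comm]
      refine add_mem ih ?_
      rw [← L.aRefl_F]
      exact hU k _ (L.F_idem_apply _ _)
  have h := key (Fin.last n)
  rw [Y_last _ hx, show (L.q : ℂ) • x - x = ((L.q : ℂ) - 1) • x by module] at h
  exact (U.smul_mem_iff (sub_ne_zero.mpr hq)).mp h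

/-- Stability under the reflected composites is converted back to the original ones. The diagonal
composite plus the identity is `q y`, so `U k` is stable under the inverse of `c k` and hence under
`c k`. This gives stability under all `b j * a k`, and partial products can then be inserted one
factor at a time. -/
theorem b_pi_mem [FiniteDimensional ℂ V] (U : Fin n → Submodule ℂ V)
    (hF : ∀ k, ∀ u ∈ U k, L.F k u = u)
    (h : ∀ j k, ∀ u ∈ U k, L.aRefl k u j ∈ U j) (j : Fin n)
    {u : V} (hu : u ∈ (Submodule.pi Set.univ U).map L.pi) : L.b j u ∈ U j := by
  have hq : (L.q : ℂ) ≠ 0 := L.q.ne_zero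
  have hy : ∀ k, ∀ u ∈ U k, L.y k u ∈ U k := by
    intro k u hu
    have h1 := add_mem hu (h k k u hu)
    rw [aRefl_self, hF k u hu, sub_self, zero_add] at h1
    exact ((U k).smul_mem_iff hq).mp h1
  have hba' : ∀ j k, ∀ u ∈ U k, L.b j (L.a k (L.y k u)) ∈ U j := by
    intro j k u hu
    have h1 := h j k u hu
    rw [aRefl_apply] at h1
    have h2 : (if j < k then -(L.q : ℂ) else -1) • L.b j (L.a k (L.y k u)) ∈ U j := by
      by_cases hjk : j = k
      · subst hjk
        rw [if_pos rfl] at h1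
        exact ((U j).add_mem_iff_left ((U j).smul_mem _ (hy j u hu))).mp h1
      · rwa [if_neg hjk, add_zero] at h1
    refine ((U j).smul_mem_iff ?_).mp h2
    split_ifs
    · simp
    · simp
  have hba : ∀ j k, ∀ u ∈ U k, L.b j (L.a k u) ∈ U j := by
    intro j k u hu
    have h1 : ∀ u ∈ U k, ((L.c k)⁻¹ : (End ℂ V)ˣ).val u ∈ U k := by
      intro u hu
      have := hy k u hu
      rwa [y, Module.End.mul_apply, hF k u hu] at this
    have h2 : (L.c k : End ℂ V) u ∈ U k := by
      have := unit_inv_mem _ h1 hu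
      rwa [inv_inv] at this
    have h3 := hba' j k _ h2
    have h4 : L.y k ((L.c k : End ℂ V) u) = u := by
      rw [y, c_inv_F, Module.End.mul_apply, ← Module.End.mul_apply _ (L.c k).val, Units.inv_mul,
        Module.End.one_apply, hF k u hu]
    rwa [h4] at h3
  have hP : ∀ m j k, ∀ u ∈ U k, L.b j ((L.P m : End ℂ V) (L.a k u)) ∈ U j := by
    intro m
    induction m using Fin.induction with
    | zero => simpa only [P_zero, Units.val_one, Module.End.one_apply] using hba
    | succ i ih =>
      intro j k u hu
      rw [P_succ_apply, map_add]
      exact add_mem (ih j k u hu) (ih j i _ (hba i k u hu))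
  obtain ⟨x, hx, rfl⟩ := hu
  rw [pi_eq_sum, map_sum]
  exact sum_mem fun k _ => hP _ _ _ _ (hx k (Set.mem_univ k))

/-- The restriction of `pi` to the sum of the images of the `F k`. -/
def piRange : (∀ k, LinearMap.range (L.F k)) →ₗ[ℂ] LinearMap.range L.E₀ :=
  LinearMap.codRestrict _
    (L.pi ∘ₗ LinearMap.pi fun k => (LinearMap.range (L.F k)).subtype ∘ₗ LinearMap.proj k)
    fun _ => ⟨_, L.E₀_pi _⟩

theorem F_apply_of_mem_range (k) {v : V} (hv : v ∈ LinearMap.range (L.F k)) : L.F k v = v := by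
  obtain ⟨u, rfl⟩ := hv
  exact L.F_idem_apply k u

theorem E₀_apply_of_mem_range {v : V} (hv : v ∈ LinearMap.range L.E₀) : L.E₀ v = v := by
  obtain ⟨u, rfl⟩ := hv
  exact L.E₀_idem_apply u

/-- Rank-nullity for `pi` on the sum of the images of the `F k`. It is onto because `(q - 1)⁻¹ iota`
is a section, and its kernel is the new space. -/
theorem finrank_range_eProd [FiniteDimensional ℂ V] (hq : (L.q : ℂ) ≠ 1) :
    finrank ℂ (LinearMap.range L.eProd) + finrank ℂ (LinearMap.range L.E₀) =
      ∑ k, finrank ℂ (LinearMap.range (L.F k)) := by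
  have hsurj : Function.Surjective L.piRange := by
    rintro ⟨v, hv⟩
    have hv' := L.E₀_apply_of_mem_range hv
    refine ⟨fun k => ⟨((L.q : ℂ) - 1)⁻¹ • L.b k v, ⟨((L.q : ℂ) - 1)⁻¹ • L.b k v, ?_⟩⟩, ?_⟩
    · rw [map_smul, F_b_apply]
    · apply Subtype.ext
      change L.pi (((L.q : ℂ) - 1)⁻¹ • L.iota v) = v
      rw [map_smul, L.pi_iota v hv', smul_smul, inv_mul_cancel₀ (sub_ne_zero.mpr hq), one_smul]
  have h1 := L.piRange.finrank_range_add_finrank_ker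
  rw [LinearMap.range_eq_top.mpr hsurj, finrank_top, finrank_pi_fintype] at h1
  rw [← h1, add_comm]
  congr 1
  let f : LinearMap.ker L.piRange →ₗ[ℂ] (V × (Fin n → V)) :=
    LinearMap.inr ℂ V (Fin n → V) ∘ₗ
      (LinearMap.pi fun k => (LinearMap.range (L.F k)).subtype ∘ₗ LinearMap.proj k) ∘ₗ
      (LinearMap.ker L.piRange).subtype
  have hf : Function.Injective f := by
    intro x y hxy
    apply Subtype.ext
    funext k
    apply Subtype.ext
    exact congrFun (congrArg Prod.snd hxy) k
  rw [← LinearMap.finrank_range_of_inj hf]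
  suffices hr : LinearMap.range L.eProd = LinearMap.range f by rw [hr]
  ext z
  constructor
  · rintro ⟨z, rfl⟩
    have hD := L.D_e z.2
    refine ⟨⟨fun k => ⟨L.e z.2 k, ⟨L.e z.2 k, congrFun hD k⟩⟩, ?_⟩, rfl⟩
    rw [LinearMap.mem_ker]
    exact Subtype.ext (L.pi_e hq z.2)
  · rintro ⟨x, rfl⟩
    refine ⟨f x, ?_⟩
    rw [eProd_apply]
    refine congrArg _ (L.e_of_mem ?_ (congrArg Subtype.val x.2))
    ext k
    exact L.F_apply_of_mem_range k (x.1 k).2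

/-- For `q = 1` the composite of `iota` and `pi` vanishes, so the injective `iota` embeds the space
at the vertex in the kernel of the surjective `pi`. -/
theorem finrank_range_le [FiniteDimensional ℂ V]
    (hi : ∀ v, L.E₀ v = v → (∀ k, L.b k v = 0) → v = 0)
    (hs : ∀ v, L.E₀ v = v → ∃ x, L.pi x = v) (hq : (L.q : ℂ) = 1) :
    2 * finrank ℂ (LinearMap.range L.E₀) ≤ ∑ k, finrank ℂ (LinearMap.range (L.F k)) := by
  have hsurj : Function.Surjective L.piRange := by
    rintro ⟨v, hv⟩
    obtain ⟨x, hx⟩ := hs v (L.E₀_apply_of_mem_range hv)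
    refine ⟨fun k => ⟨L.F k (x k), ⟨_, rfl⟩⟩, Subtype.ext ?_⟩
    change L.pi (L.D x) = v
    rw [pi, S_D]
    exact hx
  have h1 := L.piRange.finrank_range_add_finrank_ker
  rw [LinearMap.range_eq_top.mpr hsurj, finrank_top, finrank_pi_fintype] at h1
  rw [← h1, two_mul]
  gcongr
  let f : LinearMap.range L.E₀ →ₗ[ℂ] LinearMap.ker L.piRange :=
    LinearMap.codRestrict _ (LinearMap.pi fun k => LinearMap.codRestrict (LinearMap.range (L.F k))
      (L.b k ∘ₗ (LinearMap.range L.E₀).subtype) fun v => ⟨_, L.F_b_apply k _⟩) (by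
        intro v
        rw [LinearMap.mem_ker]
        apply Subtype.ext
        change L.pi (L.iota v) = 0
        rw [L.pi_iota _ (L.E₀_apply_of_mem_range v.2), hq, sub_self, zero_smul])
  refine LinearMap.finrank_le_finrank_of_injective (f := f) ?_
  rw [← LinearMap.ker_eq_bot, LinearMap.ker_eq_bot']
  intro v hv
  apply Subtype.ext
  refine hi v (L.E₀_apply_of_mem_range v.2) fun k => ?_
  exact congrArg Subtype.val (congrFun (congrArg Subtype.val hv) k)

end Legs

/-! ### Representations with scalar monodromy at every vertex -/

section Systems

variable {I : Type u} {H : Type v}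

/-- A representation of the double of a quiver with vertices `I`, half-edges `H`, tails `tl` and
involution `st` on a space `V` (the space at the vertex `i` being the image of the idempotent
`E i`), such that at every vertex `j` the ordered product of the monodromies of the half-edges with
tail `j` is the scalar `q j`. -/
structure System (tl : H → I) (st : H → H) (ord : List H) (V : Type w) [AddCommGroup V]
    [Module ℂ V] where
  E : I → End ℂ V
  x : H → End ℂ V
  g : H → (End ℂ V)ˣ
  q : I → ℂˣ
  idem : ∀ j, E j * E j = E j
  tail_mul : ∀ h, E (tl h) * x h = x h
  mul_head : ∀ h, x h * E (tl (st h)) = x h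
  mono : ∀ h,
    ((g h : End ℂ V) = 1 + x h * x (st h) ∧
      ((g (st h))⁻¹ : (End ℂ V)ˣ).val = 1 + x (st h) * x h) ∨
    ((g (st h) : End ℂ V) = 1 + x (st h) * x h ∧
      ((g h)⁻¹ : (End ℂ V)ˣ).val = 1 + x h * x (st h))
  rel : ∀ j, ∀ l : List H, l.Sublist ord → (∀ h, h ∈ l ↔ tl h = j) →
    ((l.map g).prod : (End ℂ V)ˣ).val * E j = (q j : ℂ) • E j

namespace System

variable {tl : H → I} {st : H → H} {ord : List H} {V : Type w} [AddCommGroup V] [Module ℂ V]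

/-- The stable families of subspaces. -/
def IsStable (S : System tl st ord V) (U : I → Submodule ℂ V) : Prop :=
  (∀ j, U j ≤ LinearMap.range (S.E j)) ∧ ∀ h, ∀ u ∈ U (tl (st h)), S.x h u ∈ U (tl h)

/-- A system is simple if it is nonzero and has no proper nonzero stable families. -/
def IsSimple (S : System tl st ord V) : Prop :=
  (∃ j, S.E j ≠ 0) ∧ ∀ U, S.IsStable U → (∀ j, U j = ⊥) ∨ ∀ j, U j = LinearMap.range (S.E j)

/-- The dimension vector of a system. -/
def dim (S : System tl st ord V) (j : I) : ℤ := finrank ℂ (LinearMap.range (S.E j))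

variable (S : System tl st ord V)

theorem E_apply_of_mem {j : I} {v : V} (hv : v ∈ LinearMap.range (S.E j)) : S.E j v = v := by
  obtain ⟨u, rfl⟩ := hv
  exact LinearMap.congr_fun (S.idem j) u

/-- This removes the sign `ε`. If the monodromy is the inverse of `1 + x y`, then `a = -x` and `b =
y g` give `1 + a b = g`, and `1 + b a` is the inverse of the monodromy at the other end. Since `g`
and its inverse preserve the same subspaces, stability is unaffected. -/
theorem exists_pair [FiniteDimensional ℂ V] (hst : ∀ h, st (st h) = h) (h : H) :
    ∃ a b : End ℂ V, S.E (tl h) * a = a ∧ a * S.E (tl (st h)) = a ∧ S.E (tl (st h)) * b = b ∧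
      b * S.E (tl h) = b ∧ (S.g h : End ℂ V) = 1 + a * b ∧
      ((S.g (st h))⁻¹ : (End ℂ V)ˣ).val = 1 + b * a ∧
      ∀ U₁ U₂ : Submodule ℂ V, ((∀ u ∈ U₂, a u ∈ U₁) ∧ ∀ u ∈ U₁, b u ∈ U₂) ↔
        ((∀ u ∈ U₂, S.x h u ∈ U₁) ∧ ∀ u ∈ U₁, S.x (st h) u ∈ U₂) := by
  have t1 := S.tail_mul h
  have t2 := S.mul_head h
  have t3 := S.tail_mul (st h)
  have t4 := S.mul_head (st h)
  rw [hst] at t4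
  rcases S.mono h with ⟨h1, h2⟩ | ⟨h1, h2⟩
  · exact ⟨S.x h, S.x (st h), t1, t2, t3, t4, h1, h2, fun _ _ => Iff.rfl⟩
  · set x := S.x h
    set y := S.x (st h)
    set g := S.g h
    set c := S.g (st h)
    have e1 : x * c.val = (g⁻¹).val * x := by rw [h1, h2]; simp [mul_add, add_mul, mul_assoc]
    have e2 : c.val * y = y * (g⁻¹).val := by rw [h1, h2]; simp [mul_add, add_mul, mul_assoc]
    have e3 : y * g.val = (c⁻¹).val * y := by
      rw [Units.eq_inv_mul_iff_mul_eq, ← mul_assoc, e2, mul_assoc, Units.inv_mul, mul_one]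
    have e4 : S.E (tl h) * (g⁻¹).val = (g⁻¹).val * S.E (tl h) := by
      rw [h2]
      simp only [mul_add, add_mul, mul_one, one_mul]
      rw [← mul_assoc, t1, mul_assoc, t4]
    have e5 : S.E (tl h) * g.val = g.val * S.E (tl h) := by
      rw [← Units.inv_mul_eq_iff_eq_mul, ← mul_assoc, ← e4, mul_assoc, Units.inv_mul, mul_one]
    refine ⟨-x, y * g.val, by rw [mul_neg, t1], by rw [neg_mul, t2],
      by rw [← mul_assoc, t3], by rw [mul_assoc, ← e5, ← mul_assoc, t4], ?_, ?_, ?_⟩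
    · have h3 : x * y = (g⁻¹).val - 1 := by rw [h2]; abel
      rw [neg_mul, ← mul_assoc, h3, sub_mul, Units.inv_mul, one_mul]
      abel
    · have h3 : y * x = c.val - 1 := by rw [h1]; abel
      rw [mul_neg, e3, mul_assoc, h3, mul_sub, Units.inv_mul, mul_one]
      abel
    · intro U₁ U₂
      have hg : (∀ u ∈ U₂, x u ∈ U₁) → (∀ u ∈ U₁, y u ∈ U₂) →
          ∀ u ∈ U₁, (g⁻¹).val u ∈ U₁ := by
        intro hx hy u hu
        rw [h2]
        exact add_mem hu (hx _ (hy _ hu))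
      have hg' : (∀ u ∈ U₂, x u ∈ U₁) → (∀ u ∈ U₁, y (g.val u) ∈ U₂) →
          ∀ u ∈ U₁, g.val u ∈ U₁ := by
        intro hx hy u hu
        have h3 : g.val = 1 - x * (y * g.val) := by
          have h3 : x * y = (g⁻¹).val - 1 := by rw [h2]; abel
          rw [← mul_assoc, h3, sub_mul, Units.inv_mul, one_mul]
          abel
        rw [h3]
        exact sub_mem hu (hx _ (hy _ hu))
      constructor
      · rintro ⟨hx, hy⟩
        have hx' : ∀ u ∈ U₂, x u ∈ U₁ := fun u hu => by simpa using hx u hu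
        refine ⟨hx', fun u hu => ?_⟩
        have := hy _ (Legs.unit_inv_mem g (hg' hx' hy) hu)
        simpa [← Module.End.mul_apply, mul_assoc] using this
      · rintro ⟨hx, hy⟩
        refine ⟨fun u hu => by simpa using hx u hu, fun u hu => hy _ ?_⟩
        have := Legs.unit_inv_mem _ (hg hx hy) hu
        rwa [inv_inv] at this

theorem E_mul_g (hst : ∀ h, st (st h) = h) (h : H) :
    S.E (tl h) * (S.g h).val = (S.g h).val * S.E (tl h) := by
  have t1 := S.tail_mul h
  have t4 := S.mul_head (st h)
  rw [hst] at t4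
  have t5 : S.E (tl h) * (1 + S.x h * S.x (st h)) = (1 + S.x h * S.x (st h)) * S.E (tl h) := by
    simp only [mul_add, add_mul, mul_one, one_mul]
    rw [← mul_assoc, t1, mul_assoc, t4]
  rcases S.mono h with ⟨h1, h2⟩ | ⟨h1, h2⟩
  · rw [h1, t5]
  · rw [← h2] at t5
    rw [← Units.inv_mul_eq_iff_eq_mul, ← mul_assoc, ← t5, mul_assoc, Units.inv_mul, mul_one]

/-- The half-edges at a vertex `i`, together with a choice of factorizations of their
monodromies. -/
structure Star (S : System tl st ord V) (i : I) where
  n : ℕ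
  κ : Fin n → H
  κ_inj : Function.Injective κ
  κ_range : ∀ h, tl h = i ↔ ∃ k, κ k = h
  κ_sublist : ∀ l : List H, l.Sublist ord → (∀ h, h ∈ l ↔ tl h = i) → l = List.ofFn κ
  L : Legs V n
  E₀_eq : L.E₀ = S.E i
  F_eq : ∀ k, L.F k = S.E (tl (st (κ k)))
  g_eq : ∀ k, L.g k = S.g (κ k)
  c_eq : ∀ k, L.c k = (S.g (st (κ k)))⁻¹
  q_eq : L.q = S.q i
  stable_iff : ∀ k, ∀ U₁ U₂ : Submodule ℂ V,
    ((∀ u ∈ U₂, L.a k u ∈ U₁) ∧ ∀ u ∈ U₁, L.b k u ∈ U₂) ↔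
      ((∀ u ∈ U₂, S.x (κ k) u ∈ U₁) ∧ ∀ u ∈ U₁, S.x (st (κ k)) u ∈ U₂)

theorem partialProd_last {M : Type*} [Monoid M] {n : ℕ} (f : Fin n → M) :
    Fin.partialProd f (Fin.last n) = (List.ofFn f).prod := by
  rw [Fin.partialProd, List.take_of_length_le (by simp)]

/-- Filtering `ord` by the tail lists the half-edges at `i` in their order, and `exists_pair` puts
all of them in the uniform shape `1 + a b`. Since `ord` has no repetitions, this list is the only
one to which the relation at `i` can refer. -/
theorem nonempty_star [FiniteDimensional ℂ V] (hst : ∀ h, st (st h) = h) (hnd : ord.Nodup)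
    (hall : ∀ h, h ∈ ord) (i : I) : Nonempty (S.Star i) := by
  classical
  set l := ord.filter (fun h => tl h = i) with hl
  have hmem : ∀ h, h ∈ l ↔ tl h = i := by simp [hl, hall]
  have hlnd : l.Nodup := hnd.filter _
  choose a b h1 h2 h3 h4 h5 h6 h7 using S.exists_pair hst
  have ht : ∀ k, tl (l.get k) = i := fun k => (hmem _).mp (l.get_mem k)
  have hrel := S.rel i l List.filter_sublist hmem
  refine ⟨⟨l.length, l.get, List.nodup_iff_injective_get.mp hlnd, ?_, ?_,
    ⟨S.E i, fun k => S.E (tl (st (l.get k))), fun k => a (l.get k), fun k => b (l.get k),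
      fun k => S.g (l.get k), fun k => (S.g (st (l.get k)))⁻¹, S.q i, S.idem i, fun k => S.idem _,
      fun k => ?_, fun k => h2 _, fun k => h3 _, fun k => ?_, fun k => h5 _, fun k => h6 _, ?_⟩,
    rfl, fun _ => rfl, fun _ => rfl, fun _ => rfl, rfl, fun k => h7 _⟩⟩
  · intro h
    rw [← hmem, List.mem_iff_get]
  · intro l' hl' hm
    rw [List.ofFn_get]
    have : l' = l'.filter (fun h => tl h = i) := by
      rw [eq_comm, List.filter_eq_self]
      intro h hh
      simpa using (hm h).mp hh
    have h' : l'.Sublist l := by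
      rw [this]; exact hl'.filter _
    refine h'.eq_of_length_le ?_
    refine List.Subperm.length_le (hlnd.subperm ?_)
    intro h hh
    exact (hm h).mpr ((hmem h).mp hh)
  · have := h1 (l.get k)
    rwa [ht k] at this
  · have := h4 (l.get k)
    rwa [ht k] at this
  · rw [partialProd_last]
    have : List.ofFn (fun k => S.g (l.get k)) = l.map S.g := by
      rw [show (fun k => S.g (l.get k)) = S.g ∘ l.get from rfl, ← List.map_ofFn, List.ofFn_get]
    rw [this]
    exact hrel

end System
end Systems

/-! ### Construction of the reflected system -/

namespace System

variable {I : Type u} {H : Type v}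
variable {tl : H → I} {st : H → H} {ord : List H} {V : Type w} [AddCommGroup V] [Module ℂ V]
variable {S : System tl st ord V} {i : I}

theorem unit_apply_inv_apply (f : (End ℂ V)ˣ) (v : V) : f.val ((f⁻¹).val v) = v := by
  rw [← Module.End.mul_apply, Units.mul_inv, Module.End.one_apply]

theorem unit_inv_apply_apply (f : (End ℂ V)ˣ) (v : V) : (f⁻¹).val (f.val v) = v := by
  rw [← Module.End.mul_apply, Units.inv_mul, Module.End.one_apply]

/-- The extension of an automorphism by the identity. -/
def prodOne (X : Type*) [AddCommGroup X] [Module ℂ X] (f : (End ℂ V)ˣ) : (End ℂ (V × X))ˣ where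
  val := LinearMap.prodMap f.val 1
  inv := LinearMap.prodMap (f⁻¹).val 1
  val_inv := LinearMap.ext fun z => Prod.ext (unit_apply_inv_apply f z.1) rfl
  inv_val := LinearMap.ext fun z => Prod.ext (unit_inv_apply_apply f z.1) rfl

theorem prodOne_apply (X : Type*) [AddCommGroup X] [Module ℂ X] (f : (End ℂ V)ˣ) (z : V × X) :
    (prodOne X f).val z = (f.val z.1, z.2) := rfl

theorem E_idem_apply (S : System tl st ord V) (j : I) (v : V) : S.E j (S.E j v) = S.E j v :=
  LinearMap.congr_fun (S.idem j) v

theorem tail_mul_apply (S : System tl st ord V) (h : H) (v : V) :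
    S.E (tl h) (S.x h v) = S.x h v := LinearMap.congr_fun (S.tail_mul h) v

theorem mul_head_apply (S : System tl st ord V) (h : H) (v : V) :
    S.x h (S.E (tl (st h)) v) = S.x h v := LinearMap.congr_fun (S.mul_head h) v

namespace Star

variable (T : S.Star i)

open Classical in
/-- The idempotents of the reflected system. -/
def reflE (j : I) : End ℂ (V × (Fin T.n → V)) :=
  if j = i then T.L.eProd else LinearMap.prodMap (S.E j) 0

/-- The family which agrees with `f` on the half-edges at `i`, with `f'` on their opposites, and
with `f''` on all others. -/
def glue {A : Type*} (f f' : Fin T.n → A) (f'' : H → A) (h : H) : A :=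
  Function.extend T.κ f (Function.extend (st ∘ T.κ) f' f'') h

theorem glue_κ {A : Type*} (f f' : Fin T.n → A) (f'' : H → A) (k : Fin T.n) :
    T.glue f f' f'' (T.κ k) = f k :=
  T.κ_inj.extend_apply _ _ _

theorem tl_κ (k : Fin T.n) : tl (T.κ k) = i := (T.κ_range _).mpr ⟨k, rfl⟩

theorem glue_st_κ {A : Type*} (f f' : Fin T.n → A) (f'' : H → A) (hst : ∀ h, st (st h) = h)
    (hloop : ∀ h, tl h = i → tl (st h) ≠ i) (k : Fin T.n) :
    T.glue f f' f'' (st (T.κ k)) = f' k := by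
  rw [glue, Function.extend_apply' _ _ _ (fun h => hloop _ (T.tl_κ k) ((T.κ_range _).mpr h))]
  exact Function.Injective.extend_apply
    ((Function.Involutive.injective hst).comp T.κ_inj) _ _ k

theorem glue_other {A : Type*} (f f' : Fin T.n → A) (f'' : H → A) (hst : ∀ h, st (st h) = h)
    {h : H} (h1 : tl h ≠ i) (h2 : tl (st h) ≠ i) :
    T.glue f f' f'' h = f'' h := by
  rw [glue, Function.extend_apply' _ _ _ (fun h' => h1 ((T.κ_range _).mpr h')),
    Function.extend_apply']
  rintro ⟨k, rfl⟩
  refine h2 ?_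
  rw [Function.comp_apply, hst, T.tl_κ]

theorem cases (hst : ∀ h, st (st h) = h) (h : H) :
    (∃ k, h = T.κ k) ∨ (∃ k, h = st (T.κ k)) ∨ (tl h ≠ i ∧ tl (st h) ≠ i) := by
  by_cases h1 : tl h = i
  · obtain ⟨k, hk⟩ := (T.κ_range h).mp h1
    exact Or.inl ⟨k, hk.symm⟩
  by_cases h2 : tl (st h) = i
  · obtain ⟨k, hk⟩ := (T.κ_range _).mp h2
    exact Or.inr (Or.inl ⟨k, by rw [hk, hst]⟩)
  exact Or.inr (Or.inr ⟨h1, h2⟩)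

/-- The monodromies of the reflected system. -/
def reflG : H → (End ℂ (V × (Fin T.n → V)))ˣ :=
  T.glue T.L.gProd T.L.cProd fun h => prodOne _ (S.g h)

theorem reflE_self : T.reflE i = T.L.eProd := if_pos rfl

theorem reflE_of_ne {j : I} (h : j ≠ i) : T.reflE j = LinearMap.prodMap (S.E j) 0 := if_neg h

/-- Going through the half-edges at `j ≠ i`, those that lead to `i` contribute a factor `T.L.q` each
and the others none. Hence the total monodromy at `j` changes by a scalar only. -/
theorem prod_reflG (hst : ∀ h, st (st h) = h)
    (hloop : ∀ h, tl h = i → tl (st h) ≠ i) {j : I} (hj : j ≠ i) (l : List H)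
    (hl : ∀ h ∈ l, tl h = j) :
    ∃ d : ℂˣ, ∀ v : V, S.E j ((l.map S.g).prod.val (S.E j v)) = (l.map S.g).prod.val (S.E j v) ∧
      (l.map T.reflG).prod.val (S.E j v, 0) = (d : ℂ) • ((l.map S.g).prod.val (S.E j v), 0) := by
  induction l with
  | nil => exact ⟨1, fun v => by simp [E_idem_apply]⟩
  | cons h l ih =>
    obtain ⟨d, hd⟩ := ih fun h' hh' => hl h' (List.mem_cons_of_mem _ hh')
    have hh := hl h List.mem_cons_self
    have hE := fun v => LinearMap.congr_fun (S.E_mul_g hst h) v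
    simp only [Module.End.mul_apply, hh] at hE
    obtain ⟨c, hc⟩ : ∃ c : ℂˣ, ∀ v, S.E j v = v →
        (T.reflG h).val (v, 0) = (c : ℂ) • ((S.g h).val v, 0) := by
      rcases T.cases hst h with ⟨k, rfl⟩ | ⟨k, rfl⟩ | ⟨h1, h2⟩
      · exact absurd ((T.tl_κ k).symm.trans hh) hj.symm
      · refine ⟨T.L.q, fun v hv => ?_⟩
        rw [reflG, glue_st_κ T _ _ _ hst hloop, Legs.cProd_val, Legs.one_add_bProd_mul_aProd_apply]
        have h1 : T.L.F k v = v := by rw [T.F_eq, hh, hv]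
        simp only [h1, sub_self, zero_add, Legs.y, Module.End.mul_apply, T.c_eq, inv_inv]
        ext <;> simp
      · refine ⟨1, fun v _ => ?_⟩
        rw [reflG, glue_other T _ _ _ hst h1 h2, prodOne_apply]
        simp
    refine ⟨d * c, fun v => ⟨?_, ?_⟩⟩
    · simp only [List.map_cons, List.prod_cons, Units.val_mul, Module.End.mul_apply]
      rw [hE, (hd v).1]
    · simp only [List.map_cons, List.prod_cons, Units.val_mul, Module.End.mul_apply]
      rw [(hd v).2, map_smul, hc _ (hd v).1, smul_smul]

/-- The reflection of a system at a loop-free vertex. -/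
theorem exists_reflect [FiniteDimensional ℂ V] (hst : ∀ h, st (st h) = h)
    (hnd : ord.Nodup) (hall : ∀ h, h ∈ ord)
    (hloop : ∀ h, tl h = i → tl (st h) ≠ i) (hq : (S.q i : ℂ) ≠ 1) :
    ∃ S' : System tl st ord (V × (Fin T.n → V)), S'.E = T.reflE ∧
      S'.x = T.glue T.L.aProd T.L.bProd fun h => LinearMap.prodMap (S.x h) 0 := by
  have hq' : (T.L.q : ℂ) ≠ 1 := by rwa [T.q_eq]
  -- The new parameter is the inverse of the old one at `i`, and a scalar multiple of the old one
  -- elsewhere. Its value is not recorded, since the root argument works for every parameter.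
  have hrel : ∀ j, ∃ c : ℂˣ, ∀ l : List H, l.Sublist ord → (∀ h, h ∈ l ↔ tl h = j) →
      (l.map T.reflG).prod.val * T.reflE j = (c : ℂ) • T.reflE j := by
    intro j
    by_cases hj : j = i
    · subst hj
      refine ⟨T.L.q⁻¹, fun l hl hm => ?_⟩
      rw [T.κ_sublist l hl hm, reflE_self, List.map_ofFn,
        show T.reflG ∘ T.κ = T.L.gProd from funext fun k => T.glue_κ _ _ _ k,
        ← partialProd_last]
      exact T.L.rel_eProd hq'
    · obtain ⟨Tj⟩ := S.nonempty_star hst hnd hall j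
      have hmem : ∀ h, h ∈ List.ofFn Tj.κ ↔ tl h = j := by
        intro h
        rw [Tj.κ_range, List.mem_ofFn]
      obtain ⟨d, hd⟩ := T.prod_reflG hst hloop hj (List.ofFn Tj.κ) fun h hh => (hmem h).mp hh
      refine ⟨d * S.q j, fun l hl hm => LinearMap.ext fun z => ?_⟩
      have h1 := LinearMap.congr_fun (S.rel j l hl hm) z.1
      rw [Tj.κ_sublist l hl hm] at h1 ⊢
      rw [Module.End.mul_apply, T.reflE_of_ne hj, LinearMap.prodMap_apply, LinearMap.zero_apply,
        (hd z.1).2, ← Module.End.mul_apply, h1]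
      ext <;> simp [smul_smul]
  choose q' hq'' using hrel
  refine ⟨⟨T.reflE, T.glue T.L.aProd T.L.bProd fun h => LinearMap.prodMap (S.x h) 0, T.reflG, q',
    ?_, ?_, ?_, ?_, hq''⟩, rfl, rfl⟩
  · intro j
    by_cases hj : j = i
    · subst hj
      rw [reflE_self]
      exact T.L.eProd_idem hq'
    · rw [T.reflE_of_ne hj]
      exact LinearMap.ext fun z => Prod.ext (S.E_idem_apply j z.1) rfl
  · intro h
    rcases T.cases hst h with ⟨k, rfl⟩ | ⟨k, rfl⟩ | ⟨h1, h2⟩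
    · rw [T.tl_κ, reflE_self, glue_κ]
      exact LinearMap.ext fun z => by simp [Legs.e_aRefl]
    · rw [T.reflE_of_ne (hloop _ (T.tl_κ k)), T.glue_st_κ _ _ _ hst hloop]
      refine LinearMap.ext fun z => Prod.ext ?_ rfl
      have h1 := congrFun (T.L.D_e z.2) k
      rw [Legs.D_apply, T.F_eq] at h1
      exact h1
    · rw [T.reflE_of_ne h1, T.glue_other _ _ _ hst h1 h2]
      exact LinearMap.ext fun z => Prod.ext (S.tail_mul_apply h z.1) rfl
  · intro h
    rcases T.cases hst h with ⟨k, rfl⟩ | ⟨k, rfl⟩ | ⟨h1, h2⟩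
    · rw [T.reflE_of_ne (hloop _ (T.tl_κ k)), T.glue_κ, ← T.F_eq]
      exact LinearMap.ext fun z => Prod.ext rfl (T.L.aRefl_F k z.1)
    · rw [hst, T.tl_κ, reflE_self, T.glue_st_κ _ _ _ hst hloop]
      refine LinearMap.ext fun z => Prod.ext ?_ rfl
      simp [T.L.e_of_mem (T.L.D_e z.2) (T.L.pi_e hq' z.2)]
    · rw [T.reflE_of_ne h2, T.glue_other _ _ _ hst h1 h2]
      exact LinearMap.ext fun z => Prod.ext (S.mul_head_apply h z.1) rfl
  · intro h
    rcases T.cases hst h with ⟨k, rfl⟩ | ⟨k, rfl⟩ | ⟨h1, h2⟩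
    -- At `i` the reflected monodromy is the inverse of `1 + a b`, so the uninverted factor now sits
    -- at the other end of the leg.
    · right
      simp only [reflG, glue_κ, T.glue_st_κ _ _ _ hst hloop]
      exact ⟨T.L.cProd_val k, T.L.gProd_inv_val k⟩
    · left
      simp only [hst, reflG, glue_κ, T.glue_st_κ _ _ _ hst hloop]
      exact ⟨T.L.cProd_val k, T.L.gProd_inv_val k⟩
    · have h2' : tl (st (st h)) ≠ i := by rwa [hst]
      simp only [reflG, T.glue_other _ _ _ hst h1 h2, T.glue_other _ _ _ hst h2 h2']
      refine (S.mono h).imp ?_ ?_ <;>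
      · rintro ⟨e1, e2⟩
        refine ⟨LinearMap.ext fun z => Prod.ext ?_ ?_, LinearMap.ext fun z => Prod.ext ?_ ?_⟩
        · exact LinearMap.congr_fun e1 z.1
        · exact (add_zero _).symm
        · exact LinearMap.congr_fun e2 z.1
        · exact (add_zero _).symm

end Star
end System

/-! ### Simplicity and dimension under reflection -/

namespace System

variable {I : Type u} {H : Type v}
variable {tl : H → I} {st : H → H} {ord : List H} {V : Type w} [AddCommGroup V] [Module ℂ V]
variable {S : System tl st ord V} {i : I}

namespace Star

variable (T : S.Star i)

/-- A stable family of the reflected system determines one of the original system, which must be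
zero or everything away from `i`. At `i` there is then no freedom: a vector of the new space is zero
if all its components are, and the new space is generated from the neighbours by `mem_of_aRefl_mem`.
-/
theorem isSimple_of_reflect [FiniteDimensional ℂ V] (hst : ∀ h, st (st h) = h)
    (hloop : ∀ h, tl h = i → tl (st h) ≠ i) (hq : (S.q i : ℂ) ≠ 1) (hS : S.IsSimple)
    (S' : System tl st ord (V × (Fin T.n → V))) (hE : S'.E = T.reflE)
    (hx : S'.x = T.glue T.L.aProd T.L.bProd fun h => LinearMap.prodMap (S.x h) 0) :
    S'.IsSimple := by
  classical
  have hq' : (T.L.q : ℂ) ≠ 1 := by rwa [T.q_eq]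
  have hEne : ∀ j, j ≠ i → S'.E j = LinearMap.prodMap (S.E j) 0 := fun j hj => by
    rw [hE, T.reflE_of_ne hj]
  have hEi : S'.E i = T.L.eProd := by rw [hE, reflE_self]
  have hxa : ∀ k, S'.x (T.κ k) = T.L.aProd k := fun k => by rw [hx, glue_κ]
  have hxb : ∀ k, S'.x (st (T.κ k)) = T.L.bProd k := fun k => by
    rw [hx, T.glue_st_κ _ _ _ hst hloop]
  constructor
  -- If all other spaces vanish then so does `iota`, and `pi_iota` shows that `q - 1` kills the
  -- space at `i`.
  · by_contra! h0
    obtain ⟨⟨j, hj⟩, -⟩ := hS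
    have h1 : ∀ j, j ≠ i → S.E j = 0 := by
      intro j hj
      refine LinearMap.ext fun v => ?_
      have := LinearMap.congr_fun (h0 j) (v, 0)
      rw [hEne j hj] at this
      exact congrArg Prod.fst this
    have hji : j = i := by
      by_contra hne
      exact hj (h1 j hne)
    subst hji
    refine hj (LinearMap.ext fun v => ?_)
    have h2 := T.L.pi_iota (T.L.E₀ v) (T.L.E₀_idem_apply v)
    have h3 : T.L.iota (T.L.E₀ v) = 0 := by
      ext k
      rw [Legs.iota_apply, ← T.L.F_b_apply, T.F_eq, h1 _ (hloop _ (T.tl_κ k))]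
      rfl
    rw [h3, map_zero, eq_comm, smul_eq_zero_iff_right (sub_ne_zero.mpr hq'), T.E₀_eq] at h2
    exact h2
  · rintro U' ⟨hU'r, hU's⟩
    have hfst : ∀ j, j ≠ i → ∀ v, v ∈ (U' j).map (LinearMap.fst ℂ V (Fin T.n → V)) ↔
        (v, 0) ∈ U' j := by
      intro j hj v
      constructor
      · rintro ⟨z, hz, rfl⟩
        obtain ⟨y, hy⟩ := hU'r j hz
        have : z = (z.1, 0) := by
          rw [← hy, hEne j hj]
          rfl
        rw [this] at hz
        exact hz
      · intro h
        exact ⟨_, h, rfl⟩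
    set UX : Fin T.n → Submodule ℂ V := fun k =>
      (U' (tl (st (T.κ k)))).map (LinearMap.fst ℂ V (Fin T.n → V)) with hUX
    -- The old space at `i` is no longer present, so its subspace is taken to be what the
    -- neighbouring subspaces generate through `pi`.
    set U : I → Submodule ℂ V := fun j => if j = i then (Submodule.pi Set.univ UX).map T.L.pi else
      (U' j).map (LinearMap.fst ℂ V (Fin T.n → V)) with hU
    have hUi : U i = (Submodule.pi Set.univ UX).map T.L.pi := if_pos rfl
    have hUne : ∀ j, j ≠ i → U j = (U' j).map (LinearMap.fst ℂ V (Fin T.n → V)) :=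
      fun j hj => if_neg hj
    have hUXk : ∀ k, U (tl (st (T.κ k))) = UX k := fun k => hUne _ (hloop _ (T.tl_κ k))
    have hXmem : ∀ k v, v ∈ UX k ↔ (v, 0) ∈ U' (tl (st (T.κ k))) :=
      fun k v => hfst _ (hloop _ (T.tl_κ k)) v
    have hEU : ∀ j, j ≠ i → ∀ v, (v, 0) ∈ U' j → S.E j v = v := by
      intro j hj v hv
      have := S'.E_apply_of_mem (hU'r j hv)
      rw [hEne j hj] at this
      exact congrArg Prod.fst this
    have hF : ∀ k, ∀ u ∈ UX k, T.L.F k u = u := by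
      intro k u hu
      rw [T.F_eq]
      exact hEU _ (hloop _ (T.tl_κ k)) u ((hXmem k u).mp hu)
    have haU : ∀ k, ∀ u ∈ UX k, (0, T.L.aRefl k u) ∈ U' i := by
      intro k u hu
      have := hU's (T.κ k) _ ((hXmem k u).mp hu)
      rwa [hxa, T.tl_κ] at this
    have hbU : ∀ k x, (0, x) ∈ U' i → T.L.e x k ∈ UX k := by
      intro k x hx
      have := hU's (st (T.κ k)) (0, x) (by rwa [hst, T.tl_κ])
      rw [hxb] at this
      exact (hXmem k _).mpr this
    have hab : ∀ j k, ∀ u ∈ UX k, T.L.aRefl k u j ∈ UX j := by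
      intro j k u hu
      have := hbU j _ (haU k u hu)
      rwa [Legs.e_aRefl] at this
    have hb : ∀ k, ∀ u ∈ U i, T.L.b k u ∈ UX k := by
      intro k u hu
      rw [hUi] at hu
      exact T.L.b_pi_mem UX hF hab k hu
    have ha : ∀ k, ∀ u ∈ UX k, T.L.a k u ∈ U i := by
      intro k u hu
      rw [hUi] at hb ⊢
      exact T.L.a_mem_map_pi UX hb k hu
    have hstab : S.IsStable U := by
      constructor
      · intro j
        by_cases hj : j = i
        · subst hj
          rw [hUi]
          rintro _ ⟨x, -, rfl⟩
          rw [← T.E₀_eq, ← T.L.E₀_pi]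
          exact ⟨_, rfl⟩
        · intro v hv
          rw [hUne j hj, hfst j hj] at hv
          exact ⟨v, hEU j hj v hv⟩
      · intro h
        rcases T.cases hst h with ⟨k, rfl⟩ | ⟨k, rfl⟩ | ⟨h1, h2⟩
        · rw [hUXk, T.tl_κ]
          exact ((T.stable_iff k (U i) (UX k)).mp ⟨ha k, hb k⟩).1
        · rw [hUXk, hst, T.tl_κ]
          exact ((T.stable_iff k (U i) (UX k)).mp ⟨ha k, hb k⟩).2
        · rw [hUne _ h1, hUne _ h2]
          intro u hu
          rw [hfst _ h2] at hu
          rw [hfst _ h1]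
          have := hU's h _ hu
          rw [hx, T.glue_other _ _ _ hst h1 h2] at this
          exact this
    have hzero : ∀ j, ∀ z ∈ U' j, j ≠ i → z = (z.1, 0) := by
      intro j z hz hj
      obtain ⟨y, hy⟩ := hU'r j hz
      rw [← hy, hEne j hj]
      rfl
    have hzero' : ∀ z ∈ U' i, z = (0, z.2) ∧ T.L.e z.2 = z.2 := by
      intro z hz
      have := S'.E_apply_of_mem (hU'r i hz)
      rw [hEi, Legs.eProd_apply] at this
      exact ⟨Prod.ext (congrArg Prod.fst this).symm rfl, congrArg Prod.snd this⟩
    rcases hS.2 U hstab with h | h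
    · left
      have hbot : ∀ j, j ≠ i → U' j = ⊥ := by
        intro j hj
        rw [eq_bot_iff]
        intro z hz
        have h1 : z.1 ∈ U j := by
          rw [hUne j hj]
          exact ⟨z, hz, rfl⟩
        rw [h j, Submodule.mem_bot] at h1
        rw [Submodule.mem_bot, hzero j z hz hj, h1]
        rfl
      intro j
      by_cases hj : j = i
      · subst hj
        rw [eq_bot_iff]
        intro z hz
        obtain ⟨h1, h2⟩ := hzero' z hz
        rw [Submodule.mem_bot, h1]
        refine Prod.ext rfl ?_
        funext k
        rw [h1] at hz
        have h3 := hbU k _ hz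
        rw [← hUXk, h, Submodule.mem_bot, h2] at h3
        exact h3
      · exact hbot j hj
    · right
      intro j
      refine le_antisymm (hU'r j) ?_
      by_cases hj : j = i
      · subst hj
        rintro _ ⟨z, rfl⟩
        rw [hEi, Legs.eProd_apply]
        change T.L.e z.2 ∈ (U' j).comap (LinearMap.inr ℂ V (Fin T.n → V))
        refine T.L.mem_of_aRefl_mem hq' (fun k v hv => ?_) (T.L.D_e z.2) (T.L.pi_e hq' z.2)
        refine haU k v ?_
        rw [← hUXk, h, ← T.F_eq]
        exact ⟨v, hv⟩
      · rintro _ ⟨z, rfl⟩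
        rw [hEne j hj]
        change (S.E j z.1, 0) ∈ U' j
        rw [← hfst j hj, ← hUne j hj, h]
        exact ⟨_, rfl⟩

theorem dim_reflect_self [FiniteDimensional ℂ V] (hq : (S.q i : ℂ) ≠ 1)
    (S' : System tl st ord (V × (Fin T.n → V))) (hE : S'.E = T.reflE) :
    S'.dim i = ∑ k, S.dim (tl (st (T.κ k))) - S.dim i := by
  rw [dim, hE, reflE_self, eq_sub_iff_add_eq]
  have := T.L.finrank_range_eProd (by rwa [T.q_eq])
  rw [T.E₀_eq] at this
  rw [funext T.F_eq] at this
  unfold dim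
  exact_mod_cast this

theorem dim_reflect_of_ne {j : I} (hj : j ≠ i) (S' : System tl st ord (V × (Fin T.n → V)))
    (hE : S'.E = T.reflE) : S'.dim j = S.dim j := by
  have h : LinearMap.range (LinearMap.prodMap (S.E j) (0 : End ℂ (Fin T.n → V))) =
      (LinearMap.range (S.E j)).map (LinearMap.inl ℂ V (Fin T.n → V)) := by
    ext z
    constructor
    · rintro ⟨y, rfl⟩
      exact ⟨_, ⟨y.1, rfl⟩, rfl⟩
    · rintro ⟨_, ⟨y, rfl⟩, rfl⟩
      exact ⟨(y, 0), rfl⟩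
  rw [dim, dim, hE, T.reflE_of_ne hj, h, ← (Submodule.equivMapOfInjective _
    LinearMap.inl_injective _).finrank_eq]

end Star

/-- At a loop-free vertex with parameter `1`, a simple system is concentrated at that vertex and
one-dimensional, or satisfies the inequality of the fundamental region. -/
theorem IsSimple.two_mul_dim_le [FiniteDimensional ℂ V] (hS : S.IsSimple) (T : S.Star i)
    (hst : ∀ h, st (st h) = h) (hloop : ∀ h, tl h = i → tl (st h) ≠ i)
    (hq : (S.q i : ℂ) = 1) (hdim : ¬ ((∀ j, j ≠ i → S.dim j = 0) ∧ S.dim i = 1)) :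
    2 * S.dim i ≤ ∑ k, S.dim (tl (st (T.κ k))) := by
  classical
  -- A subspace at `i` killed by all outgoing maps is stable with zero everywhere else.
  have hstab1 : ∀ U : Submodule ℂ V, U ≤ LinearMap.range (S.E i) →
      (∀ u ∈ U, ∀ k, T.L.b k u = 0) →
      S.IsStable fun j => if j = i then U else ⊥ := by
    intro U hU hb
    constructor
    · intro j
      by_cases hj : j = i
      · subst hj; simpa using hU
      · simp [hj]
    · intro h
      rcases T.cases hst h with ⟨k, rfl⟩ | ⟨k, rfl⟩ | ⟨h1, h2⟩
      · simp only [T.tl_κ, hloop _ (T.tl_κ k), if_false, if_true]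
        intro u hu
        rw [Submodule.mem_bot] at hu
        rw [hu, map_zero]
        exact zero_mem _
      · simp only [hst, T.tl_κ, hloop _ (T.tl_κ k), if_false, if_true]
        refine ((T.stable_iff k U ⊥).mp ⟨?_, fun u hu => ?_⟩).2
        · intro u hu
          rw [Submodule.mem_bot] at hu
          rw [hu, map_zero]
          exact zero_mem _
        · rw [hb u hu, Submodule.mem_bot]
      · simp only [h1, h2, if_false]
        intro u hu
        rw [Submodule.mem_bot] at hu
        rw [hu, map_zero]
        exact zero_mem _
  have hdim0 : ∀ j, LinearMap.range (S.E j) = ⊥ → S.dim j = 0 := by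
    intro j hj
    rw [dim, hj, finrank_bot]; rfl
  -- In a system concentrated at `i` every `b` vanishes, so every line is stable and simplicity
  -- forces dimension one.
  have hconc : ¬ ∀ j, j ≠ i → LinearMap.range (S.E j) = ⊥ := by
    intro h
    apply hdim
    refine ⟨fun j hj => hdim0 j (h j hj), ?_⟩
    have hb : ∀ v k, T.L.b k v = 0 := by
      intro v k
      have h1 : T.L.F k (T.L.b k v) ∈ LinearMap.range (S.E (tl (st (T.κ k)))) := by
        rw [T.F_eq]
        exact ⟨_, rfl⟩
      rwa [h _ (hloop _ (T.tl_κ k)), Submodule.mem_bot, Legs.F_b_apply] at h1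
    obtain ⟨j, hj⟩ := hS.1
    have hji : j = i := by
      by_contra hne
      exact hj (LinearMap.range_eq_bot.mp (h j hne))
    subst hji
    obtain ⟨v, hv⟩ := DFunLike.ne_iff.mp hj
    have hv' : S.E j v ≠ 0 := hv
    rcases hS.2 _ (hstab1 (ℂ ∙ S.E j v) (by
      rw [Submodule.span_singleton_le_iff_mem]; exact ⟨v, rfl⟩) fun u _ k => hb u k) with h' | h'
    · have := h' j
      rw [if_pos rfl, Submodule.span_singleton_eq_bot] at this
      exact absurd this hv'
    · have := h' j
      rw [if_pos rfl] at this
      rw [dim, ← this, finrank_span_singleton hv']; rfl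
  have hi : ∀ v, T.L.E₀ v = v → (∀ k, T.L.b k v = 0) → v = 0 := by
    intro v hv hb
    have hst1 := hstab1 (ℂ ∙ v) (by
      rw [Submodule.span_singleton_le_iff_mem, ← T.E₀_eq]; exact ⟨v, hv⟩) (by
      intro u hu k
      obtain ⟨c, rfl⟩ := Submodule.mem_span_singleton.mp hu
      rw [map_smul, hb, smul_zero])
    rcases hS.2 _ hst1 with h | h
    · have := h i
      rwa [if_pos rfl, Submodule.span_singleton_eq_bot] at this
    · exact absurd (fun j hj => by rw [← h j, if_neg hj]) hconc
  have hs : ∀ v, T.L.E₀ v = v → ∃ x, T.L.pi x = v := by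
    set UX : Fin T.n → Submodule ℂ V := fun k => LinearMap.range (T.L.F k)
    have hb : ∀ k, ∀ u ∈ (Submodule.pi Set.univ UX).map T.L.pi, T.L.b k u ∈ UX k :=
      fun k u _ => ⟨_, T.L.F_b_apply k u⟩
    -- This family is everything away from `i`. It is not zero because the system is not
    -- concentrated at `i`, so simplicity makes `pi` surjective.
    have hstab : S.IsStable fun j => if j = i then (Submodule.pi Set.univ UX).map T.L.pi else
        LinearMap.range (S.E j) := by
      constructor
      · intro j
        by_cases hj : j = i
        · subst hj
          simp only [if_true]
          rintro _ ⟨x, -, rfl⟩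
          rw [← T.E₀_eq, ← T.L.E₀_pi]
          exact ⟨_, rfl⟩
        · simp [hj]
      · intro h
        rcases T.cases hst h with ⟨k, rfl⟩ | ⟨k, rfl⟩ | ⟨h1, h2⟩
        · simp only [T.tl_κ, hloop _ (T.tl_κ k), if_false, if_true, ← T.F_eq]
          exact ((T.stable_iff k _ (UX k)).mp ⟨fun u hu => T.L.a_mem_map_pi UX hb k hu, hb k⟩).1
        · simp only [hst, T.tl_κ, hloop _ (T.tl_κ k), if_false, if_true, ← T.F_eq]
          exact ((T.stable_iff k _ (UX k)).mp ⟨fun u hu => T.L.a_mem_map_pi UX hb k hu, hb k⟩).2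
        · simp only [h1, h2, if_false]
          exact fun u _ => ⟨_, S.tail_mul_apply h u⟩
    intro v hv
    rcases hS.2 _ hstab with h | h
    · exact absurd (fun j hj => by rw [← h j, if_neg hj]) hconc
    · have h1 := h i
      rw [if_pos rfl] at h1
      have h2 : v ∈ LinearMap.range (S.E i) := by
        rw [← T.E₀_eq]; exact ⟨v, hv⟩
      rw [← h1] at h2
      obtain ⟨x, -, hx⟩ := h2
      exact ⟨x, hx⟩
  have := T.L.finrank_range_le hi hs (by rwa [T.q_eq])
  rw [T.E₀_eq] at this
  rw [funext T.F_eq] at this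
  unfold dim
  exact_mod_cast this

end System

/-! ### Dimension vectors of simple systems are roots -/

theorem sum_eq_sum_of_range_eq {A B C : Type*} [Fintype A] [Fintype B] {f : A → C} {g : B → C}
    (hf : Function.Injective f) (hg : Function.Injective g) (h : Set.range f = Set.range g)
    (φ : C → ℤ) : ∑ a, φ (f a) = ∑ b, φ (g b) := by
  refine Fintype.sum_equiv ((Equiv.ofInjective f hf).trans
    ((Equiv.setCongr h).trans (Equiv.ofInjective g hg).symm)) _ _ fun a => ?_
  congr 1
  exact (congrArg Subtype.val
    ((Equiv.ofInjective g hg).apply_symm_apply ⟨f a, h ▸ ⟨a, rfl⟩⟩)).symm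

theorem DoubledArrow.star_star {I : Type u} [Quiver.{v} I] (h : DoubledArrow I) :
    h.star.star = h := by cases h <;> rfl

section

variable {I : Type u} [Quiver.{v} I] {ord : List (DoubledArrow I)} {V : Type w} [AddCommGroup V]
  [Module ℂ V]

open DoubledArrow

namespace System

theorem dim_nonneg (S : System tail star ord V) (j : I) : 0 ≤ S.dim j := by
  unfold dim; positivity

theorem dim_ne_zero_iff [FiniteDimensional ℂ V] (S : System tail star ord V) (j : I) :
    S.dim j ≠ 0 ↔ LinearMap.range (S.E j) ≠ ⊥ := by
  rw [dim, Ne, Nat.cast_eq_zero, Submodule.finrank_eq_zero]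

theorem Star.sum_eq [∀ i j : I, Finite (i ⟶ j)] [Fintype I]
    {S : System tail star ord V} {i : I} (T : S.Star i) (β : I → ℤ) :
    ∑ k, β (tail (star (T.κ k))) =
      (∑ j, (Nat.card (i ⟶ j) : ℤ) * β j) + ∑ j, (Nat.card (j ⟶ i) : ℤ) * β j := by
  have : ∀ i j : I, Fintype (i ⟶ j) := fun i j => Fintype.ofFinite _
  let f : (Σ j, (i ⟶ j)) ⊕ (Σ j, (j ⟶ i)) → DoubledArrow I
    | .inl a => fwd ⟨i, a.1, a.2⟩
    | .inr a => rev ⟨a.1, i, a.2⟩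
  have hf : Function.Injective f := by
    rintro (⟨a, x⟩ | ⟨a, x⟩) (⟨b, y⟩ | ⟨b, y⟩) h
    · cases h; rfl
    · cases h
    · cases h
    · cases h; rfl
  have hr : Set.range T.κ = Set.range f := by
    ext h
    rw [Set.mem_range, ← T.κ_range]
    constructor
    · rintro rfl
      rcases h with ⟨a, b, x⟩ | ⟨a, b, x⟩
      · exact ⟨.inl ⟨b, x⟩, rfl⟩
      · exact ⟨.inr ⟨a, x⟩, rfl⟩
    · rintro ⟨a | a, rfl⟩ <;> rfl
  rw [sum_eq_sum_of_range_eq T.κ_inj hf hr fun h => β (tail (star h)), Fintype.sum_sum_type,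
    Fintype.sum_sigma, Fintype.sum_sigma]
  congr 1 <;> refine Finset.sum_congr rfl fun j _ => ?_
  · change ∑ _ : i ⟶ j, β j = _
    simp
  · change ∑ _ : j ⟶ i, β j = _
    simp

end System

end

section

variable {I : Type u} [Fintype I] [DecidableEq I] [Quiver.{v} I]

theorem cartanForm_single (β : I → ℤ) (i : I) :
    cartanForm β (Pi.single i 1) = 2 * β i -
      ((∑ j, (Nat.card (i ⟶ j) : ℤ) * β j) + ∑ j, (Nat.card (j ⟶ i) : ℤ) * β j) := by
  have h1 : ∀ j, β j * (Pi.single i 1 : I → ℤ) j = if j = i then β j else 0 := by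
    intro j
    by_cases h : j = i
    · subst h; simp
    · simp [h]
  have h2 : ∀ a b, (Nat.card (a ⟶ b) : ℤ) *
      (β a * (Pi.single i 1 : I → ℤ) b + β b * (Pi.single i 1 : I → ℤ) a) =
      (if a = i then (Nat.card (a ⟶ b) : ℤ) * β b else 0) +
      (if b = i then (Nat.card (a ⟶ b) : ℤ) * β a else 0) := by
    intro a b
    by_cases ha : a = i <;> by_cases hb : b = i <;> simp [ha, hb, mul_add]
  simp only [cartanForm, h1, h2, Finset.sum_ite_eq', Finset.mem_univ, if_true,
    Finset.sum_add_distrib]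
  congr 2
  rw [Finset.sum_comm]
  simp

/-- A loop at `i` contributes at least `β i` to the outgoing sum and again to the incoming one,
which cancels `2 * β i`. So a vertex where the form is positive can be reflected at. -/
theorem cartanForm_single_le_of_loop [∀ i j : I, Finite (i ⟶ j)] {β : I → ℤ} (hβ : ∀ j, 0 ≤ β j)
    {i : I} (hi : ¬ IsEmpty (i ⟶ i)) : cartanForm β (Pi.single i 1) ≤ 0 := by
  rw [cartanForm_single]
  have : Nonempty (i ⟶ i) := not_isEmpty_iff.mp hi
  have hc : (1 : ℤ) ≤ Nat.card (i ⟶ i) := by exact_mod_cast Nat.card_pos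
  have h1 : (Nat.card (i ⟶ i) : ℤ) * β i ≤ ∑ j, (Nat.card (i ⟶ j) : ℤ) * β j :=
    Finset.single_le_sum (f := fun j => (Nat.card (i ⟶ j) : ℤ) * β j)
      (fun j _ => mul_nonneg (by positivity) (hβ j)) (Finset.mem_univ i)
  have h2 : (Nat.card (i ⟶ i) : ℤ) * β i ≤ ∑ j, (Nat.card (j ⟶ i) : ℤ) * β j :=
    Finset.single_le_sum (f := fun j => (Nat.card (j ⟶ i) : ℤ) * β j)
      (fun j _ => mul_nonneg (by positivity) (hβ j)) (Finset.mem_univ i)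
  have h3 : β i ≤ (Nat.card (i ⟶ i) : ℤ) * β i := le_mul_of_one_le_left (hβ i) hc
  linarith

namespace System

open DoubledArrow

variable {ord : List (DoubledArrow I)} {V : Type w} [AddCommGroup V] [Module ℂ V]
  {S : System tail star ord V} {i : I}

/-- The family that is full on one connected component of the support and zero elsewhere is stable.
-/
theorem IsSimple.connected [FiniteDimensional ℂ V] (hS : S.IsSimple) :
    ((SimpleGraph.fromRel fun i j : I => Nonempty (i ⟶ j)).induce {i | S.dim i ≠ 0}).Connected := by
  classical
  set G := (SimpleGraph.fromRel fun i j : I => Nonempty (i ⟶ j)).induce {i | S.dim i ≠ 0}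
  have hne : Nonempty {i | S.dim i ≠ 0} := by
    obtain ⟨j, hj⟩ := hS.1
    exact ⟨⟨j, (S.dim_ne_zero_iff j).mpr (by rwa [Ne, LinearMap.range_eq_bot])⟩⟩
  refine SimpleGraph.Connected.mk ?_
  intro a b
  set U : I → Submodule ℂ V := fun j =>
    if ∃ hj : S.dim j ≠ 0, G.Reachable a ⟨j, hj⟩ then LinearMap.range (S.E j) else ⊥ with hU
  have hstab : S.IsStable U := by
    constructor
    · intro j
      simp only [hU]
      split_ifs
      · exact le_rfl
      · exact bot_le
    · intro h u hu
      by_cases hr : ∃ hj : S.dim (tail (star h)) ≠ 0, G.Reachable a ⟨_, hj⟩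
      · obtain ⟨hj, hr⟩ := hr
        have hmem : S.x h u ∈ LinearMap.range (S.E (tail h)) := ⟨_, S.tail_mul_apply h u⟩
        by_cases ht : S.dim (tail h) = 0
        · have : LinearMap.range (S.E (tail h)) = ⊥ := by
            by_contra hb
            exact (S.dim_ne_zero_iff _).mpr hb ht
          rw [this, Submodule.mem_bot] at hmem
          rw [hmem]
          exact zero_mem _
        · have hr' : G.Reachable a ⟨tail h, ht⟩ := by
            -- The graph is irreflexive, so a loop gives no edge and is treated apart.
            by_cases heq : tail h = tail (star h)
            · have : (⟨tail h, ht⟩ : {i | S.dim i ≠ 0}) = ⟨tail (star h), hj⟩ := Subtype.ext heq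
              rw [this]
              exact hr
            · refine hr.trans (SimpleGraph.Adj.reachable ?_)
              change (SimpleGraph.fromRel fun i j : I => Nonempty (i ⟶ j)).Adj _ _
              rw [SimpleGraph.fromRel_adj]
              refine ⟨Ne.symm heq, ?_⟩
              rcases h with ⟨_, _, x⟩ | ⟨_, _, x⟩
              · exact Or.inr ⟨x⟩
              · exact Or.inl ⟨x⟩
          simp only [hU]
          rwa [if_pos ⟨ht, hr'⟩]
      · simp only [hU, if_neg hr, Submodule.mem_bot] at hu
        rw [hu, map_zero]
        exact zero_mem _
  rcases hS.2 U hstab with h | h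
  · have h1 := h a.1
    simp only [hU] at h1
    rw [if_pos ⟨a.2, SimpleGraph.Reachable.refl _⟩] at h1
    exact absurd h1 ((S.dim_ne_zero_iff _).mp a.2)
  · by_contra hab
    have h1 := h b.1
    simp only [hU] at h1
    rw [if_neg (fun hex => hab hex.2)] at h1
    exact (S.dim_ne_zero_iff _).mp b.2 h1.symm

/-- The dimension vector of a simple system is a root. -/
theorem IsSimple.isRoot [∀ i j : I, Finite (i ⟶ j)] (hnd : ord.Nodup) (hall : ∀ h, h ∈ ord)
    [FiniteDimensional ℂ V] (hS : S.IsSimple) : IsRoot S.dim := by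
  obtain ⟨n, hn⟩ : ∃ n : ℕ, ∑ j, S.dim j < n := by
    obtain ⟨n, hn⟩ := exists_nat_gt (∑ j, S.dim j)
    exact ⟨n, by exact_mod_cast hn⟩
  -- Reflection changes the ambient space, so the induction ranges over all systems on all spaces
  -- with the given bound on the total dimension.
  induction n generalizing V with
  | zero => exact absurd hn (not_lt.mpr (Finset.sum_nonneg fun j _ => S.dim_nonneg j))
  | succ n ih =>
    by_cases hfund : ∀ i, cartanForm S.dim (Pi.single i 1) ≤ 0
    · refine IsRoot.fundamental _ ⟨?_, S.dim_nonneg, hS.connected, hfund⟩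
      intro h0
      obtain ⟨j, hj⟩ := hS.1
      exact (S.dim_ne_zero_iff j).mpr (by rwa [Ne, LinearMap.range_eq_bot]) (congrFun h0 j)
    · push Not at hfund
      obtain ⟨i, hi⟩ := hfund
      have hlf : IsEmpty (i ⟶ i) := by
        by_contra h
        exact absurd (cartanForm_single_le_of_loop S.dim_nonneg h) (not_le.mpr hi)
      have hloop : ∀ h : DoubledArrow I, tail h = i → tail (star h) ≠ i := by
        rintro (⟨a, b, x⟩ | ⟨a, b, x⟩) h1 h2
        · cases h1; cases h2; exact hlf.false x
        · cases h1; cases h2; exact hlf.false x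
      obtain ⟨T⟩ := S.nonempty_star star_star hnd hall i
      have hform : ∀ β : I → ℤ, cartanForm β (Pi.single i 1) =
          2 * β i - ∑ k, β (tail (star (T.κ k))) := fun β => by
        rw [cartanForm_single, T.sum_eq]
      by_cases hq : (S.q i : ℂ) = 1
      · by_cases hd : (∀ j, j ≠ i → S.dim j = 0) ∧ S.dim i = 1
        · have : S.dim = Pi.single i 1 := by
            funext j
            by_cases hj : j = i
            · subst hj; simpa using hd.2
            · simpa [hj] using hd.1 j hj
          rw [this]
          exact IsRoot.coordinate i hlf
        · have := hS.two_mul_dim_le T star_star hloop hq hd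
          rw [hform] at hi
          linarith
      · obtain ⟨S', hE, hx⟩ := T.exists_reflect star_star hnd hall hloop hq
        have hS' := T.isSimple_of_reflect star_star hloop hq hS S' hE hx
        have hdi := T.dim_reflect_self hq S' hE
        have hdn : ∀ j, j ≠ i → S'.dim j = S.dim j := fun j hj => T.dim_reflect_of_ne hj S' hE
        have hleg : ∑ k, S'.dim (tail (star (T.κ k))) = ∑ k, S.dim (tail (star (T.κ k))) :=
          Finset.sum_congr rfl fun k _ => hdn _ (hloop _ (T.tl_κ k))
        -- Reflections are involutive, so the original vector is the reflection of the smaller one,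
        -- to which the induction applies.
        have hrefl : S.dim = reflect i S'.dim := by
          funext j
          rw [reflect, Pi.sub_apply, Pi.smul_apply, hform, hleg]
          by_cases hj : j = i
          · subst hj
            rw [Pi.single_eq_same, hdi]
            simp only [smul_eq_mul]
            ring
          · rw [Pi.single_eq_of_ne hj, smul_zero, sub_zero, hdn j hj]
        have hsum : ∑ j, S'.dim j < ∑ j, S.dim j := by
          rw [hform] at hi
          refine Finset.sum_lt_sum (fun j _ => ?_) ⟨i, Finset.mem_univ i, by rw [hdi]; linarith⟩
          by_cases hj : j = i
          · subst hj; rw [hdi]; linarith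
          · rw [hdn j hj]
        rw [hrefl]
        refine IsRoot.reflect i hlf _ (ih hS' ?_)
        push_cast at hn
        linarith

end System
end

/-! ### The multiplicative preprojective algebra by generators, and determinants -/

section Generic

variable {J : Type u} [Quiver.{v} J]

/-- The double is the disjoint union of two copies of the set of arrows. -/
def DoubledArrow.equivSum : Quiver.Total J ⊕ Quiver.Total J ≃ DoubledArrow J where
  toFun := Sum.elim .fwd .rev
  invFun
    | .fwd a => .inl a
    | .rev a => .inr a
  left_inv := by rintro (a | a) <;> rfl
  right_inv := by rintro (a | a) <;> rfl

/-- After passing to a commutative monoid, such as by a determinant, the order is irrelevant and the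
factors of an arrow and its opposite cancel. -/
theorem DoubledArrow.prod_map_eq_one {C : Type*} [CommMonoid C] {ord : List (DoubledArrow J)}
    (hnd : ord.Nodup) (hall : ∀ a, a ∈ ord) (f : DoubledArrow J → C)
    (hf : ∀ t, f (.fwd t) * f (.rev t) = 1) : (ord.map f).prod = 1 := by
  classical
  let _ : Fintype (DoubledArrow J) := ⟨⟨ord, hnd⟩, hall⟩
  let _ : Fintype (Quiver.Total J) := Fintype.ofInjective DoubledArrow.fwd (by
    intro a b h; cases h; rfl)
  have h1 : (ord.map f).prod = ∏ a, f a := rfl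
  rw [h1, ← DoubledArrow.equivSum.prod_comp, Fintype.prod_sum_type, ← Finset.prod_mul_distrib]
  exact Finset.prod_eq_one fun t _ => hf t

namespace MPA

variable [Fintype J] (ord : List (DoubledArrow J)) (q : J → ℂˣ)

/-- The arrows as elements of `Λ^q`. -/
def arrow (a : DoubledArrow J) : MPA ord q :=
  RingQuot.mkAlgHom ℂ (Rel ord q) (FreeAlgebra.ι ℂ (Gen.arrow a))

/-- The invertible elements `1 + a a*` of `Λ^q`. -/
def unit (a : DoubledArrow J) : (MPA ord q)ˣ where
  val := 1 + arrow ord q a * arrow ord q a.star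
  inv := RingQuot.mkAlgHom ℂ (Rel ord q) (FreeAlgebra.ι ℂ (Gen.inverse a))
  val_inv := by
    have := RingQuot.mkAlgHom_rel ℂ (Rel.mul_inverse (ord := ord) (q := q) a)
    simpa [oneAdd, arrow] using this
  inv_val := by
    have := RingQuot.mkAlgHom_rel ℂ (Rel.inverse_mul (ord := ord) (q := q) a)
    simpa [oneAdd, arrow] using this

/-- The factors `(1 + a a*)^{ε(a)}` of the moment map. -/
def factor : DoubledArrow J → (MPA ord q)ˣ
  | .fwd a => unit ord q (.fwd a)
  | .rev a => (unit ord q (.rev a))⁻¹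

theorem vertex_mul_self (i : J) : vertex ord q i * vertex ord q i = vertex ord q i := by
  have := RingQuot.mkAlgHom_rel ℂ (Rel.idem (ord := ord) (q := q) i)
  simpa [vertex] using this

theorem vertex_mul_of_ne {i j : J} (h : i ≠ j) : vertex ord q i * vertex ord q j = 0 := by
  have := RingQuot.mkAlgHom_rel ℂ (Rel.orth (ord := ord) (q := q) i j h)
  simpa [vertex] using this

theorem sum_vertex : ∑ i, vertex ord q i = 1 := by
  have := RingQuot.mkAlgHom_rel ℂ (Rel.sum_vertex (ord := ord) (q := q))
  simpa [vertex] using this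

theorem vertex_tail_mul (a : DoubledArrow J) :
    vertex ord q a.tail * arrow ord q a = arrow ord q a := by
  have := RingQuot.mkAlgHom_rel ℂ (Rel.tail_mul (ord := ord) (q := q) a)
  simpa [vertex, arrow] using this

theorem mul_vertex_head (a : DoubledArrow J) :
    arrow ord q a * vertex ord q a.head = arrow ord q a := by
  have := RingQuot.mkAlgHom_rel ℂ (Rel.mul_head (ord := ord) (q := q) a)
  simpa [vertex, arrow] using this

theorem prod_factor :
    ((ord.map (factor ord q)).prod : (MPA ord q)ˣ).val = ∑ i, (q i : ℂ) • vertex ord q i := by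
  have := RingQuot.mkAlgHom_rel ℂ (Rel.moment (ord := ord) (q := q))
  rw [map_list_prod, List.map_map, map_sum] at this
  simp only [map_smul] at this
  change _ = ∑ i, (q i : ℂ) • RingQuot.mkAlgHom ℂ (Rel ord q) (FreeAlgebra.ι ℂ (Gen.vertex i))
  rw [← this, ← Units.coeHom_apply, map_list_prod, List.map_map]
  congr 2
  funext a
  cases a with
  | fwd a => simp [factor, momentFactor, unit, oneAdd, arrow]
  | rev a => simp [factor, momentFactor, unit, Units.inv_mk]

theorem induction {P : MPA ord q → Prop} (hvertex : ∀ i, P (vertex ord q i))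
    (harrow : ∀ a, P (arrow ord q a)) (hinv : ∀ a, P ((unit ord q a)⁻¹ : (MPA ord q)ˣ).val)
    (hscalar : ∀ c : ℂ, P (algebraMap ℂ _ c)) (hadd : ∀ x y, P x → P y → P (x + y))
    (hmul : ∀ x y, P x → P y → P (x * y)) (x : MPA ord q) : P x := by
  obtain ⟨y, rfl⟩ := RingQuot.mkAlgHom_surjective ℂ (Rel ord q) x
  induction y using FreeAlgebra.induction with
  | grade0 c => rw [AlgHom.commutes]; exact hscalar c
  | grade1 g =>
    cases g with
    | vertex i => exact hvertex i
    | arrow a => exact harrow a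
    | inverse a => exact hinv a
  | mul a b ha hb => rw [map_mul]; exact hmul _ _ ha hb
  | add a b ha hb => rw [map_add]; exact hadd _ _ ha hb

/-- The remaining generators are inverses of expressions in the arrows, so their images are
determined. -/
theorem algHom_ext {B : Type*} [Ring B] [Algebra ℂ B] {f g : MPA ord q →ₐ[ℂ] B}
    (hvertex : ∀ i, f (vertex ord q i) = g (vertex ord q i))
    (harrow : ∀ a, f (arrow ord q a) = g (arrow ord q a)) : f = g := by
  refine AlgHom.ext fun x => ?_
  induction x using induction with
  | hvertex i => exact hvertex i
  | harrow a => exact harrow a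
  | hinv a =>
    have : Units.map (f : MPA ord q →* B) (unit ord q a) =
        Units.map (g : MPA ord q →* B) (unit ord q a) := by
      ext
      simp [unit, harrow]
    have h2 := congrArg (fun u : Bˣ => (u⁻¹).val) this
    simp only [← map_inv] at h2
    exact h2
  | hscalar c => simp
  | hadd x y hx hy => rw [map_add, map_add, hx, hy]
  | hmul x y hx hy => rw [map_mul, map_mul, hx, hy]

/-- Construction of homomorphisms out of `Λ^q`. -/
theorem exists_algHom {B : Type*} [Ring B] [Algebra ℂ B] (E : J → B) (X : DoubledArrow J → B)
    (F : DoubledArrow J → Bˣ) (hidem : ∀ i, E i * E i = E i)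
    (horth : ∀ i j, i ≠ j → E i * E j = 0) (hsum : ∑ i, E i = 1)
    (htail : ∀ a, E a.tail * X a = X a) (hhead : ∀ a, X a * E a.head = X a)
    (hfwd : ∀ t, (F (.fwd t)).val = 1 + X (.fwd t) * X (.rev t))
    (hrev : ∀ t, ((F (.rev t))⁻¹ : Bˣ).val = 1 + X (.rev t) * X (.fwd t))
    (hmoment : ((ord.map F).prod : Bˣ).val = ∑ i, (q i : ℂ) • E i) :
    ∃ f : MPA ord q →ₐ[ℂ] B, (∀ i, f (vertex ord q i) = E i) ∧ ∀ a, f (arrow ord q a) = X a := by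
  -- For a reversed arrow `F` is already the inverse of `1 + a a*`, so the formal inverse goes to
  -- `F` and not to its inverse.
  let G : Gen J → B
    | .vertex i => E i
    | .arrow a => X a
    | .inverse (.fwd t) => ((F (.fwd t))⁻¹ : Bˣ).val
    | .inverse (.rev t) => (F (.rev t)).val
  have hG : ∀ a, FreeAlgebra.lift ℂ G (momentFactor a) = (F a).val := by
    rintro (t | t)
    · simp [momentFactor, oneAdd, G, hfwd, DoubledArrow.star]
    · simp [momentFactor, G]
  have hrel : ∀ ⦃x y⦄, Rel ord q x y → FreeAlgebra.lift ℂ G x = FreeAlgebra.lift ℂ G y := by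
    rintro x y (i | ⟨i, j, hij⟩ | _ | a | a | a | a | _)
    · simp [G, hidem]
    · simp [G, horth i j hij]
    · simp [G, hsum]
    · simp [G, htail]
    · simp [G, hhead]
    · rcases a with t | t
      · simp [oneAdd, G, DoubledArrow.star, ← hfwd]
      · simp [oneAdd, G, DoubledArrow.star, ← hrev]
    · rcases a with t | t
      · simp [oneAdd, G, DoubledArrow.star, ← hfwd]
      · simp [oneAdd, G, DoubledArrow.star, ← hrev]
    · rw [map_list_prod, List.map_map,
        show (FreeAlgebra.lift ℂ G) ∘ momentFactor = (Units.coeHom B) ∘ F from funext hG,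
        ← List.map_map, ← map_list_prod, Units.coeHom_apply, hmoment]
      simp [G]
  refine ⟨RingQuot.liftAlgHom ℂ ⟨FreeAlgebra.lift ℂ G, hrel⟩, fun i => ?_, fun a => ?_⟩
  · rw [vertex, RingQuot.liftAlgHom_mkAlgHom_apply]; simp [G]
  · rw [arrow, RingQuot.liftAlgHom_mkAlgHom_apply]; simp [G]

end MPA

end Generic

theorem det_one_add_mul_comm {M : Type*} [AddCommGroup M] [Module ℂ M] [FiniteDimensional ℂ M]
    (f g : End ℂ M) : LinearMap.det (1 + f * g) = LinearMap.det (1 + g * f) := by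
  let b := finBasis ℂ M
  rw [← LinearMap.det_toMatrix b, ← LinearMap.det_toMatrix b, map_add, map_add,
    LinearMap.toMatrix_mul, LinearMap.toMatrix_mul, LinearMap.toMatrix_one,
    Matrix.det_one_add_mul_comm]

/-- The determinant of a linear combination of a complete system of orthogonal idempotents. -/
theorem det_sum_smul_idem {J M : Type*} [Fintype J] [AddCommGroup M] [Module ℂ M]
    [FiniteDimensional ℂ M] (E : J → End ℂ M) (hidem : ∀ i, E i * E i = E i)
    (horth : ∀ i j, i ≠ j → E i * E j = 0) (hsum : ∑ i, E i = 1) (c : J → ℂ) :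
    LinearMap.det (∑ i, c i • E i) = ∏ i, c i ^ finrank ℂ (LinearMap.range (E i)) := by
  classical
  have hself : ∀ i, ∀ v ∈ LinearMap.range (E i), E i v = v := by
    rintro i _ ⟨v, rfl⟩
    exact LinearMap.congr_fun (hidem i) v
  have hne : ∀ i j, i ≠ j → ∀ v ∈ LinearMap.range (E j), E i v = 0 := by
    rintro i j hij _ ⟨v, rfl⟩
    exact LinearMap.congr_fun (horth i j hij) v
  let e : (∀ i, LinearMap.range (E i)) ≃ₗ[ℂ] M :=
    { toFun := fun x => ∑ i, (x i : M)
      map_add' := fun x y => by simp [Finset.sum_add_distrib]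
      map_smul' := fun r x => by simp [Finset.smul_sum]
      invFun := fun v i => ⟨E i v, v, rfl⟩
      left_inv := fun x => by
        funext i
        apply Subtype.ext
        simp only [map_sum]
        rw [Finset.sum_eq_single i (fun j _ hj => hne i j hj.symm _ (x j).2) (by simp)]
        exact hself i _ (x i).2
      right_inv := fun v => by
        have := LinearMap.congr_fun hsum v
        simpa using this }
  let b := (Pi.basis fun i => finBasis ℂ (LinearMap.range (E i))).map e
  have hb : ∀ k, b k ∈ LinearMap.range (E k.1) := by
    rintro ⟨i, k⟩
    have : b ⟨i, k⟩ = (finBasis ℂ (LinearMap.range (E i)) k : M) := by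
      simp only [b, Basis.map_apply, Pi.basis_apply]
      change ∑ j, ((Pi.single i (finBasis ℂ (LinearMap.range (E i)) k) :
        ∀ i, LinearMap.range (E i)) j : M) = _
      rw [Finset.sum_eq_single i]
      · simp
      · intro j _ hj; simp [hj]
      · simp
    rw [this]
    exact Subtype.mem _
  have hdiag : LinearMap.toMatrix b b (∑ i, c i • E i) = Matrix.diagonal fun k => c k.1 := by
    ext k l
    rw [LinearMap.toMatrix_apply]
    have : (∑ i, c i • E i) (b l) = c l.1 • b l := by
      simp only [LinearMap.sum_apply, LinearMap.smul_apply]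
      rw [Finset.sum_eq_single l.1 (fun j _ hj => by rw [hne j l.1 hj _ (hb l), smul_zero])
        (by simp), hself _ _ (hb l)]
    rw [this, map_smul, Finsupp.smul_apply, Basis.repr_self, Matrix.diagonal_apply,
      Finsupp.single_apply]
    by_cases h : k = l
    · subst h; simp
    · simp [h, Ne.symm h]
  rw [← LinearMap.det_toMatrix b, hdiag, Matrix.det_diagonal, Fintype.prod_sigma]
  simp

/-! ### Modules that vanish at the framing vertex -/

section FramedModules

variable {I : Type u} [Quiver.{v} I] {W : I → Type v}

/-- The arrows of the double of `I` as arrows of the double of the framed quiver. -/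
def DoubledArrow.toFramed (W : I → Type v) : DoubledArrow I → DoubledArrow (Framed I W)
  | .fwd a => .fwd ⟨.vertex a.left, .vertex a.right, a.hom⟩
  | .rev a => .rev ⟨.vertex a.left, .vertex a.right, a.hom⟩

/-- The partial inverse of `DoubledArrow.toFramed`. -/
def DoubledArrow.ofFramed : DoubledArrow (Framed I W) → Option (DoubledArrow I)
  | .fwd ⟨.vertex i, .vertex j, x⟩ => some (.fwd ⟨i, j, x⟩)
  | .rev ⟨.vertex i, .vertex j, x⟩ => some (.rev ⟨i, j, x⟩)
  | _ => none

theorem DoubledArrow.ofFramed_toFramed (h : DoubledArrow I) : (h.toFramed W).ofFramed = some h := by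
  rcases h with ⟨i, j, x⟩ | ⟨i, j, x⟩ <;> rfl

theorem DoubledArrow.eq_toFramed_of_ofFramed {a : DoubledArrow (Framed I W)} {h : DoubledArrow I}
    (ha : a.ofFramed = some h) : a = h.toFramed W := by
  rcases a with ⟨_ | _, _ | _, x⟩ | ⟨_ | _, _ | _, x⟩ <;> cases ha <;> rfl

theorem DoubledArrow.infty_of_ofFramed_eq_none {a : DoubledArrow (Framed I W)}
    (ha : a.ofFramed = none) : a.tail = .infty ∨ a.head = .infty := by
  rcases a with ⟨_ | _, _ | _, x⟩ | ⟨_ | _, _ | _, x⟩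
  all_goals first | (cases ha; done) | exact Or.inl rfl | exact Or.inr rfl

theorem DoubledArrow.tail_toFramed (h : DoubledArrow I) : (h.toFramed W).tail = .vertex h.tail := by
  cases h <;> rfl

theorem DoubledArrow.head_toFramed (h : DoubledArrow I) :
    (h.toFramed W).head = .vertex h.star.tail := by
  cases h <;> rfl

theorem DoubledArrow.head_eq {J : Type*} [Quiver J] (a : DoubledArrow J) : a.head = a.star.tail := by
  cases a <;> rfl

theorem eq_filter_of_sublist {H : Type*} {ord l : List H} (hnd : ord.Nodup) {p : H → Bool}
    (hl : l.Sublist ord) (hm : ∀ h, h ∈ ord → (h ∈ l ↔ p h)) : l = ord.filter p := by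
  have h1 : l = l.filter p := by
    rw [eq_comm, List.filter_eq_self]
    exact fun h hh => (hm h (hl.subset hh)).mp hh
  have h2 : l.Sublist (ord.filter p) := by
    rw [h1]; exact hl.filter _
  refine h2.eq_of_length_le (List.Subperm.length_le ((hnd.filter _).subperm fun h hh => ?_))
  rw [List.mem_filter] at hh
  exact (hm h hh.1).mpr hh.2

variable [Fintype I]
  {ord : List (DoubledArrow (Framed I W))} {q' : Framed I W → ℂˣ}
  {M : Type w} [AddCommGroup M] [Module ℂ M]

open DoubledArrow

theorem map_arrow_eq_zero (φ : MPA ord q' →ₐ[ℂ] End ℂ M)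
    (h0 : φ (MPA.vertex ord q' .infty) = 0) {a : DoubledArrow (Framed I W)}
    (ha : a.ofFramed = none) : φ (MPA.arrow ord q' a) = 0 := by
  rcases infty_of_ofFramed_eq_none ha with h | h
  · rw [← MPA.vertex_tail_mul, map_mul, h, h0, zero_mul]
  · rw [← MPA.mul_vertex_head, map_mul, h, h0, mul_zero]

/-- The image of a factor of the moment map under a representation. -/
def repFactor (φ : MPA ord q' →ₐ[ℂ] End ℂ M) (a : DoubledArrow (Framed I W)) : (End ℂ M)ˣ :=
  Units.map (φ : MPA ord q' →* End ℂ M) (MPA.factor ord q' a)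

theorem repFactor_fwd (φ : MPA ord q' →ₐ[ℂ] End ℂ M) (t) :
    (repFactor φ (.fwd t)).val =
      1 + φ (MPA.arrow ord q' (.fwd t)) * φ (MPA.arrow ord q' (.rev t)) := by
  simp [repFactor, MPA.factor, MPA.unit, DoubledArrow.star]

theorem repFactor_rev (φ : MPA ord q' →ₐ[ℂ] End ℂ M) (t) :
    ((repFactor φ (.rev t))⁻¹).val =
      1 + φ (MPA.arrow ord q' (.rev t)) * φ (MPA.arrow ord q' (.fwd t)) := by
  rw [repFactor, MPA.factor, map_inv, inv_inv]
  simp [MPA.unit, DoubledArrow.star]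

theorem val_eq_one_of_inv_val {B : Type*} [Ring B] {u : Bˣ} (h : (u⁻¹).val = 1) : u = 1 :=
  inv_eq_one.mp (Units.ext h)

theorem repFactor_eq_one (φ : MPA ord q' →ₐ[ℂ] End ℂ M)
    (h0 : φ (MPA.vertex ord q' .infty) = 0) {a : DoubledArrow (Framed I W)}
    (ha : a.ofFramed = none) : repFactor φ a = 1 := by
  have h1 := map_arrow_eq_zero φ h0 ha
  cases a with
  | fwd t =>
    ext1
    rw [repFactor_fwd, h1, zero_mul, add_zero]; rfl
  | rev t =>
    refine val_eq_one_of_inv_val ?_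
    rw [repFactor_rev, h1, zero_mul, add_zero]

/-- The factor of an arrow lives in the block at its tail and is the identity on all other blocks.
Hence the global moment relation splits into one relation per vertex. -/
theorem commute_repFactor (φ : MPA ord q' →ₐ[ℂ] End ℂ M) (j) (a) :
    Commute (φ (MPA.vertex ord q' j)) (repFactor φ a).val ∧
      (a.tail ≠ j → (repFactor φ a).val * φ (MPA.vertex ord q' j) =
        φ (MPA.vertex ord q' j)) := by
  have key : ∀ a : DoubledArrow (Framed I W),
      Commute (φ (MPA.vertex ord q' j))
        (1 + φ (MPA.arrow ord q' a) * φ (MPA.arrow ord q' a.star)) ∧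
      (a.tail ≠ j → (1 + φ (MPA.arrow ord q' a) * φ (MPA.arrow ord q' a.star)) *
        φ (MPA.vertex ord q' j) = φ (MPA.vertex ord q' j)) := by
    intro a
    have e1 : φ (MPA.vertex ord q' a.tail) * φ (MPA.arrow ord q' a) = φ (MPA.arrow ord q' a) := by
      rw [← map_mul, MPA.vertex_tail_mul]
    have e2 : φ (MPA.arrow ord q' a.star) * φ (MPA.vertex ord q' a.tail) =
        φ (MPA.arrow ord q' a.star) := by
      have := MPA.mul_vertex_head ord q' a.star
      rw [head_eq, DoubledArrow.star_star] at this
      rw [← map_mul, this]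
    have e3 : ∀ i k, i ≠ k → φ (MPA.vertex ord q' i) * φ (MPA.vertex ord q' k) = 0 := by
      intro i k hik
      rw [← map_mul, MPA.vertex_mul_of_ne _ _ hik, map_zero]
    by_cases h : a.tail = j
    · subst h
      refine ⟨?_, fun h => absurd rfl h⟩
      rw [Commute, SemiconjBy, mul_add, add_mul, ← mul_assoc, e1, mul_assoc, e2, mul_one, one_mul]
    · have z1 : φ (MPA.vertex ord q' j) * φ (MPA.arrow ord q' a) = 0 := by
        rw [← e1, ← mul_assoc, e3 _ _ (Ne.symm h), zero_mul]
      have z2 : φ (MPA.arrow ord q' a.star) * φ (MPA.vertex ord q' j) = 0 := by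
        rw [← e2, mul_assoc, e3 _ _ h, mul_zero]
      constructor
      · rw [Commute, SemiconjBy, mul_add, add_mul, ← mul_assoc, z1, mul_assoc, z2]
        simp
      · intro _
        rw [add_mul, mul_assoc, z2]
        simp
  cases a with
  | fwd t => rw [repFactor_fwd]; exact key (.fwd t)
  | rev t =>
    have := key (.rev t)
    have hr := repFactor_rev φ t
    simp only [DoubledArrow.star] at this
    rw [← hr] at this
    refine ⟨Commute.units_inv_right_iff.mp this.1, fun h => ?_⟩
    have h2 := this.2 h
    rw [Units.inv_mul_eq_iff_eq_mul] at h2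
    exact h2.symm

/-- Framing arrows start or end at `∞` and act by zero on such a module. What remains is a
representation of the double of the unframed quiver. -/
theorem exists_system (hnd : ord.Nodup) (φ : MPA ord q' →ₐ[ℂ] End ℂ M)
    (h0 : φ (MPA.vertex ord q' .infty) = 0) :
    ∃ S : System tail DoubledArrow.star (ord.filterMap ofFramed) M,
      (∀ i, S.E i = φ (MPA.vertex ord q' (.vertex i))) ∧
      ∀ h, S.x h = φ (MPA.arrow ord q' (h.toFramed W)) := by
  classical
  have hnd' : (ord.filterMap (ofFramed (W := W))).Nodup := by
    refine hnd.filterMap ?_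
    intro a b h ha hb
    rw [eq_toFramed_of_ofFramed ha, eq_toFramed_of_ofFramed hb]
  refine ⟨⟨fun i => φ (MPA.vertex ord q' (.vertex i)),
    fun h => φ (MPA.arrow ord q' (h.toFramed W)), fun h => repFactor φ (h.toFramed W),
    fun i => q' (.vertex i), ?_, ?_, ?_, ?_, ?_⟩, fun _ => rfl, fun _ => rfl⟩
  · intro j
    rw [← map_mul, MPA.vertex_mul_self]
  · intro h
    rw [← map_mul, ← tail_toFramed, MPA.vertex_tail_mul]
  · intro h
    rw [← map_mul, ← head_toFramed, MPA.mul_vertex_head]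
  · rintro (⟨i, j, x⟩ | ⟨i, j, x⟩)
    · exact Or.inl ⟨repFactor_fwd φ _, repFactor_rev φ _⟩
    · exact Or.inr ⟨repFactor_fwd φ _, repFactor_rev φ _⟩
  · intro j l hl hm
    have hl' : l = (ord.filterMap (ofFramed (W := W))).filter (fun h => h.tail = j) :=
      eq_filter_of_sublist hnd' hl fun h _ => by simpa using hm h
    have hmom : ((ord.map (repFactor φ)).prod).val * φ (MPA.vertex ord q' (.vertex j)) =
        (q' (.vertex j) : ℂ) • φ (MPA.vertex ord q' (.vertex j)) := by
      have h1 : ((ord.map (repFactor φ)).prod).val =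
          φ ((ord.map (MPA.factor ord q')).prod).val := by
        have : repFactor φ = Units.map (φ : MPA ord q' →* End ℂ M) ∘ MPA.factor ord q' := rfl
        rw [this, ← List.map_map, ← map_list_prod]
        rfl
      rw [h1, MPA.prod_factor, ← map_mul, Finset.sum_mul,
        Finset.sum_eq_single (Framed.vertex j : Framed I W)]
      · rw [smul_mul_assoc, MPA.vertex_mul_self, map_smul]
      · intro k _ hk
        rw [smul_mul_assoc, MPA.vertex_mul_of_ne _ _ hk, smul_zero]
      · simp
    rw [← hmom, hl']
    clear hl' hmom hl hm hnd' hnd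
    generalize hE : φ (MPA.vertex ord q' (.vertex j)) = E
    -- Restricted to the block at `j`, the discarded factors are trivial: those of framing arrows
    -- are `1`, and those with another tail fix the block. Commutation with `E` lets each of them
    -- meet the block.
    have hlist : ∀ L : List (DoubledArrow (Framed I W)),
        (((((L.filterMap (ofFramed (W := W))).filter (fun h => h.tail = j)).map
          fun h => repFactor φ (h.toFramed W)).prod).val * E =
          ((L.map (repFactor φ)).prod).val * E) ∧
          Commute E ((L.map (repFactor φ)).prod).val := by
      intro L
      induction L with
      | nil => simp
      | cons a L ih =>
        have hc := commute_repFactor φ (.vertex j) a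
        rw [hE] at hc
        refine ⟨?_, ?_⟩
        · rw [List.map_cons, List.prod_cons, Units.val_mul, mul_assoc]
          cases ha : a.ofFramed with
          | none =>
            rw [List.filterMap_cons_none ha, ih.1, repFactor_eq_one φ h0 ha, Units.val_one, one_mul]
          | some h =>
            rw [List.filterMap_cons_some ha]
            by_cases ht : h.tail = j
            · rw [List.filter_cons_of_pos (by simpa using ht), List.map_cons, List.prod_cons,
                Units.val_mul, mul_assoc, ih.1, ← eq_toFramed_of_ofFramed ha]
            · rw [List.filter_cons_of_neg (by simpa using ht), ih.1, ← ih.2.eq, ← mul_assoc,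
                hc.2]
              rw [eq_toFramed_of_ofFramed ha, tail_toFramed]
              intro h'
              cases h'
              exact ht rfl
        · rw [List.map_cons, List.prod_cons, Units.val_mul]
          exact hc.1.mul_right ih.2
    exact (hlist ord).1

/-- The determinant of the moment map is `1`, because `det (1 + a a*) = det (1 + a* a)` and the two
occur with opposite exponents. On the other side stands a diagonal operator with eigenvalue `q' j`
on the block at `j`. -/
theorem det_moment (hnd : ord.Nodup) (hall : ∀ a, a ∈ ord) [FiniteDimensional ℂ M]
    (φ : MPA ord q' →ₐ[ℂ] End ℂ M) :
    ∏ j, (q' j : ℂ) ^ finrank ℂ (LinearMap.range (φ (MPA.vertex ord q' j))) = 1 := by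
  rw [← det_sum_smul_idem (fun j => φ (MPA.vertex ord q' j))
    (fun i => by rw [← map_mul, MPA.vertex_mul_self])
    (fun i j hij => by rw [← map_mul, MPA.vertex_mul_of_ne _ _ hij, map_zero])
    (by rw [← map_sum, MPA.sum_vertex, map_one])]
  have h1 : ∑ j, (q' j : ℂ) • φ (MPA.vertex ord q' j) =
      ((ord.map (repFactor φ)).prod).val := by
    have : repFactor φ = Units.map (φ : MPA ord q' →* End ℂ M) ∘ MPA.factor ord q' := rfl
    rw [this, ← List.map_map, ← map_list_prod]
    change _ = φ ((ord.map (MPA.factor ord q')).prod).val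
    rw [MPA.prod_factor, map_sum]
    simp
  rw [h1]
  let d : (End ℂ M)ˣ →* ℂˣ := Units.map (LinearMap.det : End ℂ M →* ℂ)
  have h2 : d (ord.map (repFactor φ)).prod = 1 := by
    rw [map_list_prod, List.map_map]
    refine DoubledArrow.prod_map_eq_one hnd hall _ fun t => ?_
    have e1 : d (repFactor φ (.fwd t)) = (d (repFactor φ (.rev t)))⁻¹ := by
      rw [← map_inv]
      ext
      change LinearMap.det (repFactor φ (.fwd t)).val = LinearMap.det ((repFactor φ (.rev t))⁻¹).val
      rw [repFactor_fwd, repFactor_rev, det_one_add_mul_comm]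
    simp [e1]
  exact congrArg Units.val h2

end FramedModules

/-! ### Regularity implies simplicity -/

section Simplicity

variable {I : Type u} [Fintype I] [DecidableEq I] [Quiver.{v} I] [∀ i j : I, Finite (i ⟶ j)]
  {W : I → Type v} {ord : List (DoubledArrow (Framed I W))}
  {q' : Framed I W → ℂˣ}

open DoubledArrow

/-- Such a simple module would be a simple system of the unframed quiver. Its dimension vector would
be a root on which `q` takes the value `1` by `det_moment`. -/
theorem not_isSimpleModule (hnd : ord.Nodup) (hall : ∀ a, a ∈ ord)
    (hq : IsRegular fun i => q' (.vertex i)) (M : Type w) [AddCommGroup M] [Module ℂ M]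
    [Module (MPA ord q') M] [IsScalarTower ℂ (MPA ord q') M] [FiniteDimensional ℂ M]
    (h0 : ∀ m : M, MPA.vertex ord q' .infty • m = 0) : ¬ IsSimpleModule (MPA ord q') M := by
  intro hM
  let φ : MPA ord q' →ₐ[ℂ] End ℂ M := Algebra.lsmul ℂ ℂ M
  have hφ : ∀ x m, φ x m = x • m := fun x m => rfl
  have hφ0 : φ (MPA.vertex ord q' .infty) = 0 := LinearMap.ext h0
  obtain ⟨S, hE, hx⟩ := exists_system hnd φ hφ0
  have hsumv : ∀ m : M, ∑ i : I, MPA.vertex ord q' (.vertex i) • m = m := by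
    intro m
    have := congrArg (· • m) (MPA.sum_vertex ord q')
    simp only [Finset.sum_smul, one_smul] at this
    rw [← Equiv.sum_comp framedEquiv.symm, Fintype.sum_option] at this
    change MPA.vertex ord q' .infty • m + ∑ i : I, MPA.vertex ord q' (.vertex i) • m = m at this
    rwa [h0, zero_add] at this
  have hnd' : (ord.filterMap (ofFramed (W := W))).Nodup := by
    refine hnd.filterMap ?_
    intro a b h ha hb
    rw [eq_toFramed_of_ofFramed ha, eq_toFramed_of_ofFramed hb]
  have hall' : ∀ h, h ∈ ord.filterMap (ofFramed (W := W)) := fun h =>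
    List.mem_filterMap.mpr ⟨_, hall _, ofFramed_toFramed h⟩
  have hsimple : S.IsSimple := by
    constructor
    · have := IsSimpleModule.nontrivial (MPA ord q') M
      obtain ⟨m, hm⟩ := exists_ne (0 : M)
      by_contra! h
      refine hm ?_
      rw [← hsumv m]
      refine Finset.sum_eq_zero fun i _ => ?_
      rw [← hφ, ← hE, h]
      rfl
    · intro U hU
      have hmem : ∀ i, ∀ u ∈ U i, MPA.vertex ord q' (.vertex i) • u = u := by
        intro i u hu
        rw [← hφ, ← hE]
        exact S.E_apply_of_mem (hU.1 i hu)
      have hmem' : ∀ i j, i ≠ j → ∀ u ∈ U i, MPA.vertex ord q' (.vertex j) • u = 0 := by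
        intro i j hij u hu
        rw [← hmem i u hu, smul_smul, MPA.vertex_mul_of_ne, zero_smul]
        intro h
        cases h
        exact hij rfl
      -- The sum of a stable family is graded by the vertices. This makes it a submodule from whose
      -- triviality the family can be recovered.
      have hsup : ∀ u ∈ ⨆ i, U i, ∀ i, MPA.vertex ord q' (.vertex i) • u ∈ U i := by
        intro u hu i
        induction hu using Submodule.iSup_induction' with
        | mem j u hu =>
          by_cases hij : j = i
          · subst hij; rwa [hmem j u hu]
          · rw [hmem' j i hij u hu]; exact zero_mem _
        | zero => rw [smul_zero]; exact zero_mem _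
        | add x y _ _ hx hy => rw [smul_add]; exact add_mem hx hy
      have harr : ∀ a, ∀ u ∈ ⨆ i, U i, MPA.arrow ord q' a • u ∈ ⨆ i, U i := by
        intro a u hu
        cases ha : a.ofFramed with
        | none =>
          have := LinearMap.congr_fun (map_arrow_eq_zero φ hφ0 ha) u
          rw [hφ] at this
          rw [this]
          exact zero_mem _
        | some h =>
          have h1 := hU.2 h _ (hsup u hu (tail (DoubledArrow.star h)))
          rw [hx, ← eq_toFramed_of_ofFramed ha, hφ, smul_smul, ← head_toFramed (W := W),
            ← eq_toFramed_of_ofFramed ha, MPA.mul_vertex_head] at h1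
          exact Submodule.mem_iSup_of_mem _ h1
      have hstab : ∀ x : MPA ord q', ∀ u ∈ ⨆ i, U i, x • u ∈ ⨆ i, U i := by
        intro x
        induction x using MPA.induction with
        | hvertex i =>
          intro u hu
          cases i with
          | infty => rw [h0]; exact zero_mem _
          | vertex i => exact Submodule.mem_iSup_of_mem _ (hsup u hu i)
        | harrow a => exact harr a
        | hinv a =>
          intro u hu
          -- Stability under `1 + a a*` passes to its inverse by finite dimension.
          refine Legs.unit_inv_mem (Units.map (φ : MPA ord q' →* End ℂ M) (MPA.unit ord q' a))
            (fun u hu => ?_) hu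
          change (1 + MPA.arrow ord q' a * MPA.arrow ord q' a.star) • u ∈ _
          rw [add_smul, one_smul, mul_smul]
          exact add_mem hu (harr _ _ (harr _ _ hu))
        | hscalar c =>
          intro u hu
          rw [algebraMap_smul]
          exact Submodule.smul_mem _ c hu
        | hadd x y hx hy => intro u hu; rw [add_smul]; exact add_mem (hx u hu) (hy u hu)
        | hmul x y hx hy => intro u hu; rw [mul_smul]; exact hx _ (hy u hu)
      let N : Submodule (MPA ord q') M :=
        { (⨆ i, U i).toAddSubmonoid with smul_mem' := fun x u hu => hstab x u hu }
      rcases eq_bot_or_eq_top N with hN | hN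
      · left
        intro i
        rw [eq_bot_iff]
        intro u hu
        have : u ∈ N := Submodule.mem_iSup_of_mem (p := U) i hu
        rwa [hN] at this
      · right
        intro i
        refine le_antisymm (hU.1 i) ?_
        rintro _ ⟨m, rfl⟩
        have : m ∈ N := by rw [hN]; trivial
        rw [hE]
        exact hsup m this i
  have hroot := hsimple.isRoot hnd' hall'
  refine hq _ hroot ?_
  have hdet := det_moment hnd hall φ
  rw [← Equiv.prod_comp framedEquiv.symm, Fintype.prod_option] at hdet
  change (q' .infty : ℂ) ^ finrank ℂ (LinearMap.range (φ (MPA.vertex ord q' .infty))) *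
    ∏ i : I, (q' (.vertex i) : ℂ) ^
      finrank ℂ (LinearMap.range (φ (MPA.vertex ord q' (.vertex i)))) = 1 at hdet
  rw [hφ0, LinearMap.range_zero, finrank_bot, pow_zero, one_mul] at hdet
  ext
  push_cast
  rw [← hdet]
  refine Finset.prod_congr rfl fun i _ => ?_
  rw [System.dim, hE]
  simp

/-- A nonzero finite-dimensional module contains a simple submodule, which again vanishes at `∞`. -/
theorem subsingleton_of_infty_smul_eq_zero (hnd : ord.Nodup) (hall : ∀ a, a ∈ ord)
    (hq : IsRegular fun i => q' (.vertex i)) (M : Type w) [AddCommGroup M] [Module ℂ M]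
    [Module (MPA ord q') M] [IsScalarTower ℂ (MPA ord q') M] [FiniteDimensional ℂ M]
    (h0 : ∀ m : M, MPA.vertex ord q' .infty • m = 0) : Subsingleton M := by
  by_contra hns
  rw [not_subsingleton_iff_nontrivial] at hns
  have : IsArtinian (MPA ord q') M := isArtinian_of_tower ℂ inferInstance
  obtain ⟨N, hN⟩ := IsAtomic.exists_atom (Submodule (MPA ord q') M)
  have hN' : IsSimpleModule (MPA ord q') N := isSimpleModule_iff_isAtom.mpr hN
  have : FiniteDimensional ℂ N :=
    FiniteDimensional.of_injective ((N.subtype).restrictScalars ℂ) N.injective_subtype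
  exact not_isSimpleModule hnd hall hq N (fun m => Subtype.ext (h0 m)) hN'

/-- The block at `∞` is a line, so either the submodule or the quotient vanishes there, and
whichever does is zero. -/
theorem eq_bot_or_eq_top (hnd : ord.Nodup) (hall : ∀ a, a ∈ ord)
    (hq : IsRegular fun i => q' (.vertex i)) (M : Type w) [AddCommGroup M] [Module ℂ M]
    [Module (MPA ord q') M] [IsScalarTower ℂ (MPA ord q') M] [FiniteDimensional ℂ M]
    (h1 : finrank ℂ (LinearMap.range (Algebra.lsmul ℂ ℂ M (MPA.vertex ord q' .infty))) = 1)
    (N : Submodule (MPA ord q') M) : N = ⊥ ∨ N = ⊤ := by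
  by_cases hN : ∀ n ∈ N, MPA.vertex ord q' .infty • n = 0
  · left
    have : FiniteDimensional ℂ N :=
      FiniteDimensional.of_injective ((N.subtype).restrictScalars ℂ) N.injective_subtype
    have := subsingleton_of_infty_smul_eq_zero hnd hall hq N fun n => Subtype.ext (hN n n.2)
    exact Submodule.subsingleton_iff_eq_bot.mp this
  · right
    push Not at hN
    obtain ⟨n, hn, hne⟩ := hN
    have : FiniteDimensional ℂ (M ⧸ N) :=
      FiniteDimensional.of_surjective ((N.mkQ).restrictScalars ℂ) N.mkQ_surjective
    have hspan := (finrank_eq_one_iff_of_nonzero'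
      (⟨MPA.vertex ord q' .infty • n, n, rfl⟩ :
        LinearMap.range (Algebra.lsmul ℂ ℂ M (MPA.vertex ord q' .infty)))
      (fun h => hne (congrArg Subtype.val h))).mp h1
    have := subsingleton_of_infty_smul_eq_zero hnd hall hq (M ⧸ N) fun m => by
      obtain ⟨m, rfl⟩ := N.mkQ_surjective m
      rw [← map_smul, Submodule.mkQ_apply, Submodule.Quotient.mk_eq_zero]
      obtain ⟨c, hc⟩ := hspan ⟨MPA.vertex ord q' .infty • m, m, rfl⟩
      have hc' : c • (MPA.vertex ord q' .infty • n) = MPA.vertex ord q' .infty • m :=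
        congrArg Subtype.val hc
      rw [← hc', ← algebraMap_smul (MPA ord q')]
      exact N.smul_mem _ (N.smul_mem _ hn)
    exact Submodule.Quotient.subsingleton_iff.mp this

theorem isSimpleModule_of_hasDimVector (hnd : ord.Nodup) (hall : ∀ a, a ∈ ord)
    (hq : IsRegular fun i => q' (.vertex i)) (α : I → ℕ) (M : Type w) [AddCommGroup M]
    [Module ℂ M] [Module (MPA ord q') M] [IsScalarTower ℂ (MPA ord q') M]
    (hdim : HasDimVector (MPA.vertex ord q') (framedDim W α) M) :
    IsSimpleModule (MPA ord q') M := by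
  have hfin : ∀ j, FiniteDimensional ℂ
      (LinearMap.range (Algebra.lsmul ℂ ℂ M (MPA.vertex ord q' j))) := fun j => by
    have := hdim j
    exact Module.rank_lt_aleph0_iff.mp (this ▸ Cardinal.natCast_lt_aleph0)
  -- Finiteness is not part of the dimension condition; it holds because `M` is the sum of its
  -- blocks.
  have : FiniteDimensional ℂ M := by
    let f : (∀ j, LinearMap.range (Algebra.lsmul ℂ ℂ M (MPA.vertex ord q' j))) →ₗ[ℂ] M :=
      ∑ j, (LinearMap.range (Algebra.lsmul ℂ ℂ M (MPA.vertex ord q' j))).subtype ∘ₗ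
        LinearMap.proj j
    refine FiniteDimensional.of_surjective f fun m => ?_
    refine ⟨fun j => ⟨_, m, rfl⟩, ?_⟩
    have := congrArg (· • m) (MPA.sum_vertex ord q')
    simp only [Finset.sum_smul, one_smul] at this
    simpa [f] using this
  have h1 : finrank ℂ (LinearMap.range (Algebra.lsmul ℂ ℂ M (MPA.vertex ord q' .infty))) = 1 := by
    have := hdim .infty
    rw [← finrank_eq_rank] at this
    exact_mod_cast this
  have : Nontrivial M := by
    by_contra h
    rw [not_nontrivial_iff_subsingleton] at h
    rw [finrank_zero_of_subsingleton] at h1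
    exact zero_ne_one h1
  exact { eq_bot_or_eq_top := eq_bot_or_eq_top hnd hall hq M h1 }

end Simplicity

/-! ### Irreducibility of points and freeness of the action -/

section BaseIndex

variable {J : Type u} {α : J → ℕ}

/-- The basis index at a vertex of dimension one. -/
def baseIndex {o : J} (ho : α o = 1) : Σ i, Fin (α i) := ⟨o, ⟨0, by omega⟩⟩

theorem eq_baseIndex {o : J} (ho : α o = 1) {k : Σ i, Fin (α i)} (hk : k.1 = o) :
    k = baseIndex ho := by
  obtain ⟨k, a⟩ := k
  subst hk
  have : Subsingleton (Fin (α k)) := by rw [ho]; infer_instance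
  exact congrArg (Sigma.mk k) (Subsingleton.elim _ _)

end BaseIndex

section Irreducible

variable {J : Type u} [DecidableEq J] {α : J → ℕ}

theorem blockIdem_apply (S : Type*) [CommRing S] (i : J) (k l : Σ i, Fin (α i)) :
    blockIdem α S i k l = if k = l ∧ k.1 = i then 1 else 0 := by
  obtain ⟨k, a⟩ := k
  obtain ⟨l, b⟩ := l
  rw [blockIdem, Matrix.blockDiagonal'_apply]
  by_cases h : k = l
  · subst h
    by_cases hk : k = i
    · subst hk
      simp [Matrix.one_apply]
    · simp [hk]
  · have : ¬ ((⟨k, a⟩ : Σ i, Fin (α i)) = ⟨l, b⟩) := fun h' => h (congrArg Sigma.fst h')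
    simp [h, this]

theorem blockIdem_eq_diagonal (S : Type*) [CommRing S] (i : J) :
    blockIdem α S i = Matrix.diagonal fun k => if k.1 = i then 1 else 0 := by
  ext k l
  rw [blockIdem_apply, Matrix.diagonal_apply]
  by_cases h : k = l <;> simp [h]

variable [Fintype J]

theorem blockIdem_mulVec (S : Type*) [CommRing S] (i : J) (v : (Σ i, Fin (α i)) → S) (k) :
    (blockIdem α S i).mulVec v k = if k.1 = i then v k else 0 := by
  rw [blockIdem_eq_diagonal, Matrix.mulVec_diagonal]
  simp

theorem blockIdem_mul (S : Type*) [CommRing S] (i : J) (X : BlockMat α S) (k l) :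
    (blockIdem α S i * X) k l = if k.1 = i then X k l else 0 := by
  rw [blockIdem_eq_diagonal, Matrix.diagonal_mul]
  simp

theorem mul_blockIdem (S : Type*) [CommRing S] (i : J) (X : BlockMat α S) (k l) :
    (X * blockIdem α S i) k l = if l.1 = i then X k l else 0 := by
  rw [blockIdem_eq_diagonal, Matrix.mul_diagonal]
  simp

/-- A point of the representation space is irreducible if it has no proper nonzero invariant
subspaces. -/
def RepPoint.IsIrred {A : Type w} [Ring A] [Algebra ℂ A] {e : J → A} (ρ : RepPoint e α ℂ) : Prop :=
  ∀ U : Submodule ℂ ((Σ i, Fin (α i)) → ℂ),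
    (∀ x, ∀ u ∈ U, Matrix.mulVec (ρ.toAlgHom x) u ∈ U) → U = ⊥ ∨ U = ⊤

end Irreducible

section Framed

variable {I : Type u} [Fintype I] [DecidableEq I] [Quiver.{v} I]
  {W : I → Type v} {ord : List (DoubledArrow (Framed I W))} {q : I → ℂˣ} {α : I → ℕ}

theorem FramedRep.isIrred [∀ i j : I, Finite (i ⟶ j)] (hnd : ord.Nodup) (hall : ∀ a, a ∈ ord)
    (hq : IsRegular q) (ρ : FramedRep W ord α q) : ρ.IsIrred := by
  intro U hU
  let V := (Σ i, Fin (framedDim W α i)) → ℂ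
  let φ : FramedMPA W ord α q →ₐ[ℂ] End ℂ V :=
    (Matrix.toLinAlgEquiv' : BlockMat (framedDim W α) ℂ ≃ₐ[ℂ] End ℂ V).toAlgHom.comp ρ.toAlgHom
  let _ : Module (FramedMPA W ord α q) V := Module.compHom V (φ : FramedMPA W ord α q →+* End ℂ V)
  have hsmul : ∀ (x : FramedMPA W ord α q) (v : V), x • v = (ρ.toAlgHom x).mulVec v :=
    fun x v => rfl
  have : IsScalarTower ℂ (FramedMPA W ord α q) V := ⟨fun c x v => by
    rw [hsmul, hsmul, map_smul, Matrix.smul_mulVec]⟩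
  have ho : framedDim W α .infty = 1 := rfl
  have hr : finrank ℂ (LinearMap.range
      (Algebra.lsmul ℂ ℂ V (MPA.vertex ord (framedParam W α q) .infty))) = 1 := by
    have hne : (Pi.single (baseIndex ho) 1 : V) ≠ 0 := by
      intro h
      have := congrFun h (baseIndex ho)
      simp at this
    have : LinearMap.range (Algebra.lsmul ℂ ℂ V (MPA.vertex ord (framedParam W α q) .infty)) =
        ℂ ∙ (Pi.single (baseIndex ho) 1 : V) := by
      have key : ∀ v : V, (Algebra.lsmul ℂ ℂ V (MPA.vertex ord (framedParam W α q) .infty)) v =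
          v (baseIndex ho) • (Pi.single (baseIndex ho) 1 : V) := by
        intro v
        change (ρ.toAlgHom (framedVertex W ord α q .infty)).mulVec v = _
        rw [ρ.map_idem]
        funext k
        rw [blockIdem_mulVec]
        by_cases hk : k.1 = .infty
        · have := eq_baseIndex ho hk
          subst this
          simp [hk]
        · have : k ≠ baseIndex ho := fun h => hk (by rw [h]; rfl)
          simp [hk, this]
      ext v
      rw [Submodule.mem_span_singleton]
      constructor
      · rintro ⟨v, rfl⟩
        exact ⟨_, (key v).symm⟩
      · rintro ⟨c, rfl⟩
        refine ⟨c • Pi.single (baseIndex ho) 1, ?_⟩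
        rw [key, Pi.smul_apply, Pi.single_eq_same, smul_eq_mul, mul_one]
    rw [this]
    exact finrank_span_singleton hne
  let N : Submodule (FramedMPA W ord α q) V :=
    { U.toAddSubmonoid with smul_mem' := fun x u hu => hU x u hu }
  rcases eq_bot_or_eq_top (q' := framedParam W α q) hnd hall hq V hr N with h | h
  · left
    rw [eq_bot_iff]
    intro u hu
    have : u ∈ N := hu
    rwa [h] at this
  · right
    rw [eq_top_iff]
    intro u _
    have : u ∈ N := by rw [h]; trivial
    exact this

/-- A stabilizing `G` commutes with the representation, so the kernel of `G - 1` is invariant. It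
contains the basis vector at `∞`, where `G` is `1`, and is therefore the whole space. -/
theorem eq_one_of_smul_eq [∀ i j : I, Finite (i ⟶ j)] (hnd : ord.Nodup) (hall : ∀ a, a ∈ ord)
    (hq : IsRegular q) (ρ : FramedRep W ord α q) (g : GLdim α ℂ)
    (hg : extendByOne W g • ρ = ρ) : g = 1 := by
  set G : BlockMat (framedDim W α) ℂ := (toBlock (framedDim W α) ℂ (extendByOne W g)).val with hG
  have hcomm : ∀ x, G * ρ.toAlgHom x = ρ.toAlgHom x * G := by
    intro x
    have h1 := congrArg (fun r : FramedRep W ord α q => r.toAlgHom x) hg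
    simp only [smul_toAlgHom_apply] at h1
    rw [← mul_assoc, Units.mul_inv_eq_iff_eq_mul] at h1
    exact h1
  have ho : framedDim W α .infty = 1 := rfl
  have hdiag : G = Matrix.blockDiagonal' fun i =>
      (extendByOne W g i : Matrix (Fin (framedDim W α i)) (Fin (framedDim W α i)) ℂ) := rfl
  have h1 : LinearMap.ker (Matrix.toLin' (G - 1)) = ⊤ := by
    refine (FramedRep.isIrred hnd hall hq ρ _ ?_).resolve_left ?_
    · intro x u hu
      rw [LinearMap.mem_ker, Matrix.toLin'_apply] at hu ⊢
      rw [Matrix.mulVec_mulVec, sub_mul, one_mul, hcomm]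
      have : ρ.toAlgHom x * G - ρ.toAlgHom x = ρ.toAlgHom x * (G - 1) := by
        rw [mul_sub, mul_one]
      rw [this, ← Matrix.mulVec_mulVec, hu, Matrix.mulVec_zero]
    · intro h
      have hmem : (Pi.single (baseIndex ho) 1 : (Σ i, Fin (framedDim W α i)) → ℂ) ∈
          LinearMap.ker (Matrix.toLin' (G - 1)) := by
        rw [LinearMap.mem_ker, Matrix.toLin'_apply, Matrix.sub_mulVec, Matrix.one_mulVec, sub_eq_zero,
          Matrix.mulVec_single_one]
        funext k
        rw [Matrix.col_apply, hdiag]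
        obtain ⟨k, a⟩ := k
        by_cases hk : k = .infty
        · subst hk
          have := eq_baseIndex ho (k := ⟨.infty, a⟩) rfl
          rw [this, Pi.single_eq_same, baseIndex, Matrix.blockDiagonal'_apply_eq]
          exact Matrix.one_apply_eq _
        · have : (⟨k, a⟩ : Σ i, Fin (framedDim W α i)) ≠ baseIndex ho := fun h =>
            hk (congrArg Sigma.fst h)
          rw [Pi.single_eq_of_ne this, baseIndex, Matrix.blockDiagonal'_apply_ne _ _ _ hk]
      rw [h, Submodule.mem_bot] at hmem
      have := congrFun hmem (baseIndex ho)
      simp at this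
  have h2 : G = 1 := by
    rw [LinearMap.ker_eq_top] at h1
    have : G - 1 = 0 := by
      rw [← map_zero Matrix.toLin'] at h1
      exact Matrix.toLin'.injective h1
    exact sub_eq_zero.mp this
  funext i
  ext a b
  have h3 : ∀ a b : Fin (framedDim W α (.vertex i)), (extendByOne W g (.vertex i)).val a b =
      (1 : BlockMat (framedDim W α) ℂ) ⟨.vertex i, a⟩ ⟨.vertex i, b⟩ := by
    intro a b
    rw [← h2, hdiag, Matrix.blockDiagonal'_apply_eq]
  change (g i).val a b = (1 : Matrix (Fin (α i)) (Fin (α i)) ℂ) a b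
  refine Eq.trans (h3 a b) ?_
  by_cases hab : a = b
  · subst hab
    rw [Matrix.one_apply_eq, Matrix.one_apply_eq]
  · rw [Matrix.one_apply_ne hab, Matrix.one_apply_ne]
    intro h
    exact hab (eq_of_heq (Sigma.mk.inj_iff.mp h).2)

end Framed

/-! ### The functor of points of the representation scheme -/

section Points

variable {J : Type u} {A : Type w} [Ring A] [Algebra ℂ A] [DecidableEq J] [Fintype J]
  {e : J → A} {α : J → ℕ}

theorem blockIdem_mapMatrix {S T : Type*} [CommRing S] [CommRing T] (f : S →+* T) (i : J) :
    f.mapMatrix (blockIdem α S i) = blockIdem α T i := by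
  ext k l
  rw [RingHom.mapMatrix_apply, Matrix.map_apply, blockIdem_apply, blockIdem_apply]
  split_ifs <;> simp

/-- Base change of points. -/
def RepPoint.map {S T : Type*} [CommRing S] [Algebra ℂ S] [CommRing T] [Algebra ℂ T]
    (f : S →ₐ[ℂ] T) (ρ : RepPoint e α S) : RepPoint e α T where
  toAlgHom := f.mapMatrix.comp ρ.toAlgHom
  map_idem i := by
    rw [AlgHom.comp_apply, ρ.map_idem]
    exact blockIdem_mapMatrix f.toRingHom i

theorem RepPoint.map_apply {S T : Type*} [CommRing S] [Algebra ℂ S] [CommRing T] [Algebra ℂ T]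
    (f : S →ₐ[ℂ] T) (ρ : RepPoint e α S) (x : A) (k l) :
    (ρ.map f).toAlgHom x k l = f (ρ.toAlgHom x k l) := rfl

theorem univPoint_apply (x : A) (k l) :
    (univPoint e α).toAlgHom x k l = coord e α x k l := rfl

theorem RepRing.induction {P : RepRing e α → Prop} (hcoord : ∀ x k l, P (coord e α x k l))
    (hscalar : ∀ c : ℂ, P (algebraMap ℂ _ c)) (hadd : ∀ x y, P x → P y → P (x + y))
    (hmul : ∀ x y, P x → P y → P (x * y)) (r : RepRing e α) : P r := by
  obtain ⟨p, rfl⟩ := Ideal.Quotient.mk_surjective r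
  induction p using MvPolynomial.induction_on with
  | C c => exact hscalar c
  | add p q hp hq => rw [map_add]; exact hadd _ _ hp hq
  | mul_X p t hp => rw [map_mul]; exact hmul _ _ hp (hcoord t.1 t.2.1 t.2.2)

theorem RepRing.algHom_ext {S : Type*} [Semiring S] [Algebra ℂ S] {f g : RepRing e α →ₐ[ℂ] S}
    (h : ∀ x k l, f (coord e α x k l) = g (coord e α x k l)) : f = g := by
  refine AlgHom.ext fun r => ?_
  induction r using RepRing.induction with
  | hcoord x k l => exact h x k l
  | hscalar c => simp
  | hadd x y hx hy => rw [map_add, map_add, hx, hy]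
  | hmul x y hx hy => rw [map_mul, map_mul, hx, hy]

theorem evalPoint_univPoint_map {S : Type*} [CommRing S] [Algebra ℂ S] (f : RepRing e α →ₐ[ℂ] S) :
    evalPoint e α ((univPoint e α).map f) = f :=
  RepRing.algHom_ext fun x k l => by
    rw [evalPoint_coord, RepPoint.map_apply, univPoint_apply]

theorem evalPoint_map {S T : Type*} [CommRing S] [Algebra ℂ S] [CommRing T] [Algebra ℂ T]
    (f : S →ₐ[ℂ] T) (ρ : RepPoint e α S) :
    evalPoint e α (ρ.map f) = f.comp (evalPoint e α ρ) :=
  RepRing.algHom_ext fun x k l => by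
    rw [evalPoint_coord, RepPoint.map_apply, AlgHom.comp_apply, evalPoint_coord]

/-- With `evalPoint_univPoint_map`, this says that `RepRing` represents the functor of points.
Lifting problems for algebra homomorphisms thereby become lifting problems for representations. -/
theorem univPoint_map_evalPoint {S : Type*} [CommRing S] [Algebra ℂ S] (ρ : RepPoint e α S) :
    (univPoint e α).map (evalPoint e α ρ) = ρ := by
  ext1; ext x k l
  rw [RepPoint.map_apply, univPoint_apply, evalPoint_coord]

instance RepRing.finiteType [Algebra.FiniteType ℂ A] : Algebra.FiniteType ℂ (RepRing e α) := by
  obtain ⟨s, hs⟩ := ‹Algebra.FiniteType ℂ A›.out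
  classical
  let t : Set (RepRing e α) :=
    (fun z : s × (Σ i, Fin (α i)) × (Σ i, Fin (α i)) => coord e α z.1 z.2.1 z.2.2) '' Set.univ
  have ht : t.Finite := Set.finite_univ.image _
  refine ⟨⟨ht.toFinset, ?_⟩⟩
  rw [Set.Finite.coe_toFinset]
  have key : ∀ x : A, ∀ k l, coord e α x k l ∈ Algebra.adjoin ℂ t := by
    intro x
    have hx : x ∈ Algebra.adjoin ℂ (s : Set A) := by rw [hs]; trivial
    simp only [← univPoint_apply]
    induction hx using Algebra.adjoin_induction with
    | mem x hx => exact fun k l => Algebra.subset_adjoin ⟨⟨⟨x, hx⟩, k, l⟩, trivial, rfl⟩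
    | algebraMap c =>
      intro k l
      rw [AlgHom.commutes, Matrix.algebraMap_matrix_apply]
      split_ifs
      · exact Subalgebra.algebraMap_mem _ c
      · exact zero_mem _
    | add x y _ _ hx hy =>
      intro k l
      rw [map_add]
      exact add_mem (hx k l) (hy k l)
    | mul x y _ _ hx hy =>
      intro k l
      rw [map_mul, Matrix.mul_apply]
      exact sum_mem fun m _ => mul_mem (hx k m) (hy m l)
  rw [eq_top_iff]
  intro r _
  induction r using RepRing.induction with
  | hcoord x k l => exact key x k l
  | hscalar c => exact Subalgebra.algebraMap_mem _ c
  | hadd x y hx hy => exact add_mem (hx trivial) (hy trivial)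
  | hmul x y hx hy => exact mul_mem (hx trivial) (hy trivial)

end Points

instance MPA.finiteType {J : Type u} [Quiver.{v} J] [Fintype J] [∀ i j : J, Finite (i ⟶ j)]
    (ord : List (DoubledArrow J)) (q : J → ℂˣ) : Algebra.FiniteType ℂ (MPA ord q) := by
  have h1 : Finite (Quiver.Total J) := by
    refine Finite.of_injective
      (fun a : Quiver.Total J => (⟨a.left, a.right, a.hom⟩ : Σ i : J, Σ j : J, (i ⟶ j))) ?_
    rintro ⟨a, b, x⟩ ⟨c, d, y⟩ h
    cases h
    rfl
  have h2 : Finite (DoubledArrow J) := Finite.of_equiv _ DoubledArrow.equivSum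
  have h3 : Finite (Gen J) := by
    refine Finite.of_surjective
      (Sum.elim Gen.vertex (Sum.elim Gen.arrow Gen.inverse) :
        J ⊕ (DoubledArrow J ⊕ DoubledArrow J) → Gen J) ?_
    rintro (i | a | a)
    · exact ⟨.inl i, rfl⟩
    · exact ⟨.inr (.inl a), rfl⟩
    · exact ⟨.inr (.inr a), rfl⟩
  exact Algebra.FiniteType.of_surjective (RingQuot.mkAlgHom ℂ (Rel ord q))
    (RingQuot.mkAlgHom_surjective ℂ (Rel ord q))

/-- The Nullstellensatz: the residue field is finite over `ℂ`, hence equal to it. -/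
theorem exists_algHom_of_isMaximal {R : Type*} [CommRing R] [Algebra ℂ R] [Algebra.FiniteType ℂ R]
    (m : Ideal R) [m.IsMaximal] : ∃ χ : R →ₐ[ℂ] ℂ, RingHom.ker χ = m := by
  let _ : Field (R ⧸ m) := Ideal.Quotient.field m
  have : Module.Finite ℂ (R ⧸ m) := finite_of_finite_type_of_isJacobsonRing ℂ (R ⧸ m)
  have hb : Function.Bijective (algebraMap ℂ (R ⧸ m)) :=
    IsAlgClosed.algebraMap_bijective_of_isIntegral
  let f : ℂ ≃ₐ[ℂ] R ⧸ m := AlgEquiv.ofBijective (Algebra.ofId ℂ (R ⧸ m)) hb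
  refine ⟨f.symm.toAlgHom.comp (Ideal.Quotient.mkₐ ℂ m), ?_⟩
  ext r
  rw [RingHom.mem_ker, AlgHom.comp_apply]
  change f.symm _ = 0 ↔ _
  rw [EmbeddingLike.map_eq_zero_iff, Ideal.Quotient.mkₐ_eq_mk, Ideal.Quotient.eq_zero_iff_mem]

/-- A proper submodule of a finite module over a finitely generated `ℂ`-algebra is annihilated by
a nonzero functional which is semilinear over a point of the algebra. -/
theorem exists_functional {R M : Type*} [CommRing R] [Algebra ℂ R] [Algebra.FiniteType ℂ R]
    [AddCommGroup M] [Module R M] [Module.Finite R M] (N : Submodule R M) (hN : N ≠ ⊤) :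
    ∃ (χ : R →ₐ[ℂ] ℂ) (ψ : M →+ ℂ), (∀ r m, ψ (r • m) = χ r * ψ m) ∧ ψ ≠ 0 ∧
      ∀ m ∈ N, ψ m = 0 := by
  -- Since the module is finite, `N` lies in a maximal submodule; the simple quotient is a residue
  -- field of `R`, which is `ℂ`.
  obtain ⟨K, hK, hNK⟩ := (eq_top_or_exists_le_coatom N).resolve_left hN
  have hs : IsSimpleModule R (M ⧸ K) := isSimpleModule_iff_isCoatom.mpr hK
  obtain ⟨m, hm, ⟨f⟩⟩ := isSimpleModule_iff_quot_maximal.mp hs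
  obtain ⟨χ, hχ⟩ := exists_algHom_of_isMaximal m
  let g : R ⧸ m →+* ℂ := Ideal.Quotient.lift m χ.toRingHom fun r hr => by
    rw [← hχ] at hr
    exact hr
  have hg : ∀ r : R, g (Ideal.Quotient.mk m r) = χ r := fun r => rfl
  refine ⟨χ, g.toAddMonoidHom.comp ((f.toLinearMap ∘ₗ K.mkQ).toAddMonoidHom), ?_, ?_, ?_⟩
  · intro r x
    change g (f (K.mkQ (r • x))) = χ r * g (f (K.mkQ x))
    rw [map_smul, map_smul, Algebra.smul_def, map_mul]
    rfl
  · intro h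
    obtain ⟨x, hx⟩ := f.surjective 1
    obtain ⟨x, rfl⟩ := K.mkQ_surjective x
    have h1 : g (f (K.mkQ x)) = 0 := DFunLike.congr_fun h x
    rw [hx, map_one] at h1
    exact one_ne_zero h1
  · intro x hx
    change g (f (K.mkQ x)) = 0
    have : K.mkQ x = 0 := by
      rw [Submodule.mkQ_apply, Submodule.Quotient.mk_eq_zero]
      exact hNK hx
    rw [this, map_zero, map_zero]

/-! ### Logarithmic derivative of an ordered product and its transpose -/

section LogDerivative

variable {D M M' : Type*} [Ring M] [Ring M']

/-- The logarithmic derivative of the product of the units `F a`, `a ∈ L`, along the tangent vector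
with logarithmic components `δ a`. -/
def dlog (F : D → Mˣ) (δ : D → M) : List D → M
  | [] => 0
  | a :: L => δ a + (F a).val * dlog F δ L * ((F a)⁻¹ : Mˣ).val

theorem map_dlog (f : M →+* M') (F : D → Mˣ) (δ : D → M) (L : List D) :
    f (dlog F δ L) = dlog (fun a => Units.map (f : M →* M') (F a)) (fun a => f (δ a)) L := by
  induction L with
  | nil => simp [dlog]
  | cons a L ih =>
    simp only [dlog, map_add, map_mul, ih]
    rfl

theorem dlog_add (F : D → Mˣ) (δ δ' : D → M) (L : List D) :
    dlog F (δ + δ') L = dlog F δ L + dlog F δ' L := by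
  induction L with
  | nil => simp [dlog]
  | cons a L ih => simp only [dlog, ih, Pi.add_apply]; noncomm_ring

theorem dlog_smul {R : Type*} [CommRing R] [Algebra R M] (r : R) (F : D → Mˣ) (δ : D → M)
    (L : List D) : dlog F (r • δ) L = r • dlog F δ L := by
  induction L with
  | nil => simp [dlog]
  | cons a L ih => simp only [dlog, ih, Pi.smul_apply, smul_add, mul_smul_comm, smul_mul_assoc]

theorem commute_dlog {x : M} {F : D → Mˣ} {δ : D → M} (hF : ∀ a, Commute x (F a).val)
    (hδ : ∀ a, Commute x (δ a)) (L : List D) : Commute x (dlog F δ L) := by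
  induction L with
  | nil => exact Commute.zero_right x
  | cons a L ih => exact (hδ a).add_right (((hF a).mul_right ih).mul_right (hF a).units_inv_right)

theorem commute_prod {x : M} {F : D → Mˣ} (hF : ∀ a, Commute x (F a).val) (L : List D) :
    Commute x ((L.map F).prod : Mˣ).val := by
  induction L with
  | nil => exact Commute.one_right x
  | cons a L ih =>
    rw [List.map_cons, List.prod_cons, Units.val_mul]
    exact (hF a).mul_right ih

/-- The product of the units `(1 + δ a) F a`, to first order. -/
theorem prod_eq_one_add_dlog_mul (f : M →+* M') (hf : ∀ x y, f x = 0 → f y = 0 → x * y = 0)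
    (F F' : D → Mˣ) (δ : D → M) (hδ : ∀ a, f (δ a) = 0)
    (hF' : ∀ a, (F' a).val = (1 + δ a) * (F a).val) (L : List D) :
    f (dlog F δ L) = 0 ∧
      ((L.map F').prod : Mˣ).val = (1 + dlog F δ L) * ((L.map F).prod : Mˣ).val := by
  induction L with
  | nil => simp [dlog]
  | cons a L ih =>
    refine ⟨by simp [dlog, hδ, ih.1], ?_⟩
    rw [List.map_cons, List.prod_cons, List.map_cons, List.prod_cons, Units.val_mul, Units.val_mul,
      ih.2, hF', dlog]
    -- The cross term is a product of two elements of the kernel, so it vanishes and only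
    -- first-order terms remain.
    have h0 : δ a * ((F a).val * dlog F δ L * ((F a)⁻¹ : Mˣ).val) = 0 :=
      hf _ _ (hδ a) (by simp [ih.1])
    have h1 : (F a).val + (F a).val * dlog F δ L =
        (1 + (F a).val * dlog F δ L * ((F a)⁻¹ : Mˣ).val) * (F a).val := by
      rw [add_mul, one_mul, Units.inv_mul_cancel_right]
    calc (1 + δ a) * (F a).val * ((1 + dlog F δ L) * ((L.map F).prod : Mˣ).val)
        = (1 + δ a) * ((F a).val + (F a).val * dlog F δ L) * ((L.map F).prod : Mˣ).val := by
          noncomm_ring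
      _ = (1 + δ a) * (1 + (F a).val * dlog F δ L * ((F a)⁻¹ : Mˣ).val) *
          ((F a).val * ((L.map F).prod : Mˣ).val) := by
          rw [h1]; noncomm_ring
      _ = _ := by
          rw [add_mul, mul_add, mul_add, h0]; noncomm_ring

variable [DecidableEq D]

/-- The conjugate `P⁻¹ ξ P` of `ξ` by the partial product `P` of the units `F b` over the entries
`b` of the list which precede `a`. -/
def conjAt (F : D → Mˣ) : List D → M → D → M
  | [], ξ, _ => ξ
  | b :: L, ξ, a => if a = b then ξ else conjAt F L (((F b)⁻¹ : Mˣ).val * ξ * (F b).val) a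

theorem commute_conjAt {x : M} {F : D → Mˣ} (hF : ∀ a, Commute x (F a).val) (L : List D) :
    ∀ ξ : M, Commute x ξ → ∀ a, Commute x (conjAt F L ξ a) := by
  induction L with
  | nil => exact fun ξ h a => h
  | cons b L ih =>
    intro ξ h a
    rw [conjAt]
    split_ifs
    · exact h
    · exact ih _ (((hF b).units_inv_right.mul_right h).mul_right (hF b)) a

/-- The conjugation by the first factor is trivial because `ξ` commutes with it; the same then holds
for the second factor, and so on along the list. -/
theorem conjAt_eq_self {F : D → Mˣ} {L : List D} (hL : L.Nodup) :
    ∀ ξ : M, (∀ a ∈ L, Commute (conjAt F L ξ a) (F a).val) → ∀ a ∈ L, conjAt F L ξ a = ξ := by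
  induction L with
  | nil => simp
  | cons b L ih =>
    intro ξ h a ha
    have hb : Commute ξ (F b).val := by simpa [conjAt] using h b (by simp)
    have hξ : ((F b)⁻¹ : Mˣ).val * ξ * (F b).val = ξ := by
      rw [mul_assoc, hb.eq, Units.inv_mul_cancel_left]
    rw [List.nodup_cons] at hL
    have hne : ∀ a ∈ L, conjAt F (b :: L) ξ a = conjAt F L ξ a := by
      intro a ha
      rw [conjAt, if_neg (ne_of_mem_of_not_mem ha hL.1), hξ]
    rcases List.mem_cons.mp ha with rfl | ha
    · simp [conjAt]
    · rw [hne a ha]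
      refine ih hL.2 ξ (fun c hc => ?_) a ha
      rw [← hne c hc]
      exact h c (List.mem_cons_of_mem _ hc)

/-- Cyclicity of the trace moves the conjugation by the preceding factors from `δ a` to `ξ`, so
`conjAt` is the transpose of `dlog`. -/
theorem trace_dlog_mul {C : Type*} [AddCommGroup C] (τ : M →+ C)
    (hτ : ∀ x y, τ (x * y) = τ (y * x)) (F : D → Mˣ) (δ : D → M) {L : List D} (hL : L.Nodup) :
    ∀ ξ : M, τ (dlog F δ L * ξ) = (L.map fun a => τ (δ a * conjAt F L ξ a)).sum := by
  induction L with
  | nil => simp [dlog]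
  | cons b L ih =>
    intro ξ
    rw [List.nodup_cons] at hL
    rw [dlog, add_mul, map_add, List.map_cons, List.sum_cons]
    congr 1
    · simp [conjAt]
    · rw [mul_assoc, mul_assoc, hτ, mul_assoc, ih hL.2]
      congr 1
      refine List.map_congr_left fun a ha => ?_
      rw [conjAt, if_neg (ne_of_mem_of_not_mem ha hL.1)]

end LogDerivative

/-! ### Tangent vectors and square-zero deformations of representations -/

/-- A representation in a ring of the double of a quiver, with invertible elements `1 + a a*`; the
units `F a` are `(1 + a a*)^{ε(a)}`. -/
structure DoubleRep (J : Type u) [Quiver.{v} J] (M : Type*) [Ring M] where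
  E : J → M
  X : DoubledArrow J → M
  F : DoubledArrow J → Mˣ
  idem : ∀ i, E i * E i = E i
  orth : ∀ i j, i ≠ j → E i * E j = 0
  tail : ∀ a, E a.tail * X a = X a
  head : ∀ a, X a * E a.head = X a
  fwd : ∀ t, (F (.fwd t)).val = 1 + X (.fwd t) * X (.rev t)
  rev : ∀ t, ((F (.rev t))⁻¹ : Mˣ).val = 1 + X (.rev t) * X (.fwd t)

namespace DoubleRep

variable {J : Type u} [Quiver.{v} J] {M M' : Type*} [Ring M] [Ring M'] (V : DoubleRep J M)

/-- The logarithmic components of the tangent vector at `F` given by a tangent vector `d` at `X`. -/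
def logTangent (d : DoubledArrow J → M) : DoubledArrow J → M
  | .fwd t => (d (.fwd t) * V.X (.rev t) + V.X (.fwd t) * d (.rev t)) *
      ((V.F (.fwd t))⁻¹ : Mˣ).val
  -- For a reversed arrow it is the inverse of `F` that is polynomial in the arrows; hence the form
  -- `dF F⁻¹ = -F d(F⁻¹)`.
  | .rev t => -((V.F (.rev t)).val * (d (.rev t) * V.X (.fwd t) + V.X (.rev t) * d (.fwd t)))

theorem logTangent_add (d d' : DoubledArrow J → M) :
    V.logTangent (d + d') = V.logTangent d + V.logTangent d' := by
  funext a
  cases a <;> simp only [logTangent, Pi.add_apply] <;> noncomm_ring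

theorem logTangent_smul {R : Type*} [CommRing R] [Algebra R M] (r : R) (d : DoubledArrow J → M) :
    V.logTangent (r • d) = r • V.logTangent d := by
  funext a
  cases a <;> simp only [logTangent, Pi.smul_apply, smul_mul_assoc, mul_smul_comm, ← smul_add,
    smul_neg]

variable {V} in
theorem map_logTangent {V' : DoubleRep J M'} {f : M →+* M'}
    (hX : ∀ a, f (V.X a) = V'.X a)
    (hF : ∀ a, Units.map (f : M →* M') (V.F a) = V'.F a) (d : DoubledArrow J → M) (a) :
    f (V.logTangent d a) = V'.logTangent (fun a => f (d a)) a := by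
  cases a with
  | fwd t =>
    simp only [logTangent, map_mul, map_add, hX, ← hF, ← map_inv]
    rfl
  | rev t =>
    simp only [logTangent, map_mul, map_add, map_neg, hX, ← hF]
    rfl

theorem commute_mul (i : J) {j : J} {x y : M} (hxt : V.E j * x = x) (hyh : y * V.E j = y) :
    Commute (V.E i) (x * y) := by
  by_cases h : i = j
  · subst h
    rw [commute_iff_eq, ← mul_assoc, hxt, mul_assoc, hyh]
  · rw [commute_iff_eq, ← hxt, ← hyh]
    simp only [← mul_assoc]
    rw [V.orth _ _ h]
    simp only [mul_assoc]
    rw [V.orth _ _ (Ne.symm h)]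
    simp

theorem head_rev (t : Quiver.Total J) :
    V.X (.rev t) * V.E (DoubledArrow.fwd t).tail = V.X (.rev t) := V.head (.rev t)

theorem head_fwd (t : Quiver.Total J) :
    V.X (.fwd t) * V.E (DoubledArrow.rev t).tail = V.X (.fwd t) := V.head (.fwd t)

theorem commute_F (i : J) (a : DoubledArrow J) : Commute (V.E i) (V.F a).val := by
  cases a with
  | fwd t =>
    rw [V.fwd]
    exact (Commute.one_right _).add_right
      (V.commute_mul i (V.tail (.fwd t)) (V.head_rev t))
  | rev t =>
    have : Commute (V.E i) ((V.F (.rev t))⁻¹ : Mˣ).val := by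
      rw [V.rev]
      exact (Commute.one_right _).add_right
        (V.commute_mul i (V.tail (.rev t)) (V.head_fwd t))
    simpa using this.units_inv_right

theorem commute_logTangent {d : DoubledArrow J → M} (htail : ∀ a, V.E a.tail * d a = d a)
    (hhead : ∀ a, d a * V.E a.head = d a) (i : J) (a : DoubledArrow J) :
    Commute (V.E i) (V.logTangent d a) := by
  cases a with
  | fwd t =>
    exact ((V.commute_mul i (htail (.fwd t)) (V.head_rev t)).add_right
      (V.commute_mul i (V.tail (.fwd t)) (hhead (.rev t)))).mul_right
        (V.commute_F i _).units_inv_right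
  | rev t =>
    exact ((V.commute_F i _).mul_right
      ((V.commute_mul i (htail (.rev t)) (V.head_fwd t)).add_right
      (V.commute_mul i (V.tail (.rev t)) (hhead (.fwd t))))).neg_right

/-- Deforming a representation along a square-zero ideal. -/
theorem exists_deform (f : M →+* M') (hf : ∀ x y, f x = 0 → f y = 0 → x * y = 0)
    (d : DoubledArrow J → M) (hd : ∀ a, f (d a) = 0) (htail : ∀ a, V.E a.tail * d a = d a)
    (hhead : ∀ a, d a * V.E a.head = d a) :
    ∃ V' : DoubleRep J M, V'.E = V.E ∧ (∀ a, V'.X a = V.X a + d a) ∧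
      ∀ a, (V'.F a).val = (1 + V.logTangent d a) * (V.F a).val := by
  have hδ : ∀ a, f (V.logTangent d a) = 0 := by
    rintro (t | t) <;> simp [logTangent, hd]
  have hδ2 : ∀ a, V.logTangent d a * V.logTangent d a = 0 := fun a => hf _ _ (hδ a) (hδ a)
  let u : DoubledArrow J → Mˣ := fun a =>
    { val := 1 + V.logTangent d a
      inv := 1 - V.logTangent d a
      val_inv := by
        have := hδ2 a
        calc _ = 1 - V.logTangent d a * V.logTangent d a := by noncomm_ring
          _ = 1 := by rw [this, sub_zero]
      inv_val := by
        have := hδ2 a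
        calc _ = 1 - V.logTangent d a * V.logTangent d a := by noncomm_ring
          _ = 1 := by rw [this, sub_zero] }
  refine ⟨⟨V.E, fun a => V.X a + d a, fun a => u a * V.F a, V.idem, V.orth, ?_, ?_, ?_, ?_⟩,
    rfl, fun a => rfl, fun a => rfl⟩
  · intro a; rw [mul_add, V.tail, htail]
  · intro a; rw [add_mul, V.head, hhead]
  · intro t
    rw [Units.val_mul]
    change (1 + (d (.fwd t) * V.X (.rev t) + V.X (.fwd t) * d (.rev t)) *
      ((V.F (.fwd t))⁻¹ : Mˣ).val) * (V.F (.fwd t)).val = _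
    rw [add_mul, Units.inv_mul_cancel_right, one_mul, V.fwd, add_mul, mul_add, mul_add,
      hf _ _ (hd (.fwd t)) (hd (.rev t))]
    abel
  · intro t
    rw [mul_inv_rev, Units.val_mul]
    change ((V.F (.rev t))⁻¹ : Mˣ).val * (1 - -((V.F (.rev t)).val *
      (d (.rev t) * V.X (.fwd t) + V.X (.rev t) * d (.fwd t)))) = _
    rw [sub_neg_eq_add, mul_add, Units.inv_mul_cancel_left, mul_one, V.rev, add_mul, mul_add,
      mul_add, hf _ _ (hd (.rev t)) (hd (.fwd t))]
    abel

end DoubleRep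

/-- The hypotheses say that `F x` and `H y` intertwine `a` and `b`, in opposite directions. So `a`
commutes with `F x H y = F - 1`, and `b` with `H y F x = H⁻¹ - 1`. If `a = b`, it commutes with `F
x` and `F`, hence with `x`, and likewise with `y`. -/
theorem commute_of_dual {M : Type*} [Ring M] {x y a b : M} {F H : Mˣ} (hF : F.val = 1 + x * y)
    (hH : (H⁻¹ : Mˣ).val = 1 + y * x) (h1 : y * (F⁻¹ : Mˣ).val * a = b * H.val * y)
    (h2 : (F⁻¹ : Mˣ).val * a * x = x * b * H.val) :
    Commute a F.val ∧ Commute b H.val ∧ (a = b → Commute a x ∧ Commute a y) := by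
  have hy : y * F.val = (H⁻¹ : Mˣ).val * y := by rw [hF, hH]; noncomm_ring
  have hx : F.val * x = x * (H⁻¹ : Mˣ).val := by rw [hF, hH]; noncomm_ring
  have hY : H.val * y = y * (F⁻¹ : Mˣ).val := by
    rw [Units.eq_mul_inv_iff_mul_eq, mul_assoc, hy, Units.mul_inv_cancel_left]
  have e1 : H.val * y * a = b * (H.val * y) := by rw [hY, h1, mul_assoc, hY]
  have e2 : a * (F.val * x) = F.val * x * b := by
    have : a * x = F.val * (x * b * H.val) := by rw [← h2, mul_assoc, Units.mul_inv_cancel_left]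
    rw [hx, ← mul_assoc, this, mul_assoc, mul_assoc, mul_assoc, Units.mul_inv, mul_one, ← mul_assoc,
      hx]
  have eZY : F.val * x * (H.val * y) = F.val - 1 := by
    rw [hx, mul_assoc, Units.inv_mul_cancel_left, hF]; abel
  have eYZ : H.val * y * (F.val * x) = (H⁻¹ : Mˣ).val - 1 := by
    rw [hY, mul_assoc, Units.inv_mul_cancel_left, hH]; abel
  have ha : Commute a F.val := by
    have : Commute a (F.val - 1) := by
      rw [commute_iff_eq, ← eZY, ← mul_assoc, e2, mul_assoc, ← e1, ← mul_assoc]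
    simpa using this.add_right (Commute.one_right a)
  have hb : Commute b H.val := by
    have : Commute b ((H⁻¹ : Mˣ).val - 1) := by
      rw [commute_iff_eq, ← eYZ, ← mul_assoc, ← e1, mul_assoc, e2, ← mul_assoc]
    have h' : Commute b (H⁻¹ : Mˣ).val := by simpa using this.add_right (Commute.one_right b)
    simpa using h'.units_inv_right
  refine ⟨ha, hb, ?_⟩
  rintro rfl
  constructor
  · have : F.val * (a * x) = F.val * (x * a) := by
      rw [← mul_assoc, ← ha.eq, mul_assoc, e2, mul_assoc]
    exact F.isUnit.mul_left_cancel this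
  · have : H.val * (a * y) = H.val * (y * a) := by
      rw [← mul_assoc, ← hb.eq, mul_assoc, ← e1, mul_assoc]
    exact (H.isUnit.mul_left_cancel this)

theorem eq_zero_of_trace {n : Type*} [Fintype n] {z : Matrix n n ℂ}
    (h : ∀ w : Matrix n n ℂ, Matrix.trace (w * z) = 0) : z = 0 :=
  Matrix.ext_iff_trace_mul_left.mpr fun w => by rw [h, mul_zero, Matrix.trace_zero]

/-! ### Orthogonality to the differential of the moment map -/

section Duality

variable {J : Type u} [Quiver.{v} J]

theorem sum_map_eq_add {C : Type*} [AddCommMonoid C] {L : List (DoubledArrow J)} (hnd : L.Nodup)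
    (hall : ∀ a, a ∈ L) (t : Quiver.Total J) (g : DoubledArrow J → C)
    (hg : ∀ a, a ≠ .fwd t → a ≠ .rev t → g a = 0) :
    (L.map g).sum = g (.fwd t) + g (.rev t) := by
  classical
  rw [← List.sum_toFinset _ hnd,
    ← Finset.sum_subset (Finset.subset_iff.mpr fun a _ => List.mem_toFinset.mpr (hall a)),
    Finset.sum_pair (a := .fwd t) (b := .rev t) (by simp)]
  intro a _ ha
  simp only [Finset.mem_insert, Finset.mem_singleton, not_or] at ha
  exact hg a ha.1 ha.2

section Ring

variable {M C : Type*} [Ring M] [AddCommGroup C] (τ : M →+ C)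
  {p p' w x G F a b : M}

/-- Isolates the free variable `w` under the trace, so that nondegeneracy turns the vanishing of a
variation along one arrow into a matrix identity. The idempotents `p` and `p'` cut out the arrow's
component and are absorbed by `sandwich_left_eq`. -/
theorem map_sandwich_left (hτ : ∀ x y, τ (x * y) = τ (y * x)) :
    τ (p * w * p' * x * G * a) + τ (-(F * (x * (p * w * p'))) * b) =
      τ (w * (p' * (x * G * a - b * F * x) * p)) := by
  rw [neg_mul, map_neg, ← sub_eq_add_neg, show p * w * p' * x * G * a = p * (w * p' * x * G * a) by
    noncomm_ring, show F * (x * (p * w * p')) * b = F * x * p * (w * p' * b) by noncomm_ring,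
    hτ p, hτ (F * x * p), ← map_sub]
  congr 1
  noncomm_ring

theorem map_sandwich_right (hτ : ∀ x y, τ (x * y) = τ (y * x)) :
    τ (x * (p' * w * p) * G * a) + τ (-(F * (p' * w * p * x)) * b) =
      τ (w * (p * (G * a * x - x * b * F) * p')) := by
  rw [neg_mul, map_neg, ← sub_eq_add_neg, show x * (p' * w * p) * G * a = x * p' * (w * p * G * a) by
    noncomm_ring, show F * (p' * w * p * x) * b = F * p' * (w * p * x * b) by noncomm_ring,
    hτ (x * p'), hτ (F * p'), ← map_sub]
  congr 1
  noncomm_ring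

theorem sandwich_left_eq (h1 : p' * x = x) (h2 : x * p = x) (hG : Commute p G) (ha : Commute p a)
    (hF : Commute p' F) (hb : Commute p' b) :
    p' * (x * G * a - b * F * x) * p = x * G * a - b * F * x := by
  have e1 : p' * (x * G * a) * p = x * G * a := by
    rw [mul_assoc x, ← mul_assoc p', h1, mul_assoc x, ← (hG.mul_right ha).eq, ← mul_assoc, h2]
  have e2 : p' * (b * F * x) * p = b * F * x := by
    rw [← mul_assoc p', (hb.mul_right hF).eq, mul_assoc, mul_assoc, mul_assoc, h2, h1, mul_assoc]
  rw [mul_sub, sub_mul, e1, e2]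

theorem sandwich_right_eq (h1 : p * x = x) (h2 : x * p' = x) (hG : Commute p G) (ha : Commute p a)
    (hF : Commute p' F) (hb : Commute p' b) :
    p * (G * a * x - x * b * F) * p' = G * a * x - x * b * F := by
  have e1 : p * (G * a * x) * p' = G * a * x := by
    rw [← mul_assoc p, (hG.mul_right ha).eq, mul_assoc, mul_assoc, mul_assoc, h2, h1, mul_assoc]
  have e2 : p * (x * b * F) * p' = x * b * F := by
    rw [mul_assoc x, ← mul_assoc p, h1, mul_assoc x, ← (hb.mul_right hF).eq, ← mul_assoc, h2]
  rw [mul_sub, sub_mul, e1, e2]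

end Ring

section Ring

variable {M : Type*} [Ring M] (V : DoubleRep J M) {d : DoubledArrow J → M}

theorem DoubleRep.logTangent_fwd_of_left {t} (h : d (.rev t) = 0) :
    V.logTangent d (.fwd t) = d (.fwd t) * V.X (.rev t) * ((V.F (.fwd t))⁻¹ : Mˣ).val := by
  rw [logTangent, h, mul_zero, add_zero]

theorem DoubleRep.logTangent_rev_of_left {t} (h : d (.rev t) = 0) :
    V.logTangent d (.rev t) = -((V.F (.rev t)).val * (V.X (.rev t) * d (.fwd t))) := by
  rw [logTangent, h, zero_mul, zero_add]

theorem DoubleRep.logTangent_fwd_of_right {t} (h : d (.fwd t) = 0) :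
    V.logTangent d (.fwd t) = V.X (.fwd t) * d (.rev t) * ((V.F (.fwd t))⁻¹ : Mˣ).val := by
  rw [logTangent, h, zero_mul, zero_add]

theorem DoubleRep.logTangent_rev_of_right {t} (h : d (.fwd t) = 0) :
    V.logTangent d (.rev t) = -((V.F (.rev t)).val * (d (.rev t) * V.X (.fwd t))) := by
  rw [logTangent, h, mul_zero, add_zero]

theorem DoubleRep.logTangent_eq_zero {a} (h : d a = 0) (h' : d a.star = 0) :
    V.logTangent d a = 0 := by
  cases a with
  | fwd t => rw [V.logTangent_fwd_of_left h', h]; simp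
  | rev t => rw [V.logTangent_rev_of_left h, show d (.fwd t) = 0 from h']; simp

variable [DecidableEq (DoubledArrow J)]

/-- An element orthogonal to the image of the logarithmic differential of the moment map commutes
with all arrows. -/
theorem DoubleRep.commute_of_map_dlog {C : Type*} [AddCommGroup C] (τ : M →+ C)
    (hτ : ∀ x y, τ (x * y) = τ (y * x)) (hnondeg : ∀ x, (∀ w, τ (w * x) = 0) → x = 0)
    {L : List (DoubledArrow J)} (hnd : L.Nodup) (hall : ∀ a, a ∈ L) {ξ : M}
    (hξ : ∀ i, Commute (V.E i) ξ)
    (h : ∀ d : DoubledArrow J → M,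
      τ (dlog V.F (V.logTangent fun a => V.E a.tail * d a * V.E a.head) L * ξ) = 0)
    (a : DoubledArrow J) : Commute ξ (V.X a) := by
  set c := conjAt V.F L ξ with hc
  have hcE : ∀ i a, Commute (V.E i) (c a) := fun i a =>
    commute_conjAt (V.commute_F i) L ξ (hξ i) a
  -- Varying one arrow of the pair `t` affects only the two factors that belong to `t`.
  have hsum : ∀ (b : DoubledArrow J) (w : M) (t : Quiver.Total J) (_ : b = .fwd t ∨ b = .rev t),
      τ (V.logTangent (fun a => V.E a.tail * (Pi.single b w : DoubledArrow J → M) a * V.E a.head)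
        (.fwd t) * c (.fwd t)) +
      τ (V.logTangent (fun a => V.E a.tail * (Pi.single b w : DoubledArrow J → M) a * V.E a.head)
        (.rev t) * c (.rev t)) = 0 := by
    intro b w t hb
    rw [← h (Pi.single b w), trace_dlog_mul τ hτ _ _ hnd, sum_map_eq_add hnd hall t]
    intro a hf hr
    rw [V.logTangent_eq_zero, zero_mul, map_zero]
    · have : a ≠ b := by rintro rfl; rcases hb with h | h <;> contradiction
      rw [Pi.single_eq_of_ne this, mul_zero, zero_mul]
    · have : a.star ≠ b := by
        rintro rfl
        rcases a with s | s <;> rcases hb with h | h <;> cases h <;> contradiction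
      rw [Pi.single_eq_of_ne this, mul_zero, zero_mul]
  have h1 : ∀ t, V.X (.rev t) * ((V.F (.fwd t))⁻¹ : Mˣ).val * c (.fwd t) =
      c (.rev t) * (V.F (.rev t)).val * V.X (.rev t) := by
    intro t
    rw [← sub_eq_zero, ← sandwich_left_eq (V.tail (.rev t)) (V.head (.rev t))
      (V.commute_F _ _).units_inv_right (hcE _ _) (V.commute_F _ _) (hcE _ _)]
    refine hnondeg _ fun w => ?_
    rw [← map_sandwich_left τ hτ, ← hsum (.fwd t) w t (.inl rfl), V.logTangent_fwd_of_left,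
      V.logTangent_rev_of_left, Pi.single_eq_same]
    · rfl
    all_goals rw [Pi.single_eq_of_ne (by simp), mul_zero, zero_mul]
  have h2 : ∀ t, ((V.F (.fwd t))⁻¹ : Mˣ).val * c (.fwd t) * V.X (.fwd t) =
      V.X (.fwd t) * c (.rev t) * (V.F (.rev t)).val := by
    intro t
    rw [← sub_eq_zero, ← sandwich_right_eq (V.tail (.fwd t)) (V.head (.fwd t))
      (V.commute_F _ _).units_inv_right (hcE _ _) (V.commute_F _ _) (hcE _ _)]
    refine hnondeg _ fun w => ?_
    rw [← map_sandwich_right τ hτ, ← hsum (.rev t) w t (.inr rfl), V.logTangent_fwd_of_right,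
      V.logTangent_rev_of_right, Pi.single_eq_same]
    · rfl
    all_goals rw [Pi.single_eq_of_ne (by simp), mul_zero, zero_mul]
  have key := fun t => commute_of_dual (V.fwd t) (V.rev t) (h1 t) (h2 t)
  -- By `commute_of_dual` each conjugate of `ξ` commutes with the corresponding factor, so no
  -- conjugation changes `ξ`. In particular the conjugates at an arrow and its opposite coincide, as
  -- the last conclusion of `commute_of_dual` requires.
  have hself : ∀ a, c a = ξ := fun a => conjAt_eq_self hnd ξ (fun a _ => by
    rcases a with t | t
    · exact (key t).1
    · exact (key t).2.1) a (hall a)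
  rcases a with t | t
  · have := (key t).2.2 (by rw [hself, hself])
    rw [hself] at this
    exact this.1
  · have := (key t).2.2 (by rw [hself, hself])
    rw [hself] at this
    exact this.2

end Ring

end Duality

/-! ### The differential of the moment map away from one vertex -/

section Tangent

variable {J : Type u} [DecidableEq J] {α : J → ℕ}

/-- The block-diagonal part of a matrix, outside of the block at the vertex `o`. -/
def offPart {S : Type*} [CommRing S] (o : J) (z : BlockMat α S) : BlockMat α S :=
  Matrix.of fun k l => if k.1 = l.1 ∧ k.1 ≠ o then z k l else 0

section OffPart

variable {S : Type*} [CommRing S] (o : J)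

theorem offPart_apply (z : BlockMat α S) (k l) :
    offPart o z k l = if k.1 = l.1 ∧ k.1 ≠ o then z k l else 0 := rfl

theorem offPart_zero : offPart o (0 : BlockMat α S) = 0 := by
  ext k l; simp [offPart_apply]

theorem offPart_add (z z' : BlockMat α S) : offPart o (z + z') = offPart o z + offPart o z' := by
  ext k l
  simp only [offPart_apply, Matrix.add_apply]
  split_ifs <;> simp

theorem offPart_smul (r : S) (z : BlockMat α S) : offPart o (r • z) = r • offPart o z := by
  ext k l
  simp only [offPart_apply, Matrix.smul_apply]
  split_ifs <;> simp

theorem offPart_offPart (z : BlockMat α S) : offPart o (offPart o z) = offPart o z := by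
  ext k l
  simp only [offPart_apply]
  split_ifs <;> simp

variable [Fintype J]

theorem offPart_mapMatrix {T : Type*} [CommRing T] (f : S →+* T) (z : BlockMat α S) :
    f.mapMatrix (offPart o z) = offPart o (f.mapMatrix z) := by
  ext k l
  simp only [offPart_apply, RingHom.mapMatrix_apply, Matrix.map_apply]
  split_ifs <;> simp

/-- The projection is self-adjoint for the trace form, because it selects a symmetric set of
entries. -/
theorem trace_offPart_mul (z ξ : BlockMat α S) :
    Matrix.trace (offPart o z * ξ) = Matrix.trace (z * offPart o ξ) := by
  simp only [Matrix.trace, Matrix.diag_apply, Matrix.mul_apply, offPart_apply]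
  refine Finset.sum_congr rfl fun k _ => Finset.sum_congr rfl fun l _ => ?_
  by_cases h : k.1 = l.1
  · simp [h]
  · simp [h, Ne.symm h]

theorem commute_blockIdem_offPart (i : J) (z : BlockMat α S) :
    Commute (blockIdem α S i) (offPart o z) := by
  rw [commute_iff_eq]
  ext k l
  rw [blockIdem_mul, mul_blockIdem, offPart_apply]
  by_cases h : k.1 = l.1
  · rw [h]
  · simp [h]

theorem apply_eq_zero_of_commute {z : BlockMat α S} (h : ∀ i, Commute (blockIdem α S i) z) {k l}
    (hkl : k.1 ≠ l.1) : z k l = 0 := by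
  have := congrFun (congrFun (h k.1).eq k) l
  rw [blockIdem_mul, mul_blockIdem] at this
  simpa [Ne.symm hkl] using this

end OffPart

variable [Fintype J] [Quiver.{v} J]

namespace DoubleRep

variable {S : Type*} [CommRing S] (V : DoubleRep J (BlockMat α S)) (L : List (DoubledArrow J))
  (o : J)

/-- The component of a tangent vector which respects tails and heads. -/
def arrowPart (d : DoubledArrow J → BlockMat α S) (a : DoubledArrow J) : BlockMat α S :=
  blockIdem α S a.tail * d a * blockIdem α S a.head

/-- The differential of the moment map outside of the block at `o`, together with a complementary
projection. -/
def tangentMap (d : DoubledArrow J → BlockMat α S) (z : BlockMat α S) : BlockMat α S :=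
  -- The second summand fills the complement of the off-`o` block-diagonal matrices. Surjectivity
  -- onto those can thus be stated as surjectivity onto all matrices, a free module.
  offPart o (dlog V.F (V.logTangent (arrowPart d)) L) + (z - offPart o z)

/-- `tangentMap` as a linear map. -/
def tangentLin : ((DoubledArrow J → BlockMat α S) × BlockMat α S) →ₗ[S] BlockMat α S where
  toFun x := V.tangentMap L o x.1 x.2
  map_add' x y := by
    have : arrowPart (x.1 + y.1) = arrowPart x.1 + arrowPart y.1 := by
      funext a; simp only [arrowPart, Pi.add_apply]; noncomm_ring
    simp only [tangentMap, Prod.fst_add, Prod.snd_add, this, logTangent_add, dlog_add, offPart_add]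
    abel
  map_smul' r x := by
    have : arrowPart (r • x.1) = r • arrowPart x.1 := by
      funext a; simp only [arrowPart, Pi.smul_apply, mul_smul_comm, smul_mul_assoc]
    simp only [tangentMap, Prod.smul_fst, Prod.smul_snd, this, logTangent_smul, dlog_smul,
      offPart_smul, RingHom.id_apply, smul_add, smul_sub]

theorem tangentLin_apply (x) : V.tangentLin L o x = V.tangentMap L o x.1 x.2 := rfl

variable {V} in
theorem mapMatrix_tangentMap {T : Type*} [CommRing T] {V' : DoubleRep J (BlockMat α T)}
    {f : S →+* T} (hX : ∀ a, f.mapMatrix (V.X a) = V'.X a)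
    (hF : ∀ a, Units.map (f.mapMatrix : BlockMat α S →+* BlockMat α T).toMonoidHom (V.F a) = V'.F a) (d z) :
    f.mapMatrix (V.tangentMap L o d z) =
      V'.tangentMap L o (fun a => f.mapMatrix (d a)) (f.mapMatrix z) := by
  have h1 : ∀ a, f.mapMatrix (arrowPart d a) = arrowPart (fun a => f.mapMatrix (d a)) a := by
    intro a
    simp only [arrowPart, map_mul, blockIdem_mapMatrix]
  rw [tangentMap, tangentMap, map_add, map_sub, offPart_mapMatrix, offPart_mapMatrix, map_dlog]
  simp only [map_logTangent hX hF, h1]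
  rw [← funext hF]
  rfl

end DoubleRep

/-- The transpose of the differential of the moment map is injective at an irreducible point. -/
theorem DoubleRep.eq_zero_of_trace_tangentMap (V : DoubleRep J (BlockMat α ℂ))
    (hE : V.E = blockIdem α ℂ) {L : List (DoubledArrow J)} (hnd : L.Nodup) (hall : ∀ a, a ∈ L)
    {o : J} (ho : α o = 1)
    (hirr : ∀ U : Submodule ℂ ((Σ i, Fin (α i)) → ℂ),
      (∀ i, ∀ u ∈ U, (blockIdem α ℂ i).mulVec u ∈ U) → (∀ a, ∀ u ∈ U, (V.X a).mulVec u ∈ U) →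
      U = ⊥ ∨ U = ⊤)
    (ξ : BlockMat α ℂ) (h : ∀ d z, Matrix.trace (V.tangentMap L o d z * ξ) = 0) : ξ = 0 := by
  classical
  -- Varying only `z` shows that `ξ` has no component in the complement.
  have hξ : offPart o ξ = ξ := by
    have : ξ - offPart o ξ = 0 := by
      refine eq_zero_of_trace fun z => ?_
      have h1 : V.tangentMap L o 0 z = z - offPart o z := by
        have h0 := (V.tangentLin L o).map_zero
        rw [tangentLin_apply, Prod.fst_zero, Prod.snd_zero, tangentMap, offPart_zero, sub_zero,
          add_zero] at h0
        rw [tangentMap, h0, zero_add]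
      have := h 0 z
      rw [h1, sub_mul, Matrix.trace_sub, trace_offPart_mul] at this
      rw [mul_sub, Matrix.trace_sub, this]
    exact (sub_eq_zero.mp this).symm
  have hξE : ∀ i, Commute (V.E i) ξ := by
    intro i
    rw [hE, ← hξ]
    exact commute_blockIdem_offPart o i ξ
  have hX : ∀ a, Commute ξ (V.X a) := by
    refine V.commute_of_map_dlog (Matrix.traceAddMonoidHom (Σ i, Fin (α i)) ℂ)
      (fun x y => Matrix.trace_mul_comm x y) (fun x hx => eq_zero_of_trace hx) hnd hall hξE
      fun d => ?_
    have h2 := h d 0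
    rw [tangentMap, offPart_zero, sub_zero, add_zero, trace_offPart_mul, hξ] at h2
    rw [hE]
    exact h2
  -- The kernel of `ξ` is a subrepresentation. It is nonzero since `ξ` has no block at `o` and kills
  -- the basis vector there.
  have hker : LinearMap.ker (Matrix.toLin' ξ) = ⊤ := by
    refine (hirr _ (fun i u hu => ?_) fun a u hu => ?_).resolve_left fun hbot => ?_
    · rw [LinearMap.mem_ker, Matrix.toLin'_apply] at hu ⊢
      rw [Matrix.mulVec_mulVec, ← hE, ← (hξE i).eq, ← Matrix.mulVec_mulVec, hu, Matrix.mulVec_zero]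
    · rw [LinearMap.mem_ker, Matrix.toLin'_apply] at hu ⊢
      rw [Matrix.mulVec_mulVec, (hX a).eq, ← Matrix.mulVec_mulVec, hu, Matrix.mulVec_zero]
    · have hmem : (Pi.single (baseIndex ho) 1 : (Σ i, Fin (α i)) → ℂ) ∈
          LinearMap.ker (Matrix.toLin' ξ) := by
        rw [LinearMap.mem_ker, Matrix.toLin'_apply, Matrix.mulVec_single_one, ← hξ]
        funext k
        rw [Matrix.col_apply, offPart_apply, Pi.zero_apply, if_neg]
        rintro ⟨h1, h2⟩
        exact h2 h1
      rw [hbot, Submodule.mem_bot] at hmem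
      have := congrFun hmem (baseIndex ho)
      simp at this
  rw [LinearMap.ker_eq_top, ← map_zero Matrix.toLin'] at hker
  exact Matrix.toLin'.injective hker

end Tangent

/-! ### Lifting units and arrows along square-zero extensions -/

section Lifting

variable {M M' : Type*} [Ring M] [Ring M'] (f : M →+* M')

/-- For any lift `y` of the inverse, `x y - 1` and `y x - 1` have square zero, so `2 - x y` and `2 -
y x` correct `y` to one-sided inverses. -/
theorem isUnit_of_map_of_sq_zero (hsurj : Function.Surjective f)
    (hf : ∀ x y, f x = 0 → f y = 0 → x * y = 0) {x : M} (hx : IsUnit (f x)) : IsUnit x := by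
  obtain ⟨u, hu⟩ := hx
  obtain ⟨y, hy⟩ := hsurj (u⁻¹ : M'ˣ).val
  have h1 : f (x * y - 1) = 0 := by rw [map_sub, map_mul, ← hu, hy, Units.mul_inv, map_one, sub_self]
  have h2 : f (y * x - 1) = 0 := by rw [map_sub, map_mul, ← hu, hy, Units.inv_mul, map_one, sub_self]
  have e1 : x * (y * (2 - x * y)) = 1 := by
    have := hf _ _ h1 h1
    rw [← sub_eq_zero, ← neg_eq_zero, ← this]
    noncomm_ring
  have e2 : ((2 - y * x) * y) * x = 1 := by
    have := hf _ _ h2 h2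
    rw [← sub_eq_zero, ← neg_eq_zero, ← this]
    noncomm_ring
  exact isUnit_iff_exists_and_exists.mpr ⟨⟨_, e1⟩, ⟨_, e2⟩⟩

/-- Without the moment relation there is no obstruction: the arrows are lifted arbitrarily and cut
down by the idempotents, and invertibility lifts by itself. -/
theorem DoubleRep.exists_lift {J : Type u} [Quiver.{v} J] (V : DoubleRep J M')
    (hsurj : Function.Surjective f) (hf : ∀ x y, f x = 0 → f y = 0 → x * y = 0) (E : J → M)
    (hE : ∀ i, f (E i) = V.E i) (hidem : ∀ i, E i * E i = E i)
    (horth : ∀ i j, i ≠ j → E i * E j = 0) :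
    ∃ V' : DoubleRep J M, V'.E = E ∧ (∀ a, f (V'.X a) = V.X a) ∧
      ∀ a, Units.map f.toMonoidHom (V'.F a) = V.F a := by
  choose y hy using fun a => hsurj (V.X a)
  let X : DoubledArrow J → M := fun a => E a.tail * y a * E a.head
  have hX : ∀ a, f (X a) = V.X a := fun a => by
    simp only [X, map_mul, hE, hy, V.tail, V.head]
  have hu : ∀ a : DoubledArrow J, IsUnit (1 + X a * X a.star) := by
    intro a
    refine isUnit_of_map_of_sq_zero f hsurj hf ?_
    rw [map_add, map_one, map_mul, hX, hX]
    rcases a with t | t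
    · exact ⟨_, V.fwd t⟩
    · exact ⟨_, V.rev t⟩
  choose U hU using hu
  refine ⟨⟨E, X, fun a => match a with | .fwd t => U (.fwd t) | .rev t => (U (.rev t))⁻¹, hidem,
    horth, ?_, ?_, ?_, ?_⟩, rfl, hX, ?_⟩
  · intro a; simp only [X, ← mul_assoc, hidem]
  · intro a; simp only [X, mul_assoc, hidem]
  · exact fun t => hU _
  · intro t; simp only [inv_inv]; exact hU _
  · rintro (t | t)
    · ext
      change f (U (.fwd t)).val = _
      rw [hU, V.fwd, map_add, map_one, map_mul, hX, hX]; rfl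
    · rw [← inv_inj]
      ext
      change f (U (.rev t)).val = _
      rw [hU, V.rev, map_add, map_one, map_mul, hX, hX]; rfl

end Lifting

/-! ### Formal smoothness of the representation scheme -/

section Smooth

variable {J : Type u} [DecidableEq J] [Fintype J] {α : J → ℕ}

theorem blockIdem_mul_self (S : Type*) [CommRing S] (i : J) :
    blockIdem α S i * blockIdem α S i = blockIdem α S i := by
  ext k l
  rw [blockIdem_mul, blockIdem_apply]
  by_cases hk : k.1 = i <;> simp [hk]

theorem blockIdem_mul_of_ne (S : Type*) [CommRing S] {i j : J} (h : i ≠ j) :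
    blockIdem α S i * blockIdem α S j = 0 := by
  ext k l
  rw [blockIdem_mul, blockIdem_apply]
  by_cases hk : k.1 = i
  · simp [hk, h]
  · simp [hk]

theorem sum_smul_blockIdem (S : Type*) [CommRing S] [Algebra ℂ S] (c : J → ℂ) :
    ∑ i, c i • blockIdem α S i = Matrix.diagonal fun k => algebraMap ℂ S (c k.1) := by
  ext k l
  rw [Matrix.sum_apply, Matrix.diagonal_apply]
  simp only [Matrix.smul_apply, blockIdem_apply]
  by_cases h : k = l
  · subst h
    simp [Algebra.algebraMap_eq_smul_one]
  · simp [h]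

theorem sum_blockIdem (S : Type*) [CommRing S] [Algebra ℂ S] :
    ∑ i, blockIdem α S i = 1 := by
  have := sum_smul_blockIdem (α := α) S fun _ => 1
  simpa using this

/-- A matrix which commutes with the idempotents, agrees with `q` outside of the vertex `o` of
dimension one, and has determinant one. -/
theorem eq_sum_smul_blockIdem {q : J → ℂˣ} {S : Type*} [CommRing S] [Algebra ℂ S] {o : J} (ho : α o = 1)
    (hq : ∏ i, q i ^ α i = 1) {Φ : BlockMat α S} (hΦ : ∀ i, Commute (blockIdem α S i) Φ)
    (h : ∀ i, i ≠ o → blockIdem α S i * Φ = (q i : ℂ) • blockIdem α S i) (hdet : Φ.det = 1) :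
    Φ = ∑ i, (q i : ℂ) • blockIdem α S i := by
  have hrow : ∀ k l, k.1 ≠ o → Φ k l = if k = l then algebraMap ℂ S (q k.1) else 0 := by
    intro k l hk
    have := congrFun (congrFun (h k.1 hk) k) l
    rw [blockIdem_mul, if_pos rfl, Matrix.smul_apply, blockIdem_apply] at this
    rw [this]
    simp [Algebra.algebraMap_eq_smul_one]
  set c := Φ (baseIndex ho) (baseIndex ho) with hc
  have hdiag : Φ = Matrix.diagonal fun k =>
      if k = baseIndex ho then c else algebraMap ℂ S (q k.1) := by
    ext k l
    rw [Matrix.diagonal_apply]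
    by_cases hk : k.1 = o
    · obtain rfl := eq_baseIndex ho hk
      by_cases hl : l.1 = o
      · obtain rfl := eq_baseIndex ho hl
        simp [hc]
      · have h1 : (baseIndex ho).1 ≠ l.1 := fun h => hl (h ▸ hk)
        rw [apply_eq_zero_of_commute hΦ h1, if_neg]
        rintro rfl
        exact hl hk
    · have : k ≠ baseIndex ho := fun h => hk (congrArg Sigma.fst h)
      rw [hrow k l hk, if_neg this]
  have hprod : ∏ k : Σ i, Fin (α i), algebraMap ℂ S (q k.1) = 1 := by
    rw [Fintype.prod_sigma]
    simp only [Finset.prod_const, Finset.card_univ, Fintype.card_fin]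
    have := congrArg (fun u : ℂˣ => algebraMap ℂ S u) hq
    simpa using this
  -- The determinants of `Φ` and of the expected diagonal matrix are both `1` and share all factors
  -- but the one at `o`, so these agree too.
  have hco : c = algebraMap ℂ S (q o) := by
    rw [hdiag, Matrix.det_diagonal, ← Finset.mul_prod_erase _ _ (Finset.mem_univ (baseIndex ho)),
      if_pos rfl] at hdet
    rw [← Finset.mul_prod_erase _ _ (Finset.mem_univ (baseIndex ho))] at hprod
    rw [Finset.prod_congr rfl fun k hk => if_neg (Finset.ne_of_mem_erase hk)] at hdet
    exact (IsUnit.of_mul_eq_one_right _ hdet).mul_right_cancel (hdet.trans hprod.symm)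
  rw [sum_smul_blockIdem, hdiag]
  congr 1
  funext k
  split_ifs with hk
  · rw [hk]; exact hco
  · rfl

variable [Quiver.{v} J] {ord : List (DoubledArrow J)} {q : J → ℂˣ}

/-- The representation of the double underlying a point of the representation space. -/
def RepPoint.doubleRep {S : Type*} [CommRing S] [Algebra ℂ S]
    (ρ : RepPoint (MPA.vertex ord q) α S) : DoubleRep J (BlockMat α S) where
  E := blockIdem α S
  X a := ρ.toAlgHom (MPA.arrow ord q a)
  F a := Units.map (ρ.toAlgHom : MPA ord q →* BlockMat α S) (MPA.factor ord q a)
  idem := blockIdem_mul_self S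
  orth _ _ h := blockIdem_mul_of_ne S h
  tail a := by rw [← ρ.map_idem, ← map_mul, MPA.vertex_tail_mul]
  head a := by rw [← ρ.map_idem, ← map_mul, MPA.mul_vertex_head]
  fwd t := by
    change ρ.toAlgHom (1 + MPA.arrow ord q (.fwd t) * MPA.arrow ord q (.rev t)) = _
    rw [map_add, map_one, map_mul]
  rev t := by
    rw [← map_inv, MPA.factor, inv_inv]
    change ρ.toAlgHom (1 + MPA.arrow ord q (.rev t) * MPA.arrow ord q (.fwd t)) = _
    rw [map_add, map_one, map_mul]

theorem RepPoint.prod_doubleRep {S : Type*} [CommRing S] [Algebra ℂ S]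
    (ρ : RepPoint (MPA.vertex ord q) α S) :
    ((ord.map ρ.doubleRep.F).prod : (BlockMat α S)ˣ).val = ∑ i, (q i : ℂ) • blockIdem α S i := by
  have h1 : (ord.map ρ.doubleRep.F).prod =
      Units.map (ρ.toAlgHom : MPA ord q →* BlockMat α S) (ord.map (MPA.factor ord q)).prod := by
    rw [map_list_prod, List.map_map]
    rfl
  rw [h1]
  change ρ.toAlgHom ((ord.map (MPA.factor ord q)).prod).val = _
  rw [MPA.prod_factor, map_sum]
  simp only [map_smul, ρ.map_idem]

theorem RepPoint.mapMatrix_tangentMap {S T : Type*} [CommRing S] [Algebra ℂ S] [CommRing T]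
    [Algebra ℂ T] (f : S →ₐ[ℂ] T) (ρ : RepPoint (MPA.vertex ord q) α S)
    (L : List (DoubledArrow J)) (o : J) (d z) :
    (f : S →+* T).mapMatrix (ρ.doubleRep.tangentMap L o d z) =
      (ρ.map f).doubleRep.tangentMap L o (fun a => (f : S →+* T).mapMatrix (d a))
        ((f : S →+* T).mapMatrix z) :=
  DoubleRep.mapMatrix_tangentMap L o (fun _ => rfl) (fun _ => rfl) d z

/-- Stability under the idempotents and the arrows suffices: finite dimension gives stability under
the inverses, and these generate the algebra. -/
theorem RepPoint.IsIrred.eq_bot_or_eq_top {ρ : RepPoint (MPA.vertex ord q) α ℂ} (h : ρ.IsIrred)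
    (U : Submodule ℂ ((Σ i, Fin (α i)) → ℂ))
    (hE : ∀ i, ∀ u ∈ U, (blockIdem α ℂ i).mulVec u ∈ U)
    (hX : ∀ a, ∀ u ∈ U, (ρ.doubleRep.X a).mulVec u ∈ U) : U = ⊥ ∨ U = ⊤ := by
  refine h U fun x => ?_
  induction x using MPA.induction with
  | hvertex i => rw [ρ.map_idem]; exact hE i
  | harrow a => exact hX a
  | hinv a =>
    set g := Units.map (ρ.toAlgHom : MPA ord q →* BlockMat α ℂ) (MPA.unit ord q a) with hg
    have hgU : ∀ u ∈ U, g.val.mulVec u ∈ U := by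
      intro u hu
      have : g.val = 1 + ρ.doubleRep.X a * ρ.doubleRep.X a.star := by
        change ρ.toAlgHom (1 + MPA.arrow ord q a * MPA.arrow ord q a.star) = _
        rw [map_add, map_one, map_mul]; rfl
      rw [this, Matrix.add_mulVec, Matrix.one_mulVec, ← Matrix.mulVec_mulVec]
      exact U.add_mem hu (hX _ _ (hX _ _ hu))
    let T : U →ₗ[ℂ] U := (Matrix.toLin' g.val).restrict hgU
    have hT : Function.Injective T := by
      rintro ⟨x, hx⟩ ⟨y, hy⟩ hxy
      have h1 : g.val.mulVec x = g.val.mulVec y := congrArg Subtype.val hxy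
      have h2 := congrArg ((g⁻¹ : (BlockMat α ℂ)ˣ).val.mulVec) h1
      rw [Matrix.mulVec_mulVec, Matrix.mulVec_mulVec, Units.inv_mul, Matrix.one_mulVec,
        Matrix.one_mulVec] at h2
      exact Subtype.ext h2
    intro u hu
    obtain ⟨⟨x, hx⟩, hxu⟩ := (LinearMap.injective_iff_surjective.mp hT) ⟨u, hu⟩
    have h1 : g.val.mulVec x = u := congrArg Subtype.val hxu
    change (g⁻¹ : (BlockMat α ℂ)ˣ).val.mulVec u ∈ U
    rw [← h1, Matrix.mulVec_mulVec, Units.inv_mul, Matrix.one_mulVec]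
    exact hx
  | hscalar c =>
    intro u hu
    rw [AlgHom.commutes, Algebra.algebraMap_eq_smul_one, Matrix.smul_mulVec, Matrix.one_mulVec]
    exact U.smul_mem c hu
  | hadd x y hx hy =>
    intro u hu
    rw [map_add, Matrix.add_mulVec]
    exact U.add_mem (hx u hu) (hy u hu)
  | hmul x y hx hy =>
    intro u hu
    rw [map_mul, ← Matrix.mulVec_mulVec]
    exact hx _ (hy u hu)

/-- If all points are irreducible, the differential of the moment map is as surjective as possible
at the universal point. -/
theorem surjective_tangentLin_univPoint [∀ i j : J, Finite (i ⟶ j)] (hnd : ord.Nodup)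
    (hall : ∀ a, a ∈ ord) {o : J} (ho : α o = 1)
    (hirr : ∀ ρ : RepPoint (MPA.vertex ord q) α ℂ, ρ.IsIrred) :
    Function.Surjective ((univPoint (MPA.vertex ord q) α).doubleRep.tangentLin ord o) := by
  rw [← LinearMap.range_eq_top]
  by_contra hN
  obtain ⟨χ, ψ, hψ, hψ0, hψN⟩ := exists_functional _ hN
  -- The matrix that represents `ψ` for the trace form, hence the interchanged indices.
  set ξ : BlockMat α ℂ := Matrix.of fun l k => ψ (Matrix.single k l 1) with hξ
  have key : ∀ Z : BlockMat α (RepRing (MPA.vertex ord q) α),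
      ψ Z = Matrix.trace ((χ : _ →+* ℂ).mapMatrix Z * ξ) := by
    intro Z
    conv_lhs => rw [Matrix.matrix_eq_sum_single Z]
    simp only [map_sum, Matrix.trace, Matrix.diag_apply, Matrix.mul_apply]
    refine Finset.sum_congr rfl fun k _ => Finset.sum_congr rfl fun l _ => ?_
    rw [show Matrix.single k l (Z k l) = Z k l • Matrix.single k l 1 by simp, hψ]
    rfl
  apply hψ0
  have h0 : ξ = 0 := by
    let ρ := (univPoint (MPA.vertex ord q) α).map χ
    refine ρ.doubleRep.eq_zero_of_trace_tangentMap rfl hnd hall ho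
      (fun U hE hX => (hirr ρ).eq_bot_or_eq_top U hE hX) ξ fun d z => ?_
    -- Complex tangent vectors are regarded as constant ones over the coordinate ring, and the point
    -- `χ` returns them unchanged.
    have hlift : ∀ x : BlockMat α ℂ, (χ : _ →+* ℂ).mapMatrix
        ((algebraMap ℂ (RepRing (MPA.vertex ord q) α)).mapMatrix x) = x := by
      intro x
      ext k l
      exact χ.commutes (x k l)
    have h1 := RepPoint.mapMatrix_tangentMap χ (univPoint (MPA.vertex ord q) α) ord o
      (fun a => (algebraMap ℂ (RepRing (MPA.vertex ord q) α)).mapMatrix (d a))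
      ((algebraMap ℂ (RepRing (MPA.vertex ord q) α)).mapMatrix z)
    simp only [hlift] at h1
    rw [← h1, ← key]
    exact hψN _ ⟨(_, _), rfl⟩
  ext Z
  rw [key, h0, mul_zero, Matrix.trace_zero]
  rfl

/-- Preimages of the matrix units at the universal point are carried along the homomorphism that
defines `ρ`. -/
theorem surjective_tangentLin [∀ i j : J, Finite (i ⟶ j)] (hnd : ord.Nodup)
    (hall : ∀ a, a ∈ ord) {o : J} (ho : α o = 1)
    (hirr : ∀ ρ : RepPoint (MPA.vertex ord q) α ℂ, ρ.IsIrred)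
    {T : Type*} [CommRing T] [Algebra ℂ T] (ρ : RepPoint (MPA.vertex ord q) α T) (k l) :
    ∃ d z, ρ.doubleRep.tangentMap ord o d z = Matrix.single k l 1 := by
  obtain ⟨⟨d, z⟩, h⟩ := surjective_tangentLin_univPoint hnd hall ho hirr (Matrix.single k l 1)
  have h1 := RepPoint.mapMatrix_tangentMap (evalPoint _ _ ρ) (univPoint (MPA.vertex ord q) α) ord o
    d z
  rw [univPoint_map_evalPoint] at h1
  refine ⟨_, _, h1.symm.trans ?_⟩
  rw [← DoubleRep.tangentLin_apply (x := (d, z)), h]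
  ext i j
  rw [RingHom.mapMatrix_apply, Matrix.map_apply, Matrix.single_apply, Matrix.single_apply]
  split_ifs <;> simp

/-- Lifting of points along square-zero extensions. -/
theorem RepPoint.exists_lift {S T : Type*} [CommRing S] [Algebra ℂ S] [CommRing T] [Algebra ℂ T]
    (f : S →ₐ[ℂ] T) (hsurj : Function.Surjective f) (hf : ∀ x y, f x = 0 → f y = 0 → x * y = 0)
    (hnd : ord.Nodup) (hall : ∀ a, a ∈ ord) {o : J} (ho : α o = 1) (hq : ∏ i, q i ^ α i = 1)
    (ρ : RepPoint (MPA.vertex ord q) α T)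
    (hT : ∀ k l, ∃ d z, ρ.doubleRep.tangentMap ord o d z = Matrix.single k l 1) :
    ∃ ρ' : RepPoint (MPA.vertex ord q) α S, ρ'.map f = ρ := by
  set F := (f : S →+* T).mapMatrix (m := Σ i, Fin (α i)) with hF
  have hFsurj : Function.Surjective F := by
    intro Z
    choose z hz using fun k l => hsurj (Z k l)
    exact ⟨Matrix.of z, by ext k l; exact hz k l⟩
  have hF0 : ∀ X, F X = 0 → ∀ k l, f (X k l) = 0 := fun X hX k l => congrFun (congrFun hX k) l
  have hFsq : ∀ x y, F x = 0 → F y = 0 → x * y = 0 := by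
    intro x y hx hy
    ext k l
    rw [Matrix.mul_apply]
    exact Finset.sum_eq_zero fun m _ => hf _ _ (hF0 x hx k m) (hF0 y hy m l)
  obtain ⟨V, hVE, hVX, hVF⟩ := ρ.doubleRep.exists_lift F hFsurj hFsq (blockIdem α S)
    (fun i => blockIdem_mapMatrix (f : S →+* T) i) (blockIdem_mul_self S)
    (fun _ _ h => blockIdem_mul_of_ne S h)
  set Φ := (ord.map V.F).prod with hΦ
  set Q : BlockMat α S := ∑ i, (q i : ℂ) • blockIdem α S i with hQ
  -- The error in the moment relation for an arbitrary lift of the arrows; it lies in the kernel of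
  -- the extension.
  set ζ : BlockMat α S := Q * (Φ⁻¹ : (BlockMat α S)ˣ).val - 1 with hζ
  have hFΦ : Units.map F.toMonoidHom Φ = (ord.map ρ.doubleRep.F).prod := by
    rw [hΦ, map_list_prod, List.map_map]
    congr 2
    exact funext hVF
  have hFζ : F ζ = 0 := by
    have h1 : F Q = ((ord.map ρ.doubleRep.F).prod : (BlockMat α T)ˣ).val := by
      rw [ρ.prod_doubleRep, hQ, sum_smul_blockIdem, sum_smul_blockIdem]
      ext k l
      simp only [hF, RingHom.mapMatrix_apply, Matrix.map_apply, Matrix.diagonal_apply]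
      split_ifs <;> simp
    have h2 : F (Φ⁻¹ : (BlockMat α S)ˣ).val =
        ((ord.map ρ.doubleRep.F).prod⁻¹ : (BlockMat α T)ˣ).val := by
      rw [← hFΦ, ← map_inv]; rfl
    rw [hζ, map_sub, map_mul, map_one, h1, h2, Units.mul_inv, sub_self]
  choose d z hdz using hT
  choose d' hd' using fun k l a => hFsurj (d k l a)
  choose z' hz' using fun k l => hFsurj (z k l)
  -- The correcting tangent vector: preimages of the matrix units, weighted by the entries of the
  -- error.
  set x : (DoubledArrow J → BlockMat α S) × BlockMat α S :=
    ∑ k, ∑ l, ζ k l • (d' k l, z' k l) with hx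
  -- The lifted preimages map to the matrix units only modulo the kernel. The discrepancy disappears
  -- after multiplication by entries of `ζ`, which are in the kernel too.
  have hTx : V.tangentMap ord o x.1 x.2 = ζ := by
    rw [← DoubleRep.tangentLin_apply, hx, map_sum]
    conv_rhs => rw [Matrix.matrix_eq_sum_single ζ]
    refine Finset.sum_congr rfl fun k _ => ?_
    rw [map_sum]
    refine Finset.sum_congr rfl fun l _ => ?_
    rw [map_smul, show Matrix.single k l (ζ k l) = ζ k l • Matrix.single k l (1 : S) by simp,
      ← sub_eq_zero, ← smul_sub]
    have h1 : F (V.tangentLin ord o (d' k l, z' k l) - Matrix.single k l (1 : S)) = 0 := by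
      rw [map_sub, DoubleRep.tangentLin_apply, DoubleRep.mapMatrix_tangentMap ord o hVX hVF,
        sub_eq_zero]
      have e1 : (fun a => F (d' k l a)) = d k l := funext fun a => hd' k l a
      change ρ.doubleRep.tangentMap ord o (fun a => F (d' k l a)) (F (z' k l)) = _
      rw [e1, hz', hdz]
      ext i j
      rw [hF, RingHom.mapMatrix_apply, Matrix.map_apply, Matrix.single_apply, Matrix.single_apply]
      split_ifs <;> simp
    ext i j
    rw [Matrix.smul_apply, smul_eq_mul, Matrix.zero_apply]
    exact hf _ _ (hF0 ζ hFζ k l) (hF0 _ h1 i j)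
  have hFx : ∀ a, F (x.1 a) = 0 := by
    intro a
    have : x.1 a = ∑ k, ∑ l, ζ k l • d' k l a := by
      rw [hx]
      simp only [Prod.fst_sum, Finset.sum_apply, Prod.smul_fst, Pi.smul_apply]
    rw [this]
    ext i j
    simp only [hF, RingHom.mapMatrix_apply, Matrix.map_apply, Matrix.sum_apply, Matrix.smul_apply,
      smul_eq_mul, Matrix.zero_apply]
    change f _ = 0
    rw [map_sum]
    refine Finset.sum_eq_zero fun k _ => ?_
    rw [map_sum]
    refine Finset.sum_eq_zero fun l _ => ?_
    rw [map_mul, hF0 ζ hFζ k l, zero_mul]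
  obtain ⟨V', hE', hX', hF'⟩ := V.exists_deform F hFsq (DoubleRep.arrowPart x.1)
    (fun a => by rw [DoubleRep.arrowPart, map_mul, map_mul, hFx, mul_zero, zero_mul])
    (fun a => by rw [hVE, DoubleRep.arrowPart, ← mul_assoc, ← mul_assoc, blockIdem_mul_self])
    (fun a => by rw [hVE, DoubleRep.arrowPart, mul_assoc, blockIdem_mul_self])
  obtain ⟨-, hprod⟩ := prod_eq_one_add_dlog_mul F hFsq V.F V'.F
    (V.logTangent (DoubleRep.arrowPart x.1)) (fun a => by
      rcases a with t | t <;>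
      simp [DoubleRep.logTangent, DoubleRep.arrowPart, hFx]) hF' ord
  set θ := dlog V.F (V.logTangent (DoubleRep.arrowPart x.1)) ord with hθ
  have hθE : ∀ i, Commute (blockIdem α S i) θ := by
    intro i
    rw [← hVE]
    exact commute_dlog (V.commute_F i) (V.commute_logTangent
      (fun a => by rw [hVE, DoubleRep.arrowPart, ← mul_assoc, ← mul_assoc, blockIdem_mul_self])
      (fun a => by rw [hVE, DoubleRep.arrowPart, mul_assoc, blockIdem_mul_self]) i) ord
  have hΦE : ∀ i, Commute (blockIdem α S i) Φ.val := by
    intro i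
    rw [← hVE]
    exact commute_prod (V.commute_F i) ord
  have hQE : ∀ i, blockIdem α S i * Q = (q i : ℂ) • blockIdem α S i := by
    intro i
    rw [hQ, Finset.mul_sum, Finset.sum_eq_single i]
    · rw [mul_smul_comm, blockIdem_mul_self]
    · intro j _ hj
      rw [mul_smul_comm, blockIdem_mul_of_ne S hj.symm, smul_zero]
    · simp
  have hζE : ∀ i, Commute (blockIdem α S i) ζ := by
    intro i
    refine (Commute.mul_right ?_ (hΦE i).units_inv_right).sub_right (Commute.one_right _)
    rw [commute_iff_eq, hQE, hQ, Finset.sum_mul, Finset.sum_eq_single i]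
    · rw [smul_mul_assoc, blockIdem_mul_self]
    · intro j _ hj
      rw [smul_mul_assoc, blockIdem_mul_of_ne S hj, smul_zero]
    · simp
  -- Projecting with `offPart` kills the auxiliary `z` part, so the correction is exact away from
  -- `o`.
  have hoff : offPart o θ = offPart o ζ := by
    have h1 := congrArg (offPart o) hTx
    rw [DoubleRep.tangentMap, sub_eq_add_neg, ← neg_one_smul S (offPart o x.2), offPart_add,
      offPart_add, offPart_smul, offPart_offPart, offPart_offPart, neg_one_smul, add_neg_cancel,
      add_zero] at h1
    exact h1
  have hEθ : ∀ i, i ≠ o → blockIdem α S i * θ = blockIdem α S i * ζ := by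
    intro i hi
    ext k l
    rw [blockIdem_mul, blockIdem_mul]
    split_ifs with hk
    · by_cases hkl : k.1 = l.1
      · have := congrFun (congrFun hoff k) l
        rwa [offPart_apply, offPart_apply, if_pos ⟨hkl, hk ▸ hi⟩, if_pos ⟨hkl, hk ▸ hi⟩] at this
      · rw [apply_eq_zero_of_commute hθE hkl, apply_eq_zero_of_commute hζE hkl]
    · rfl
  -- Away from `o` the relation has been corrected to first order. At `o` the block is a scalar,
  -- determined by the determinant, which is `1` since opposite factors cancel.
  have hmoment : ((ord.map V'.F).prod : (BlockMat α S)ˣ).val = Q := by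
    refine eq_sum_smul_blockIdem ho hq (fun i => ?_) (fun i hi => ?_) ?_
    · rw [← hVE, ← hE']
      exact commute_prod (V'.commute_F i) ord
    · rw [hprod, ← mul_assoc, mul_add, hEθ i hi, ← mul_add, hζ, add_sub_cancel, ← mul_assoc,
        Units.inv_mul_cancel_right, hQE]
    · have h1 : ((ord.map V'.F).prod : (BlockMat α S)ˣ).val.det =
          (ord.map fun a => (V'.F a).val.det).prod := by
        rw [← Units.coeHom_apply, map_list_prod, ← Matrix.coe_detMonoidHom, map_list_prod,
          List.map_map, List.map_map]
        rfl
      rw [h1]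
      refine DoubledArrow.prod_map_eq_one hnd hall _ fun t => ?_
      have h2 : (V'.F (.fwd t)).val.det = ((V'.F (.rev t))⁻¹ : (BlockMat α S)ˣ).val.det := by
        rw [V'.fwd, V'.rev, Matrix.det_one_add_mul_comm]
      rw [h2, ← Matrix.det_mul, Units.inv_mul, Matrix.det_one]
  obtain ⟨g, hgE, hgX⟩ := MPA.exists_algHom ord q V'.E V'.X V'.F V'.idem V'.orth
    (by rw [hE', hVE]; exact sum_blockIdem S) V'.tail V'.head V'.fwd V'.rev
    (by rw [hmoment, hE', hVE])
  refine ⟨⟨g, fun i => by rw [hgE, hE', hVE]⟩, ?_⟩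
  ext1
  refine MPA.algHom_ext ord q (fun i => ?_) fun a => ?_
  · rw [ρ.map_idem, RepPoint.map_idem]
  · change F (g (MPA.arrow ord q a)) = ρ.toAlgHom (MPA.arrow ord q a)
    rw [hgX, hX', map_add, hVX, DoubleRep.arrowPart, map_mul, map_mul, hFx, mul_zero, zero_mul,
      add_zero]
    rfl

/-- If all points are irreducible, the representation space is formally smooth. -/
theorem RepRing.formallySmooth [∀ i j : J, Finite (i ⟶ j)] (hnd : ord.Nodup)
    (hall : ∀ a, a ∈ ord) {o : J} (ho : α o = 1) (hq : ∏ i, q i ^ α i = 1)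
    (hirr : ∀ ρ : RepPoint (MPA.vertex ord q) α ℂ, ρ.IsIrred) :
    Algebra.FormallySmooth ℂ (RepRing (MPA.vertex ord q) α) := by
  refine Algebra.FormallySmooth.of_comp_surjective fun B _ _ I hI g => ?_
  obtain ⟨ρ', hρ'⟩ := RepPoint.exists_lift (Ideal.Quotient.mkₐ ℂ I) (Ideal.Quotient.mkₐ_surjective ℂ I)
    (fun x y hx hy => by
      rw [Ideal.Quotient.mkₐ_eq_mk, Ideal.Quotient.eq_zero_iff_mem] at hx hy
      have := Ideal.mul_mem_mul hx hy
      rwa [← pow_two, hI] at this)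
    hnd hall ho hq ((univPoint (MPA.vertex ord q) α).map g)
    fun k l => surjective_tangentLin hnd hall ho hirr _ k l
  refine ⟨evalPoint _ _ ρ', ?_⟩
  rw [← evalPoint_map, hρ', evalPoint_univPoint_map]

end Smooth

/-! ### Polynomial identities in the entries of the group element -/

/-- A polynomial over a `ℂ`-algebra which vanishes at all points of `s ^ σ`, where `s` is an infinite
subset of `ℂ`, is zero. -/
theorem eq_zero_of_eval_algebraMap_eq_zero {σ R : Type*} [Finite σ] [CommRing R] [Algebra ℂ R]
    (s : Set ℂ) (hs : s.Infinite) (p : MvPolynomial σ R)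
    (h : ∀ x : σ → ℂ, (∀ i, x i ∈ s) → MvPolynomial.eval (fun i => algebraMap ℂ R (x i)) p = 0) :
    p = 0 := by
  classical
  have := Fintype.ofFinite σ
  ext m
  rw [MvPolynomial.coeff_zero, ← Module.forall_dual_apply_eq_zero_iff ℂ]
  intro l
  -- Applying a linear functional to the coefficients reduces to complex polynomials; functionals
  -- separate points of `R`.
  let pl : MvPolynomial σ ℂ := ∑ m ∈ p.support, MvPolynomial.monomial m (l (p.coeff m))
  have hpl : pl = 0 := by
    refine MvPolynomial.funext_set (fun _ => s) (fun _ => hs) fun x hx => ?_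
    have h1 : MvPolynomial.eval x pl =
        l (MvPolynomial.eval (fun i => algebraMap ℂ R (x i)) p) := by
      rw [MvPolynomial.eval_eq (algebraMap ℂ R <| x ·), map_sum, map_sum]
      refine Finset.sum_congr rfl fun m _ => ?_
      rw [MvPolynomial.eval_monomial, Finsupp.prod_fintype _ _ (by simp)]
      simp only [← map_pow, ← map_prod]
      rw [mul_comm (p.coeff m), ← Algebra.smul_def, map_smul, smul_eq_mul, mul_comm]
      congr 1
      exact (Finset.prod_subset (Finset.subset_univ _) fun i _ hi => by
        rw [Finsupp.notMem_support_iff.mp hi, pow_zero]).symm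
    rw [h1, h x (by simpa using hx), map_zero, map_zero]
  by_cases hm : m ∈ p.support
  · have : MvPolynomial.coeff m pl = l (p.coeff m) := by
      simp only [pl, MvPolynomial.coeff_sum, MvPolynomial.coeff_monomial]
      rw [Finset.sum_ite_eq' p.support m, if_pos hm]
    rw [← this, hpl, MvPolynomial.coeff_zero]
  · rw [MvPolynomial.notMem_support_iff.mp hm, map_zero]

theorem adjugate_unit {n S : Type*} [Fintype n] [DecidableEq n] [CommRing S] (g : (Matrix n n S)ˣ) :
    g.val.adjugate = g.val.det • (g⁻¹ : (Matrix n n S)ˣ).val := by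
  rw [← one_mul g.val.adjugate, ← Units.inv_mul g, mul_assoc, Matrix.mul_adjugate, mul_smul_comm,
    mul_one]

/-- The diagonal block of the full inverse is a right inverse of the corresponding block. -/
theorem isUnit_det_of_blockDiagonal' {J S : Type*} [Fintype J] [DecidableEq J] [CommRing S]
    {n : J → Type*} [∀ i, Fintype (n i)] [∀ i, DecidableEq (n i)]
    (B : ∀ i, Matrix (n i) (n i) S) (h : IsUnit (Matrix.blockDiagonal' B).det) (i : J) :
    IsUnit (B i).det := by
  set Y := (Matrix.blockDiagonal' B)⁻¹ with hY
  have h1 : Matrix.blockDiagonal' B * Y = 1 := Matrix.mul_nonsing_inv _ h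
  have h2 : B i * Matrix.of (fun b c => Y ⟨i, b⟩ ⟨i, c⟩) = 1 := by
    ext a c
    have h3 := congrFun (congrFun h1 ⟨i, a⟩) ⟨i, c⟩
    rw [Matrix.mul_apply, Fintype.sum_sigma, Finset.sum_eq_single i] at h3
    · simp only [Matrix.blockDiagonal'_apply_eq] at h3
      rw [Matrix.mul_apply]
      refine h3.trans ?_
      rw [Matrix.one_apply, Matrix.one_apply]
      simp
    · intro j _ hj
      exact Finset.sum_eq_zero fun b _ => by
        rw [Matrix.blockDiagonal'_apply_ne _ _ _ hj.symm, zero_mul]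
    · simp
  exact Matrix.isUnit_det_of_right_inverse h2

section Entries

variable {J : Type u} {α : J → ℕ} {R S : Type*} [CommRing R] [CommRing S]

/-- Base change of tuples of invertible matrices. -/
def GLdim.map {S T : Type*} [CommRing S] [CommRing T] (f : S →+* T) : GLdim α S →* GLdim α T where
  toFun g i := Matrix.GeneralLinearGroup.map f (g i)
  map_one' := by funext i; simp
  map_mul' g h := by funext i; simp

/-- The indices of the entries of the blocks. -/
abbrev BlockEntry (α : J → ℕ) : Type _ := Σ i, Fin (α i) × Fin (α i)

/-- Evaluation of a polynomial in the entries of the blocks at a tuple of invertible matrices. -/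
def evalBlock (f : R →+* S) (g : GLdim α S) : MvPolynomial (BlockEntry α) R →+* S :=
  MvPolynomial.eval₂Hom f fun t => (g t.1).val t.2.1 t.2.2

theorem evalBlock_C (f : R →+* S) (g : GLdim α S) (r : R) :
    evalBlock f g (MvPolynomial.C r) = f r := by
  rw [evalBlock, MvPolynomial.coe_eval₂Hom, MvPolynomial.eval₂_C]

theorem evalBlock_id_map [Algebra ℂ R] (g : GLdim α ℂ) (p : MvPolynomial (BlockEntry α) R) :
    evalBlock (RingHom.id R) (GLdim.map (algebraMap ℂ R) g) p =
      MvPolynomial.eval (fun t => algebraMap ℂ R ((g t.1).val t.2.1 t.2.2)) p := rfl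

theorem evalBlock_eq_sum [Algebra ℂ R] (g : GLdim α ℂ)
    (p : MvPolynomial (BlockEntry α) R) :
    evalBlock (RingHom.id R) (GLdim.map (algebraMap ℂ R) g) p =
      ∑ m ∈ p.support, (∏ t ∈ m.support, (g t.1).val t.2.1 t.2.2 ^ m t) • p.coeff m := by
  refine (MvPolynomial.eval_eq (fun t : BlockEntry α =>
    algebraMap ℂ R ((g t.1).val t.2.1 t.2.2)) p).trans ?_
  refine Finset.sum_congr rfl fun m _ => ?_
  simp only [← map_pow, ← map_prod]
  rw [Algebra.smul_def, mul_comm]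

end Entries

section Conj

variable {J : Type u} {A : Type w} [Ring A] [Algebra ℂ A] [DecidableEq J] [Fintype J]
  {e : J → A} {α : J → ℕ}

theorem toBlock_map {S T : Type*} [CommRing S] [CommRing T] (f : S →+* T) (g : GLdim α S) :
    toBlock α T (GLdim.map f g) =
      Units.map (f.mapMatrix : BlockMat α S →+* BlockMat α T).toMonoidHom (toBlock α S g) := by
  ext k l
  change (toBlock α T (GLdim.map f g)).val k l = f ((toBlock α S g).val k l)
  obtain ⟨k, a⟩ := k
  obtain ⟨l, b⟩ := l
  rw [toBlock_val, toBlock_val]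
  rcases eq_or_ne k l with rfl | h
  · rw [Matrix.blockDiagonal'_apply_eq, Matrix.blockDiagonal'_apply_eq]; rfl
  · rw [Matrix.blockDiagonal'_apply_ne _ _ _ h, Matrix.blockDiagonal'_apply_ne _ _ _ h, map_zero]

theorem RepPoint.map_smul {S T : Type*} [CommRing S] [Algebra ℂ S] [CommRing T] [Algebra ℂ T]
    (f : S →ₐ[ℂ] T) (g : GLdim α S) (ρ : RepPoint e α S) :
    (g • ρ).map f = GLdim.map (f : S →+* T) g • ρ.map f := by
  ext1
  refine AlgHom.ext fun x => ?_
  rw [smul_toAlgHom_apply, toBlock_map, ← map_inv]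
  change (f : S →+* T).mapMatrix ((toBlock α S g).val * (ρ.toAlgHom x *
    ((toBlock α S g)⁻¹ : (BlockMat α S)ˣ).val)) = (f : S →+* T).mapMatrix _ *
    ((f : S →+* T).mapMatrix (ρ.toAlgHom x) * (f : S →+* T).mapMatrix _)
  rw [map_mul, map_mul]

theorem conjRepRing_eq (g : GLdim α ℂ) :
    conjRepRing e α g =
      evalPoint e α (GLdim.map (algebraMap ℂ (RepRing e α)) g • univPoint e α) := rfl

theorem evalPoint_conjRepRing {S : Type*} [CommRing S] [Algebra ℂ S] (ρ : RepPoint e α S)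
    (g : GLdim α ℂ) (r : RepRing e α) :
    evalPoint e α ρ (conjRepRing e α g r) =
      evalPoint e α (GLdim.map (algebraMap ℂ S) g • ρ) r := by
  rw [conjRepRing_eq, ← AlgHom.comp_apply, ← evalPoint_map, RepPoint.map_smul,
    univPoint_map_evalPoint]
  congr 3
  funext i
  ext a b
  exact (evalPoint e α ρ).commutes _

/-- The order is reversed because functions are pulled back along the action. -/
theorem conjRepRing_conjRepRing (g h : GLdim α ℂ) (r : RepRing e α) :
    conjRepRing e α g (conjRepRing e α h r) = conjRepRing e α (h * g) r := by
  rw [conjRepRing_eq g, evalPoint_conjRepRing, smul_smul, ← map_mul, ← conjRepRing_eq]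

theorem mem_quotientRing {r : RepRing e α} :
    r ∈ quotientRing e α ↔ ∀ g, conjRepRing e α g r = r := by
  rw [quotientRing, Algebra.mem_iInf]
  rfl

section Generic

variable {R S : Type*} [CommRing R] [CommRing S]

variable (α R) in
/-- The generic block-diagonal matrix. -/
def genericBlock : BlockMat α (MvPolynomial (BlockEntry α) R) :=
  Matrix.blockDiagonal' fun i => Matrix.of fun a b => MvPolynomial.X ⟨i, a, b⟩

variable (α) in
/-- The numerator of the generic conjugate of a matrix. -/
def genericConj (Z : BlockMat α R) : BlockMat α (MvPolynomial (BlockEntry α) R) :=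
  genericBlock α R * ((MvPolynomial.C : R →+* MvPolynomial (BlockEntry α) R).mapMatrix Z *
    (genericBlock α R).adjugate)

theorem mapMatrix_genericBlock (f : MvPolynomial (BlockEntry α) R →+* S) :
    f.mapMatrix (genericBlock α R) = Matrix.blockDiagonal' fun i =>
      Matrix.of fun a b => f (MvPolynomial.X ⟨i, a, b⟩) := by
  ext k l
  obtain ⟨k, a⟩ := k
  obtain ⟨l, b⟩ := l
  rw [RingHom.mapMatrix_apply, Matrix.map_apply, genericBlock]
  rcases eq_or_ne k l with rfl | h
  · rw [Matrix.blockDiagonal'_apply_eq, Matrix.blockDiagonal'_apply_eq]; rfl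
  · rw [Matrix.blockDiagonal'_apply_ne _ _ _ h, Matrix.blockDiagonal'_apply_ne _ _ _ h, map_zero]

theorem evalBlock_genericBlock (f : R →+* S) (g : GLdim α S) :
    (evalBlock f g).mapMatrix (genericBlock α R) = (toBlock α S g).val := by
  rw [mapMatrix_genericBlock, toBlock_val]
  congr 1
  funext i
  ext a b
  rw [Matrix.of_apply, evalBlock, MvPolynomial.coe_eval₂Hom, MvPolynomial.eval₂_X]

theorem evalBlock_det (f : R →+* S) (g : GLdim α S) :
    evalBlock f g (genericBlock α R).det = (toBlock α S g).val.det := by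
  rw [RingHom.map_det, evalBlock_genericBlock]

theorem evalBlock_genericConj (f : R →+* S) (g : GLdim α S) (Z : BlockMat α R) (k l) :
    evalBlock f g (genericConj α Z k l) = (toBlock α S g).val.det *
      ((toBlock α S g).val * (f.mapMatrix Z * ((toBlock α S g)⁻¹ : (BlockMat α S)ˣ).val)) k l := by
  have h1 : (evalBlock f g).mapMatrix (genericConj α Z) = (toBlock α S g).val.det •
      ((toBlock α S g).val * (f.mapMatrix Z * ((toBlock α S g)⁻¹ : (BlockMat α S)ˣ).val)) := by
    rw [genericConj, map_mul, map_mul, RingHom.map_adjugate, evalBlock_genericBlock, adjugate_unit,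
      mul_smul_comm, mul_smul_comm]
    congr 3
    ext i j
    exact evalBlock_C f g (Z i j)
  exact congrFun (congrFun h1 k) l

theorem eval_det_genericBlock [Algebra ℂ R] (x : BlockEntry α → ℂ) :
    MvPolynomial.eval (fun i => algebraMap ℂ R (x i)) (genericBlock α R).det =
      algebraMap ℂ R (Matrix.blockDiagonal' fun i => Matrix.of fun a b => x ⟨i, a, b⟩).det := by
  rw [RingHom.map_det, RingHom.map_det, mapMatrix_genericBlock]
  congr 1
  ext k l
  obtain ⟨k, a⟩ := k
  obtain ⟨l, b⟩ := l
  rw [RingHom.mapMatrix_apply, Matrix.map_apply]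
  rcases eq_or_ne k l with rfl | h
  · rw [Matrix.blockDiagonal'_apply_eq, Matrix.blockDiagonal'_apply_eq, Matrix.of_apply,
      MvPolynomial.eval_X, Matrix.of_apply]
  · rw [Matrix.blockDiagonal'_apply_ne _ _ _ h, Matrix.blockDiagonal'_apply_ne _ _ _ h, map_zero]

theorem toBlock_algebraMap_det (S : Type*) [CommRing S] [Algebra ℂ S] (g : GLdim α ℂ) :
    (toBlock α S (GLdim.map (algebraMap ℂ S) g)).val.det =
      algebraMap ℂ S (toBlock α ℂ g).val.det := by
  rw [toBlock_map, RingHom.map_det]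
  rfl

/-- A polynomial identity up to units extends from complex matrices to matrices over any algebra. -/
theorem evalBlock_eq_of_forall [Algebra ℂ R] (b : R) (k : ℕ) (p : MvPolynomial (BlockEntry α) R)
    (h : ∀ g : GLdim α ℂ, evalBlock (RingHom.id R) (GLdim.map (algebraMap ℂ R) g) p =
      (toBlock α R (GLdim.map (algebraMap ℂ R) g)).val.det ^ k * b) (f : R →+* S)
    (g : GLdim α S) : evalBlock f g p = (toBlock α S g).val.det ^ k * f b := by
  -- The extra determinant makes the identity hold at singular complex matrices as well, hence
  -- identically. It is a unit at every group element and is cancelled at the end.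
  have h0 : (p - MvPolynomial.C b * (genericBlock α R).det ^ k) * (genericBlock α R).det = 0 := by
    refine eq_zero_of_eval_algebraMap_eq_zero Set.univ Set.infinite_univ _ fun x _ => ?_
    rw [map_mul, eval_det_genericBlock]
    set X : BlockMat α ℂ := Matrix.blockDiagonal' fun i =>
      Matrix.of fun a b => x ⟨i, a, b⟩ with hX
    by_cases hx : X.det = 0
    · rw [hx, map_zero, mul_zero]
    · let g : GLdim α ℂ := fun i => Matrix.GeneralLinearGroup.mkOfDetNeZero
        (Matrix.of fun a b => x ⟨i, a, b⟩) (isUnit_det_of_blockDiagonal' _ (Ne.isUnit hx) i).ne_zero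
      have h1 := h g
      rw [evalBlock_id_map, toBlock_algebraMap_det] at h1
      have h2 : (toBlock α ℂ g).val = X := rfl
      have h3 : MvPolynomial.eval (fun t => algebraMap ℂ R (x t)) p =
        algebraMap ℂ R (toBlock α ℂ g).val.det ^ k * b := h1
      rw [map_sub, h3, map_mul, MvPolynomial.eval_C, map_pow, eval_det_genericBlock, h2, hX]
      ring
  have h1 := congrArg (evalBlock f g) h0
  rw [map_mul, map_sub, map_mul, map_pow, evalBlock_det, evalBlock_C, map_zero] at h1
  have hu : IsUnit (toBlock α S g).val.det := Matrix.isUnits_det_units (toBlock α S g)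
  rw [← sub_eq_zero, mul_comm _ (f b)]
  exact hu.mul_left_eq_zero.mp h1

end Generic

/-- Up to a power of the determinant, the conjugate of a function by `g` is polynomial in `g`. -/
theorem exists_conjPoly (r : RepRing e α) :
    ∃ (k : ℕ) (p : MvPolynomial (BlockEntry α) (RepRing e α)),
    ∀ (S : Type (max u w)) [CommRing S] [Algebra ℂ S] (ρ : RepPoint e α S) (g : GLdim α S),
      evalBlock (evalPoint e α ρ).toRingHom g p =
        (toBlock α S g).val.det ^ k * evalPoint e α (g • ρ) r := by
  induction r using RepRing.induction with
  | hcoord x k l =>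
    refine ⟨1, genericConj α ((univPoint e α).toAlgHom x) k l, fun S _ _ ρ g => ?_⟩
    rw [evalPoint_coord, smul_toAlgHom_apply, pow_one]
    refine (evalBlock_genericConj _ g _ k l).trans ?_
    have h1 : (evalPoint e α ρ).toRingHom.mapMatrix ((univPoint e α).toAlgHom x) = ρ.toAlgHom x := by
      ext i j
      exact evalPoint_coord e α ρ x i j
    rw [h1]
  | hscalar c =>
    refine ⟨0, MvPolynomial.C (algebraMap ℂ _ c), fun S _ _ ρ g => ?_⟩
    refine (evalBlock_C _ _ _).trans ?_
    rw [AlgHom.commutes, pow_zero, one_mul]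
    exact AlgHom.commutes _ c
  | hadd x y hx hy =>
    obtain ⟨k, p, hp⟩ := hx
    obtain ⟨l, p', hp'⟩ := hy
    refine ⟨k + l, p * (genericBlock α (RepRing e α)).det ^ l +
      p' * (genericBlock α (RepRing e α)).det ^ k, fun S _ _ ρ g => ?_⟩
    have hd := evalBlock_det (evalPoint e α ρ).toRingHom g
    rw [map_add, map_mul, map_mul, map_pow, map_pow, hp, hp', map_add, hd]
    ring
  | hmul x y hx hy =>
    obtain ⟨k, p, hp⟩ := hx
    obtain ⟨l, p', hp'⟩ := hy
    refine ⟨k + l, p * p', fun S _ _ ρ g => ?_⟩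
    rw [map_mul, hp, hp', map_mul]
    ring

theorem evalPoint_univPoint : evalPoint e α (univPoint e α) = AlgHom.id ℂ (RepRing e α) := by
  have h2 : (univPoint e α).map (AlgHom.id ℂ (RepRing e α)) = univPoint e α := by
    ext1; ext; rfl
  rw [← evalPoint_univPoint_map (AlgHom.id ℂ (RepRing e α)), h2]

/-- Up to a power of the determinant, the conjugate of a function by `g` is polynomial in `g`. -/
theorem exists_evalBlock_eq (r : RepRing e α) :
    ∃ (k : ℕ) (p : MvPolynomial (BlockEntry α) (RepRing e α)), ∀ g : GLdim α ℂ,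
      evalBlock (RingHom.id _) (GLdim.map (algebraMap ℂ (RepRing e α)) g) p =
        algebraMap ℂ _ (toBlock α ℂ g).val.det ^ k * conjRepRing e α g r := by
  obtain ⟨k, p, hp⟩ := exists_conjPoly r
  refine ⟨k, p, fun g => ?_⟩
  have := hp _ (univPoint e α) (GLdim.map (algebraMap ℂ _) g)
  rw [evalPoint_univPoint, ← conjRepRing_eq, toBlock_algebraMap_det] at this
  exact this

/-- Invariant functions are invariant under conjugation by matrices over any algebra. -/
theorem evalPoint_smul_of_mem {b : RepRing e α} (hb : b ∈ quotientRing e α) {S : Type (max u w)}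
    [CommRing S] [Algebra ℂ S] (ρ : RepPoint e α S) (g : GLdim α S) :
    evalPoint e α (g • ρ) b = evalPoint e α ρ b := by
  obtain ⟨k, p, hp⟩ := exists_conjPoly b
  have h1 := evalBlock_eq_of_forall b k p (fun g => by
    have := hp _ (univPoint e α) (GLdim.map (algebraMap ℂ _) g)
    rw [evalPoint_univPoint, ← conjRepRing_eq, mem_quotientRing.mp hb] at this
    exact this) (evalPoint e α ρ).toRingHom g
  have hu : IsUnit (toBlock α S g).val.det := Matrix.isUnits_det_units (toBlock α S g)
  exact (hu.pow k).mul_left_cancel ((hp S ρ g).symm.trans h1)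

end Conj

/-! ### Averaging over unitary matrices -/

section

open MeasureTheory

section Unitary

theorem compactSpace_unitaryGroup (n : Type*) [Fintype n] [DecidableEq n] :
    CompactSpace (Matrix.unitaryGroup n ℂ) := by
  refine (isCompact_iff_compactSpace (s := (Matrix.unitaryGroup n ℂ : Set (Matrix n n ℂ)))).mp ?_
  have hK : IsCompact (Set.pi Set.univ fun _ : n => Set.pi Set.univ fun _ : n =>
      Metric.closedBall (0 : ℂ) 1) :=
    isCompact_univ_pi fun _ => isCompact_univ_pi fun _ => isCompact_closedBall 0 1
  have hs : ({U : n → n → ℂ | ∀ i j, ‖U i j‖ ≤ 1}) = Set.pi Set.univ fun _ : n =>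
      Set.pi Set.univ fun _ : n => Metric.closedBall (0 : ℂ) 1 := by
    ext U
    simp [Set.mem_pi]
  have hK' : IsCompact {U : Matrix n n ℂ | ∀ i j, ‖U i j‖ ≤ 1} := by
    rw [← hs] at hK
    exact hK
  refine hK'.of_isClosed_subset ?_ fun U hU i j => entry_norm_bound_of_unitary hU i j
  have : (Matrix.unitaryGroup n ℂ : Set (Matrix n n ℂ)) = {U | star U * U = 1} := by
    ext U
    exact Matrix.mem_unitaryGroup_iff'
  rw [this]
  exact isClosed_eq (continuous_star.mul continuous_id) continuous_const

/-- The singular value decomposition of an invertible complex matrix. -/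
theorem exists_eq_unitary_mul_diagonal_mul {n : Type*} [Fintype n] [DecidableEq n] (g : GL n ℂ) :
    ∃ (u v : Matrix.unitaryGroup n ℂ) (z : n → ℂˣ),
      g.val = u.val * Matrix.diagonal (fun i => (z i : ℂ)) * v.val := by
  classical
  open scoped ComplexOrder in
  have hH : (g.val.conjTranspose * g.val).PosDef := by
    refine Matrix.PosDef.conjTranspose_mul_self _ ?_
    exact Matrix.mulVec_injective_of_isUnit g.isUnit
  have hh := hH.isHermitian
  set U := hh.eigenvectorUnitary with hU
  let d : n → ℂˣ := fun i => Units.mk0 ((Real.sqrt (hh.eigenvalues i) : ℝ) : ℂ) (by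
    exact_mod_cast (Real.sqrt_pos.mpr (hH.eigenvalues_pos i)).ne')
  have hd : ∀ i, (d i : ℂ) * d i = (hh.eigenvalues i : ℂ) := fun i => by
    change ((Real.sqrt (hh.eigenvalues i) : ℝ) : ℂ) * ((Real.sqrt (hh.eigenvalues i) : ℝ) : ℂ) = _
    rw [← Complex.ofReal_mul, Real.mul_self_sqrt (hH.eigenvalues_pos i).le]
  have hstar : ∀ i, star ((d i : ℂ)⁻¹) = (d i : ℂ)⁻¹ := fun i => by
    change star (((Real.sqrt (hh.eigenvalues i) : ℝ) : ℂ)⁻¹) =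
      (((Real.sqrt (hh.eigenvalues i) : ℝ) : ℂ)⁻¹)
    rw [← Complex.ofReal_inv]
    exact Complex.conj_ofReal _
  have hspec : star U.val * (g.val.conjTranspose * g.val) * U.val =
      Matrix.diagonal fun i => (hh.eigenvalues i : ℂ) := by
    have h1 := hh.spectral_theorem
    rw [Unitary.conjStarAlgAut_apply] at h1
    have h2 : star U.val * U.val = 1 := Unitary.coe_star_mul_self U
    refine (congrArg (fun X => star U.val * X * U.val) h1).trans ?_
    simp only [← hU]
    rw [mul_assoc, mul_assoc, mul_assoc, h2, mul_one, ← mul_assoc, h2, one_mul]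
    rfl
  set T := Matrix.diagonal fun i => ((d i : ℂ)⁻¹) with hT
  have hTT : T * Matrix.diagonal (fun i => (d i : ℂ)) = 1 := by
    rw [hT, Matrix.diagonal_mul_diagonal]
    simp
  have hTstar : T.conjTranspose = T := by
    rw [hT, Matrix.diagonal_conjTranspose]
    congr 1
    funext i
    exact hstar i
  -- With `U` diagonalizing `gᴴ g` and `T` the inverse of the square roots of the eigenvalues, the
  -- columns of `g U T` are orthonormal.
  have hu : g.val * U.val * T ∈ Matrix.unitaryGroup n ℂ := by
    rw [Matrix.mem_unitaryGroup_iff', Matrix.star_eq_conjTranspose, Matrix.conjTranspose_mul,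
      Matrix.conjTranspose_mul, hTstar, ← Matrix.star_eq_conjTranspose U.val]
    have : T * (star U.val * g.val.conjTranspose) * (g.val * U.val * T) =
        T * (star U.val * (g.val.conjTranspose * g.val) * U.val) * T := by
      simp only [mul_assoc]
    rw [this, hspec, hT, Matrix.diagonal_mul_diagonal, Matrix.diagonal_mul_diagonal,
      ← Matrix.diagonal_one]
    congr 1
    funext i
    rw [← hd, inv_mul_cancel_left₀ (d i).ne_zero, mul_inv_cancel₀ (d i).ne_zero]
  refine ⟨⟨_, hu⟩, star U, d, ?_⟩
  change _ = g.val * U.val * T * Matrix.diagonal (fun i => (d i : ℂ)) * star U.val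
  have h2 : U.val * star U.val = 1 := Unitary.coe_mul_star_self U
  rw [mul_assoc _ T, hTT, mul_one, mul_assoc, h2, mul_one]

/-- The circle is connected and has more than one point. Its infinitude is what makes tuples of unit
complex numbers Zariski dense. -/
theorem infinite_unit_circle : {z : ℂ | ‖z‖ = 1}.Infinite := by
  have h1 : {z : ℂ | ‖z‖ = 1} = Metric.sphere (0 : ℂ) 1 := by ext; simp
  rw [h1]
  refine (isPreconnected_sphere (by rw [Complex.rank_real_complex]; norm_num) 0 1).infinite_of_nontrivial
    ⟨1, by simp, -1, by simp, ?_⟩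
  norm_num

end Unitary

section Tuples

variable {J : Type u} {α : J → ℕ}

variable (α) in
/-- Tuples of unitary matrices. -/
abbrev UnitaryDim : Type _ := ∀ i, Matrix.unitaryGroup (Fin (α i)) ℂ

/-- Tuples of unitary matrices as tuples of invertible matrices. -/
def unitaryToGL : UnitaryDim α →* GLdim α ℂ where
  toFun u i := Unitary.toUnits (u i)
  map_one' := by funext i; simp
  map_mul' u v := by funext i; simp

theorem continuous_entry (t : BlockEntry α) :
    Continuous fun u : UnitaryDim α => (unitaryToGL u t.1).val t.2.1 t.2.2 :=
  (continuous_subtype_val.comp (continuous_apply t.1)).matrix_elem t.2.1 t.2.2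

/-- Tuples of invertible diagonal matrices. -/
def diagGL (z : (Σ i, Fin (α i)) → ℂˣ) : GLdim α ℂ := fun i =>
  Units.map (Matrix.diagonalRingHom (Fin (α i)) ℂ : (Fin (α i) → ℂ) →* Matrix (Fin (α i)) (Fin (α i)) ℂ)
    (MulEquiv.piUnits.symm fun a => z ⟨i, a⟩)

theorem diagGL_val (z : (Σ i, Fin (α i)) → ℂˣ) (i : J) :
    (diagGL z i).val = Matrix.diagonal fun a => (z ⟨i, a⟩ : ℂ) := rfl

end Tuples

section Reynolds

variable {J : Type u} {A : Type w} [Ring A] [Algebra ℂ A] [DecidableEq J] [Fintype J]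
  {e : J → A} {α : J → ℕ}

theorem continuous_toBlock_det :
    Continuous fun u : UnitaryDim α => (toBlock α ℂ (unitaryToGL u)).val.det := by
  refine Continuous.matrix_det ?_
  simp only [toBlock_val]
  refine Continuous.matrix_blockDiagonal' (continuous_pi fun i => ?_)
  exact continuous_subtype_val.comp (continuous_apply i)

/-- The conjugates of a function span a finite-dimensional space: after division by a power of the
determinant, which never vanishes, they are polynomial in the entries of `g`. This makes integration
over the unitary group a matter of scalar integrals. -/
theorem exists_conjRepRing_eq_sum (r : RepRing e α) :
    ∃ (s : Finset (BlockEntry α →₀ ℕ)) (c : (BlockEntry α →₀ ℕ) → RepRing e α)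
      (h : (BlockEntry α →₀ ℕ) → GLdim α ℂ → ℂ),
      (∀ g, conjRepRing e α g r = ∑ m ∈ s, h m g • c m) ∧
      ∀ m, Continuous fun u : UnitaryDim α => h m (unitaryToGL u) := by
  obtain ⟨k, p, hp⟩ := exists_evalBlock_eq r
  refine ⟨p.support, fun m => p.coeff m, fun m g => ((toBlock α ℂ g).val.det ^ k)⁻¹ *
    ∏ t ∈ m.support, (g t.1).val t.2.1 t.2.2 ^ m t, fun g => ?_, fun m => ?_⟩
  · have hne : (toBlock α ℂ g).val.det ^ k ≠ 0 :=
      pow_ne_zero _ (Matrix.isUnits_det_units (toBlock α ℂ g)).ne_zero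
    have h1 := hp g
    rw [← map_pow, ← Algebra.smul_def] at h1
    rw [← inv_smul_smul₀ hne (conjRepRing e α g r), ← h1]
    simp only [mul_smul, ← Finset.smul_sum]
    exact congrArg _ (evalBlock_eq_sum g p)
  · refine Continuous.mul ((continuous_toBlock_det.pow k).inv₀ fun u => ?_) ?_
    · exact pow_ne_zero _ (Matrix.isUnits_det_units (toBlock α ℂ _)).ne_zero
    · exact continuous_finsetProd _ fun t _ => (continuous_entry t).pow _

/-- A function invariant under unitary matrices is invariant under invertible diagonal matrices. -/
theorem conjRepRing_diagGL {r : RepRing e α}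
    (hr : ∀ u : UnitaryDim α, conjRepRing e α (unitaryToGL u) r = r)
    (z : (Σ i, Fin (α i)) → ℂˣ) : conjRepRing e α (diagGL z) r = r := by
  obtain ⟨k, p, hp⟩ := exists_evalBlock_eq r
  let R := RepRing e α
  -- Restriction to diagonal matrices.
  let φ : MvPolynomial (BlockEntry α) R →+* MvPolynomial (Σ i, Fin (α i)) R :=
    MvPolynomial.eval₂Hom MvPolynomial.C
      fun t => if t.2.1 = t.2.2 then MvPolynomial.X ⟨t.1, t.2.1⟩ else 0
  have hφ : ∀ (z : (Σ i, Fin (α i)) → ℂˣ) (p : MvPolynomial (BlockEntry α) R),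
      MvPolynomial.eval (fun i => algebraMap ℂ R (z i)) (φ p) =
        evalBlock (RingHom.id R) (GLdim.map (algebraMap ℂ R) (diagGL z)) p := by
    intro z p
    have : (MvPolynomial.eval (fun i => algebraMap ℂ R (z i))).comp φ =
        evalBlock (RingHom.id R) (GLdim.map (algebraMap ℂ R) (diagGL z)) := by
      refine MvPolynomial.ringHom_ext (fun c => ?_) fun t => ?_
      · rw [evalBlock_C]
        simp [φ]
      · rw [evalBlock, MvPolynomial.coe_eval₂Hom, MvPolynomial.eval₂_X]
        change MvPolynomial.eval _ (φ (MvPolynomial.X t)) =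
          algebraMap ℂ R ((diagGL z t.1).val t.2.1 t.2.2)
        rw [diagGL_val, Matrix.diagonal_apply]
        simp only [φ, MvPolynomial.coe_eval₂Hom, MvPolynomial.eval₂_X]
        split_ifs
        · rw [MvPolynomial.eval_X]
        · rw [map_zero, map_zero]
    exact RingHom.congr_fun this p
  -- The identity holds on unitary diagonal matrices, so it holds identically on diagonal ones by
  -- density of the circle.
  have hq : φ (p - (genericBlock α R).det ^ k * MvPolynomial.C r) = 0 := by
    refine eq_zero_of_eval_algebraMap_eq_zero _ infinite_unit_circle _ fun x hx => ?_
    let z : (Σ i, Fin (α i)) → ℂˣ := fun i => Units.mk0 (x i) (by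
      intro h0
      have := hx i
      simp [h0] at this)
    let u : UnitaryDim α := fun i => ⟨Matrix.diagonal fun a => x ⟨i, a⟩, by
      rw [Matrix.mem_unitaryGroup_iff, Matrix.star_eq_conjTranspose, Matrix.diagonal_conjTranspose,
        Matrix.diagonal_mul_diagonal, ← Matrix.diagonal_one]
      congr 1
      funext a
      have h1 : ‖x ⟨i, a⟩‖ = 1 := hx _
      change x ⟨i, a⟩ * (starRingEnd ℂ) (x ⟨i, a⟩) = 1
      rw [Complex.mul_conj, Complex.normSq_eq_norm_sq, h1]
      simp⟩
    have hu : unitaryToGL u = diagGL z := by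
      funext i
      ext a b
      rfl
    refine (hφ z _).trans ?_
    rw [map_sub, map_mul, map_pow, evalBlock_det, evalBlock_C, toBlock_algebraMap_det, ← hu,
      RingHom.id_apply, sub_eq_zero]
    refine (hp _).trans ?_
    rw [hr]
  have h1 := hφ z (p - (genericBlock α R).det ^ k * MvPolynomial.C r)
  rw [hq, map_zero, map_sub, map_mul, map_pow, evalBlock_det, evalBlock_C, toBlock_algebraMap_det,
    RingHom.id_apply] at h1
  have h2 := (hp (diagGL z)).symm.trans (sub_eq_zero.mp h1.symm)
  have hne : (toBlock α ℂ (diagGL z)).val.det ≠ 0 :=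
    (Matrix.isUnits_det_units (toBlock α ℂ (diagGL z))).ne_zero
  exact ((hne.isUnit.map (algebraMap ℂ R)).pow k).mul_left_cancel h2

/-- A function invariant under unitary matrices is invariant. -/
theorem mem_quotientRing_of_unitary {r : RepRing e α}
    (hr : ∀ u : UnitaryDim α, conjRepRing e α (unitaryToGL u) r = r) : r ∈ quotientRing e α := by
  rw [mem_quotientRing]
  intro g
  choose u v z h using fun i => exists_eq_unitary_mul_diagonal_mul (g i)
  have hg : g = unitaryToGL u * diagGL (fun k => z k.1 k.2) * unitaryToGL v := by
    funext i
    exact Units.ext (h i)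
  rw [hg, ← conjRepRing_conjRepRing, ← conjRepRing_conjRepRing, hr, conjRepRing_diagGL hr, hr]

theorem eq_of_forall_dual {R : Type*} [CommRing R] [Algebra ℂ R] {x y : R}
    (h : ∀ l : R →ₗ[ℂ] ℂ, l x = l y) : x = y := by
  rw [← sub_eq_zero, ← Module.forall_dual_apply_eq_zero_iff ℂ]
  intro l
  rw [map_sub, h, sub_self]

theorem exists_haar (K : Type*) [Group K] [TopologicalSpace K] [IsTopologicalGroup K]
    [CompactSpace K] [MeasurableSpace K] [BorelSpace K] :
    ∃ μ : Measure K, IsProbabilityMeasure μ ∧ μ.IsMulLeftInvariant := by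
  let K₀ : TopologicalSpace.PositiveCompacts K :=
    ⟨⟨Set.univ, isCompact_univ⟩, by rw [interior_univ]; exact Set.univ_nonempty⟩
  refine ⟨Measure.haarMeasure K₀, ⟨?_⟩, inferInstance⟩
  exact Measure.haarMeasure_self (K₀ := K₀)

/-- No topology on `R` is needed, since the integrand has finitely many vector coefficients. The
integral is characterized by its values under all linear functionals. -/
theorem exists_integral {K R ι : Type*} [TopologicalSpace K] [CompactSpace K] [MeasurableSpace K]
    [BorelSpace K] (μ : Measure K) [IsFiniteMeasure μ] [AddCommGroup R] [Module ℂ R] (s : Finset ι)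
    (c : ι → R) (h : ι → K → ℂ) (hh : ∀ m, Continuous (h m)) (F : K → R)
    (hF : ∀ u, F u = ∑ m ∈ s, h m u • c m) :
    ∃ y : R, ∀ l : R →ₗ[ℂ] ℂ, Integrable (fun u => l (F u)) μ ∧ l y = ∫ u, l (F u) ∂μ := by
  have hint : ∀ m, Integrable (h m) μ := fun m =>
    (hh m).integrable_of_hasCompactSupport (HasCompactSupport.of_compactSpace _)
  refine ⟨∑ m ∈ s, (∫ u, h m u ∂μ) • c m, fun l => ?_⟩
  have hl : (fun u => l (F u)) = fun u => ∑ m ∈ s, h m u * l (c m) := by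
    funext u
    rw [hF, map_sum]
    simp only [map_smul, smul_eq_mul]
  rw [hl]
  refine ⟨integrable_finsetSum _ fun m _ => (hint m).mul_const _, ?_⟩
  rw [integral_finsetSum _ fun m _ => (hint m).mul_const _, map_sum]
  simp only [map_smul, smul_eq_mul, integral_mul_const]

/-- Averages over a compact group are invariant. -/
theorem exists_invariant_integral {K R ι : Type*} [Group K] [TopologicalSpace K]
    [IsTopologicalGroup K] [CompactSpace K] [MeasurableSpace K] [BorelSpace K] (μ : Measure K)
    [IsFiniteMeasure μ] [μ.IsMulLeftInvariant] [CommRing R] [Algebra ℂ R] (T : K → R →ₗ[ℂ] R)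
    (hT : ∀ u v r, T u (T v r) = T (v * u) r) (r : R) (s : Finset ι)
    (c : ι → R) (h : ι → K → ℂ) (hh : ∀ m, Continuous (h m))
    (hF : ∀ u, T u r = ∑ m ∈ s, h m u • c m) :
    ∃ y : R, (∀ v, T v y = y) ∧ ∀ l : R →ₗ[ℂ] ℂ,
      Integrable (fun u => l (T u⁻¹ r)) μ ∧ l y = ∫ u, l (T u⁻¹ r) ∂μ := by
  obtain ⟨y, key⟩ := exists_integral μ s c (fun m u => h m u⁻¹)
    (fun m => (hh m).comp continuous_inv) (fun u => T u⁻¹ r) fun u => hF _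
  refine ⟨y, fun v => eq_of_forall_dual fun l => ?_, key⟩
  have h1 := (key (l ∘ₗ T v)).2
  -- As `T` reverses products, `T v` composed with `T u⁻¹` is `T (v⁻¹ u)⁻¹`, a left translate of the
  -- integrand.
  rw [(key l).2, ← integral_mul_left_eq_self (fun u => l (T u⁻¹ r)) v⁻¹]
  refine h1.trans ?_
  congr 1
  funext u
  rw [LinearMap.comp_apply, hT, mul_inv_rev, inv_inv]

/-- Averages over the unitary group are invariant. -/
theorem exists_average [MeasurableSpace (UnitaryDim α)] [BorelSpace (UnitaryDim α)]
    [CompactSpace (UnitaryDim α)] (μ : Measure (UnitaryDim α)) [IsFiniteMeasure μ]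
    [μ.IsMulLeftInvariant] (r : RepRing e α) :
    ∃ y ∈ quotientRing e α, ∀ l : RepRing e α →ₗ[ℂ] ℂ,
      Integrable (fun u => l (conjRepRing e α (unitaryToGL u⁻¹) r)) μ ∧
      l y = ∫ u, l (conjRepRing e α (unitaryToGL u⁻¹) r) ∂μ := by
  obtain ⟨s, c, h, hc, hh⟩ := exists_conjRepRing_eq_sum r
  obtain ⟨y, hy, key⟩ := exists_invariant_integral μ
    (fun u => (conjRepRing e α (unitaryToGL u)).toLinearMap)
    (fun u v r => by
      rw [AlgHom.toLinearMap_apply, AlgHom.toLinearMap_apply, AlgHom.toLinearMap_apply,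
        conjRepRing_conjRepRing, map_mul]) r s c (fun m u => h m (unitaryToGL u)) hh fun u => hc _
  exact ⟨y, mem_quotientRing_of_unitary hy, key⟩

/-- Invariant functions which generate the unit ideal of the coordinate ring of the representation
space generate the unit ideal of the ring of invariants. -/
theorem span_eq_top_of_span_eq_top (s : Set (quotientRing e α))
    (hs : Ideal.span ((fun b : quotientRing e α => (b : RepRing e α)) '' s) = ⊤) :
    Ideal.span s = ⊤ := by
  have hcpt : CompactSpace (UnitaryDim α) := by
    have : ∀ i, CompactSpace (Matrix.unitaryGroup (Fin (α i)) ℂ) := fun i =>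
      compactSpace_unitaryGroup _
    infer_instance
  let _ : MeasurableSpace (UnitaryDim α) := borel _
  have _ : BorelSpace (UnitaryDim α) := ⟨rfl⟩
  obtain ⟨μ, hμ, hμ'⟩ := exists_haar (UnitaryDim α)
  have h1 : (1 : RepRing e α) ∈ Submodule.span (RepRing e α)
      ((fun b : quotientRing e α => (b : RepRing e α)) '' s) := by
    change (1 : RepRing e α) ∈ Ideal.span _
    rw [hs]; trivial
  obtain ⟨n, f, g, hfg⟩ := Submodule.mem_span_set'.mp h1
  choose b hb hbg using fun i => (g i).2
  -- Each coefficient of the partition of unity is replaced by its average. Multiplication by the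
  -- invariant functions commutes with averaging, so the sum is still `1`.
  choose y hy hyl using fun i => exists_average (e := e) (α := α) μ (f i)
  rw [Ideal.eq_top_iff_one]
  have h2 : (1 : quotientRing e α) = ∑ i, (⟨y i, hy i⟩ : quotientRing e α) * b i := by
    apply Subtype.ext
    rw [AddSubmonoidClass.coe_finsetSum]
    refine eq_of_forall_dual fun l => ?_
    have h3 : ∀ i, l (y i * (b i : RepRing e α)) =
        ∫ u, l (conjRepRing e α (unitaryToGL u⁻¹) (f i * b i)) ∂μ ∧
        Integrable (fun u => l (conjRepRing e α (unitaryToGL u⁻¹) (f i * b i))) μ := by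
      intro i
      have := hyl i (l ∘ₗ LinearMap.mulRight ℂ (b i : RepRing e α))
      have h4 : ∀ u : UnitaryDim α, conjRepRing e α (unitaryToGL u⁻¹) (f i * b i) =
          conjRepRing e α (unitaryToGL u⁻¹) (f i) * b i := fun u => by
        rw [map_mul, mem_quotientRing.mp (b i).2]
      simp only [h4]
      exact ⟨this.2, this.1⟩
    change l 1 = l (∑ i, y i * (b i : RepRing e α))
    rw [map_sum, Finset.sum_congr rfl fun i _ => (h3 i).1, ← integral_finsetSum _ fun i _ => (h3 i).2]
    have h5 : ∀ u : UnitaryDim α, ∑ i, l (conjRepRing e α (unitaryToGL u⁻¹) (f i * b i)) = l 1 := by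
      intro u
      rw [← map_sum, ← map_sum]
      have : ∑ i, f i * (b i : RepRing e α) = 1 := by
        rw [← hfg]
        exact Finset.sum_congr rfl fun i _ => by rw [smul_eq_mul, ← hbg]
      rw [this, map_one]
    simp only [h5, integral_const, probReal_univ, one_smul]
  rw [h2]
  exact Ideal.sum_mem _ fun i _ => Ideal.mul_mem_left _ _ (Ideal.subset_span (hb i))

end Reynolds

end

/-! ### Smoothness of retracts -/

section Retract

/-- A lift is obtained by lifting the composite with `s` and restricting along `j`. As a quotient of
`T` the retract is of finite type over `ℂ`, hence finitely presented. -/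
theorem smooth_of_retract {S T : Type*} [CommRing S] [Algebra ℂ S] [CommRing T] [Algebra ℂ T]
    [Algebra.Smooth ℂ T] (j : S →ₐ[ℂ] T) (s : T →ₐ[ℂ] S) (h : ∀ x, s (j x) = x) :
    Algebra.Smooth ℂ S := by
  have h1 : Algebra.FormallySmooth ℂ S := by
    refine Algebra.FormallySmooth.of_comp_surjective fun C _ _ I hI g => ?_
    obtain ⟨t, ht⟩ := Algebra.FormallySmooth.comp_surjective ℂ T I hI (g.comp s)
    refine ⟨t.comp j, ?_⟩
    rw [← AlgHom.comp_assoc, ht]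
    ext x
    rw [AlgHom.comp_apply, AlgHom.comp_apply, h]
  have h2 : Algebra.FiniteType ℂ S := Algebra.FiniteType.of_surjective s fun x => ⟨j x, h x⟩
  exact ⟨h1, Algebra.FinitePresentation.of_finiteType.mp h2⟩

/-- Injectivity holds because a relation `f ^ m * b = 0` in `R` is already one in the subalgebra. -/
theorem exists_localization_hom {R : Type*} [CommRing R] [Algebra ℂ R] (B : Subalgebra ℂ R) (f : B) :
    ∃ j : Localization.Away f →ₐ[ℂ] Localization.Away (f : R), Function.Injective j ∧
      ∀ b : B, j (algebraMap B _ b) = algebraMap R _ (b : R) := by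
  let g : B →ₐ[ℂ] Localization.Away (f : R) :=
    (IsScalarTower.toAlgHom ℂ R (Localization.Away (f : R))).comp B.val
  have hg : ∀ y : Submonoid.powers f, IsUnit (g y) := by
    rintro ⟨_, n, rfl⟩
    rw [map_pow]
    exact (IsLocalization.Away.algebraMap_isUnit (f : R)).pow n
  let j : Localization.Away f →ₐ[ℂ] Localization.Away (f : R) :=
    IsLocalization.liftAlgHom (M := Submonoid.powers f) (f := g) hg
  have hj : ∀ b : B, j (algebraMap B _ b) = algebraMap R _ (b : R) := fun b =>
    IsLocalization.lift_eq (M := Submonoid.powers f) (g := g.toRingHom) hg b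
  refine ⟨j, ?_, hj⟩
  rw [injective_iff_map_eq_zero]
  intro z hz
  obtain ⟨n, b, hb⟩ := IsLocalization.Away.surj f z
  have h1 : algebraMap R (Localization.Away (f : R)) (b : R) = 0 := by
    rw [← hj, ← hb, map_mul, hz, zero_mul]
  obtain ⟨⟨_, m, rfl⟩, hm⟩ := (IsLocalization.map_eq_zero_iff (Submonoid.powers (f : R))
    (Localization.Away (f : R)) (b : R)).mp h1
  have h2 : f ^ m * b = 0 := Subtype.ext hm
  have hu : IsUnit (algebraMap B (Localization.Away f) f) := IsLocalization.Away.algebraMap_isUnit f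
  have h3 : algebraMap B (Localization.Away f) b = 0 := by
    have := congrArg (algebraMap B (Localization.Away f)) h2
    rw [map_mul, map_pow, map_zero] at this
    exact (hu.pow m).mul_right_eq_zero.mp this
  rw [h3] at hb
  exact ((hu.pow n).mul_left_eq_zero).mp hb

/-- A subalgebra is smooth along the locus where the inclusion has a retraction. -/
theorem smooth_localization_of_retract {R : Type*} [CommRing R] [Algebra ℂ R] [Algebra.Smooth ℂ R]
    (B : Subalgebra ℂ R) (f : B) (s : R →ₐ[ℂ] Localization.Away f)
    (hs : ∀ b : B, s b = algebraMap B _ b) : Algebra.Smooth ℂ (Localization.Away f) := by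
  obtain ⟨j, -, hj⟩ := exists_localization_hom B f
  have hu : ∀ y : Submonoid.powers (f : R), IsUnit (s y) := by
    rintro ⟨_, n, rfl⟩
    rw [map_pow, hs]
    exact (IsLocalization.Away.algebraMap_isUnit f).pow n
  let s' : Localization.Away (f : R) →ₐ[ℂ] Localization.Away f :=
    IsLocalization.liftAlgHom (M := Submonoid.powers (f : R)) (f := s) hu
  have hs' : ∀ r : R, s' (algebraMap R _ r) = s r := fun r =>
    IsLocalization.lift_eq (M := Submonoid.powers (f : R)) (g := s.toRingHom) hu r
  have hsm : Algebra.Smooth R (Localization.Away (f : R)) :=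
    Algebra.Smooth.of_isLocalization_Away (f : R)
  have : Algebra.Smooth ℂ (Localization.Away (f : R)) := Algebra.Smooth.comp ℂ R _
  refine smooth_of_retract j s' fun x => ?_
  have h1 : (s'.comp j).toRingHom = RingHom.id _ := by
    refine IsLocalization.ringHom_ext (Submonoid.powers f) (RingHom.ext fun b => ?_)
    change s' (j (algebraMap B _ b)) = algebraMap B _ b
    rw [hj, hs', hs]
  exact RingHom.congr_fun h1 x

end Retract

/-! ### Local slices of the quotient -/

section Slice

variable {J : Type u} {A : Type w} [Ring A] [Algebra ℂ A] [DecidableEq J] [Fintype J]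
  {e : J → A} {α : J → ℕ} {o : J}

theorem mul_apply_baseIndex_left {S : Type*} [CommRing S] (ho : α o = 1) {P : BlockMat α S}
    (hP : ∀ i, Commute (blockIdem α S i) P) (X : BlockMat α S) (l) :
    (P * X) (baseIndex ho) l = P (baseIndex ho) (baseIndex ho) * X (baseIndex ho) l := by
  rw [Matrix.mul_apply, Finset.sum_eq_single (baseIndex ho)]
  · intro m _ hm
    have : (baseIndex ho).1 ≠ m.1 := fun h => hm (eq_baseIndex ho h.symm)
    rw [apply_eq_zero_of_commute hP this, zero_mul]
  · simp

theorem mul_apply_baseIndex_right {S : Type*} [CommRing S] (ho : α o = 1) {P : BlockMat α S}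
    (hP : ∀ i, Commute (blockIdem α S i) P) (X : BlockMat α S) (k) :
    (X * P) k (baseIndex ho) = X k (baseIndex ho) * P (baseIndex ho) (baseIndex ho) := by
  rw [Matrix.mul_apply, Finset.sum_eq_single (baseIndex ho)]
  · intro m _ hm
    have : m.1 ≠ (baseIndex ho).1 := fun h => hm (eq_baseIndex ho h)
    rw [apply_eq_zero_of_commute hP this, mul_zero]
  · simp

/-- The block at `o` of a group element is a scalar, so conjugation multiplies this entry by the
scalar and by its inverse. -/
theorem coord_baseIndex_mem (ho : α o = 1) (x : A) :
    coord e α x (baseIndex ho) (baseIndex ho) ∈ quotientRing e α := by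
  rw [mem_quotientRing]
  intro g
  have hc : ∀ (g : GLdim α (RepRing e α)) i, Commute (blockIdem α (RepRing e α) i)
      (toBlock α _ g).val := fun g i => (toBlock_mul_blockIdem α _ g i).symm
  rw [conjRepRing_eq, evalPoint_coord, smul_toAlgHom_apply, mul_apply_baseIndex_left ho (hc _),
    ← map_inv, mul_apply_baseIndex_right ho (hc _), univPoint_apply, mul_left_comm,
    ← mul_apply_baseIndex_left ho (hc _), map_inv, Units.mul_inv, Matrix.one_apply_eq, mul_one]

/-- The matrix of the invariant functions `(y_k e a e x_l)` at the vertex `o`. -/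
def pairing (e : J → A) (ho : α o = 1) (x y : (Σ i, Fin (α i)) → A) (a : A) :
    BlockMat α (quotientRing e α) :=
  Matrix.of fun k l => ⟨_, coord_baseIndex_mem (e := e) ho (y k * e k.1 * a * (e l.1 * x l))⟩

/-- The vectors `e x_l` in terms of the basis vector at `o`. -/
def frame (e : J → A) (ho : α o = 1) (x : (Σ i, Fin (α i)) → A) : BlockMat α (RepRing e α) :=
  Matrix.of fun m l => coord e α (e l.1 * x l) m (baseIndex ho)

/-- The covectors `y_k e` in terms of the basis vector at `o`. -/
def coframe (e : J → A) (ho : α o = 1) (y : (Σ i, Fin (α i)) → A) : BlockMat α (RepRing e α) :=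
  Matrix.of fun k m => coord e α (y k * e k.1) (baseIndex ho) m

/-- Although the frame and the coframe are not invariant, this product is. Dividing by its value at
`a = 1` expresses the representation in the frame with invariant entries. -/
theorem pairing_eq (ho : α o = 1) (x y : (Σ i, Fin (α i)) → A) (a : A) :
    (quotientRing e α).val.toRingHom.mapMatrix (pairing e ho x y a) =
      coframe e ho y * (univPoint e α).toAlgHom a * frame e ho x := by
  ext k l
  change (univPoint e α).toAlgHom (y k * e k.1 * a * (e l.1 * x l)) _ _ = _
  rw [map_mul, map_mul]
  simp only [Matrix.mul_apply]
  rfl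

theorem frame_eq_blockDiagonal' (ho : α o = 1) (x : (Σ i, Fin (α i)) → A) :
    frame e ho x = Matrix.blockDiagonal' fun i => Matrix.of fun a b => frame e ho x ⟨i, a⟩ ⟨i, b⟩ := by
  ext k l
  obtain ⟨k, a⟩ := k
  obtain ⟨l, b⟩ := l
  rcases eq_or_ne k l with rfl | h
  · rw [Matrix.blockDiagonal'_apply_eq, Matrix.of_apply]
  · rw [Matrix.blockDiagonal'_apply_ne _ _ _ h]
    change (univPoint e α).toAlgHom (e l * x ⟨l, b⟩) _ _ = 0
    rw [map_mul, (univPoint e α).map_idem, blockIdem_mul, if_neg h]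

/-- A point all of whose matrix entries lie in the image of an injective map comes from a point over
the source. -/
theorem RepPoint.exists_map_eq {S T : Type*} [CommRing S] [Algebra ℂ S] [CommRing T] [Algebra ℂ T]
    (j : S →ₐ[ℂ] T) (hj : Function.Injective j) (ρ : RepPoint e α T)
    (h : ∀ a, ∃ Z : BlockMat α S, (j : S →+* T).mapMatrix Z = ρ.toAlgHom a) :
    ∃ σ : RepPoint e α S, σ.map j = ρ := by
  choose Z hZ using h
  have hinj : Function.Injective ((j : S →+* T).mapMatrix (m := Σ i, Fin (α i))) := by
    intro X Y hXY
    ext k l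
    exact hj (congrFun (congrFun hXY k) l)
  refine ⟨⟨AlgHom.ofLinearMap ⟨⟨Z, fun x y => ?_⟩, fun c x => ?_⟩ ?_ fun x y => ?_, fun i => ?_⟩, ?_⟩
  · apply hinj
    rw [map_add, hZ, hZ, hZ, map_add]
  · apply hinj
    change (j : S →+* T).mapMatrix (Z (c • x)) = j.mapMatrix (c • Z x)
    rw [hZ, _root_.map_smul, _root_.map_smul]
    exact congrArg (c • ·) (hZ x).symm
  · apply hinj
    change (j : S →+* T).mapMatrix (Z 1) = _
    rw [hZ, map_one, map_one]
  · apply hinj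
    change (j : S →+* T).mapMatrix (Z (x * y)) = (j : S →+* T).mapMatrix (Z x * Z y)
    rw [hZ, map_mul, map_mul, hZ, hZ]
  · apply hinj
    change (j : S →+* T).mapMatrix (Z (e i)) = _
    rw [hZ, ρ.map_idem, blockIdem_mapMatrix]
  · ext1
    exact AlgHom.ext hZ

/-- If the matrices of a point with respect to a frame and a coframe are defined over a subring, then
so is a conjugate of the point. -/
theorem RepPoint.exists_map_eq_smul {S T : Type*} [CommRing S] [Algebra ℂ S] [CommRing T]
    [Algebra ℂ T] (j : S →ₐ[ℂ] T) (hj : Function.Injective j) (ρ : RepPoint e α T)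
    (C D : BlockMat α T) (hC : ∀ k l, k.1 ≠ l.1 → C k l = 0) (Ψ : A → BlockMat α S)
    (hΨ : ∀ a, (j : S →+* T).mapMatrix (Ψ a) = D * ρ.toAlgHom a * C) (hu : IsUnit (Ψ 1)) :
    ∃ (g : GLdim α T) (σ : RepPoint e α S), σ.map j = g • ρ := by
  obtain ⟨Γ, hΓ⟩ := hu
  have hΓ' : (j : S →+* T).mapMatrix Γ.val = D * C := by
    rw [hΓ, hΨ, map_one, mul_one]
  have h1 : IsUnit ((j : S →+* T).mapMatrix Γ.val) := Γ.isUnit.map (j : S →+* T).mapMatrix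
  have hCdet : IsUnit C.det := by
    have hdet := (Matrix.isUnit_iff_isUnit_det _).mp h1
    rw [hΓ', Matrix.det_mul] at hdet
    exact isUnit_of_mul_isUnit_right hdet
  have hCdiag : C = Matrix.blockDiagonal' fun m => Matrix.of fun a b => C ⟨m, a⟩ ⟨m, b⟩ := by
    ext ⟨m, a⟩ ⟨l, b⟩
    rcases eq_or_ne m l with rfl | h
    · rw [Matrix.blockDiagonal'_apply_eq, Matrix.of_apply]
    · rw [Matrix.blockDiagonal'_apply_ne _ _ _ h, hC _ _ h]
  have hblock := isUnit_det_of_blockDiagonal' (fun m => Matrix.of fun a b => C ⟨m, a⟩ ⟨m, b⟩)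
    (by rw [← hCdiag]; exact hCdet)
  let g : GLdim α T := fun m => Matrix.GeneralLinearGroup.mk'' _ (hblock m)
  have hg : (toBlock α T g).val = C := hCdiag.symm
  -- In the frame `C` the representation becomes `C⁻¹ ρ(a) C = (D C)⁻¹ (D ρ(a) C)`, and both factors
  -- are defined over `S`.
  obtain ⟨σ, hσ⟩ := RepPoint.exists_map_eq j hj (g⁻¹ • ρ) fun a => by
    refine ⟨(Γ⁻¹ : (BlockMat α S)ˣ).val * Ψ a, ?_⟩
    rw [map_mul, hΨ, smul_toAlgHom_apply, map_inv, inv_inv, hg]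
    apply h1.mul_left_cancel
    rw [← mul_assoc, ← map_mul, Units.mul_inv, map_one, one_mul, hΓ', ← hg, mul_assoc D,
      mul_assoc D, Units.mul_inv_cancel_left]
  exact ⟨_, σ, hσ⟩

/-- Over the locus where the pairing is nondegenerate, the frame gives a retraction from the
coordinate ring of the representation space to the ring of invariants. -/
theorem exists_retraction (ho : α o = 1) (x y : (Σ i, Fin (α i)) → A) :
    ∃ s : RepRing e α →ₐ[ℂ] Localization.Away (pairing e ho x y 1).det,
      ∀ b : quotientRing e α, s b = algebraMap _ _ b := by
  obtain ⟨j, hj, hjb⟩ := exists_localization_hom (quotientRing e α) (pairing e ho x y 1).det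
  have key : ∃ (g : GLdim α (Localization.Away ((pairing e ho x y 1).det : RepRing e α)))
      (σ : RepPoint e α (Localization.Away (pairing e ho x y 1).det)), σ.map j = g • (univPoint e α).map
      (IsScalarTower.toAlgHom ℂ (RepRing e α)
        (Localization.Away ((pairing e ho x y 1).det : RepRing e α))) := by
    refine RepPoint.exists_map_eq_smul j hj _
      ((algebraMap (RepRing e α) _).mapMatrix (frame e ho x))
      ((algebraMap (RepRing e α) _).mapMatrix (coframe e ho y)) (fun k l h => ?_)
      (fun a => (algebraMap (quotientRing e α) _).mapMatrix (pairing e ho x y a)) (fun a => ?_) ?_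
    · rw [RingHom.mapMatrix_apply, Matrix.map_apply, frame_eq_blockDiagonal',
        Matrix.blockDiagonal'_apply_ne _ _ _ h, map_zero]
    · have h1 := congrArg (algebraMap (RepRing e α)
        (Localization.Away ((pairing e ho x y 1).det : RepRing e α))).mapMatrix
          (pairing_eq ho x y a)
      rw [map_mul, map_mul] at h1
      refine Eq.trans ?_ h1
      ext m l
      exact hjb _
    · rw [Matrix.isUnit_iff_isUnit_det]
      have h1 := RingHom.map_det (algebraMap (quotientRing e α)
        (Localization.Away (pairing e ho x y 1).det)) (pairing e ho x y 1)
      rw [← h1]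
      exact IsLocalization.Away.algebraMap_isUnit _
  obtain ⟨g, σ, hσ⟩ := key
  -- The point `σ` is conjugate to the universal one over the larger ring, and invariants do not see
  -- the conjugation.
  refine ⟨evalPoint e α σ, fun b => hj ?_⟩
  have h1 : evalPoint e α (σ.map j) (b : RepRing e α) = j (evalPoint e α σ b) :=
    DFunLike.congr_fun (evalPoint_map j σ) _
  rw [← h1, hσ, evalPoint_smul_of_mem b.2, evalPoint_univPoint_map, hjb]
  rfl

/-- At an irreducible point, some frame and coframe are dual bases. -/
theorem RepPoint.IsIrred.exists_pairing_ne_zero (ho : α o = 1) (χ : RepRing e α →ₐ[ℂ] ℂ)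
    (h : ((univPoint e α).map χ).IsIrred) :
    ∃ x y : (Σ i, Fin (α i)) → A, χ ((pairing e ho x y 1).det : quotientRing e α) ≠ 0 := by
  set ρ := (univPoint e α).map χ with hρ
  let K := Σ i, Fin (α i)
  let o' : K := baseIndex ho
  -- The vectors generated by the basis vector at `o`; by irreducibility they are all vectors.
  let W : Submodule ℂ (K → ℂ) :=
    { carrier := {v | ∃ a, v = fun k => ρ.toAlgHom a k o'}
      add_mem' := by
        rintro _ _ ⟨a, rfl⟩ ⟨b, rfl⟩
        exact ⟨a + b, by rw [map_add]; rfl⟩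
      zero_mem' := ⟨0, by rw [map_zero]; rfl⟩
      smul_mem' := by
        rintro c _ ⟨a, rfl⟩
        exact ⟨c • a, by rw [_root_.map_smul]; rfl⟩ }
  have hone : ρ.toAlgHom 1 o' o' = 1 := by rw [map_one, Matrix.one_apply_eq]
  have hW : W = ⊤ := by
    refine (h W ?_).resolve_left fun hbot => ?_
    · rintro b _ ⟨a, rfl⟩
      refine ⟨b * a, ?_⟩
      funext k
      rw [map_mul, Matrix.mul_apply]
      rfl
    · have hmem : (fun k => ρ.toAlgHom 1 k o') ∈ W := ⟨1, rfl⟩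
      rw [hbot, Submodule.mem_bot] at hmem
      have := congrFun hmem o'
      rw [hone] at this
      exact one_ne_zero this
  -- The common kernel of the covectors generated at `o`. It is a subrepresentation that omits the
  -- basis vector at `o`, hence zero.
  let U : Submodule ℂ (K → ℂ) :=
    { carrier := {v | ∀ a, ∑ k, ρ.toAlgHom a o' k * v k = 0}
      add_mem' := by
        intro v v' hv hv' a
        simp only [Pi.add_apply, mul_add, Finset.sum_add_distrib, hv a, hv' a, add_zero]
      zero_mem' := by intro a; simp
      smul_mem' := by
        intro c v hv a
        simp only [Pi.smul_apply, smul_eq_mul, mul_left_comm _ c, ← Finset.mul_sum, hv a, mul_zero] }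
  have hU : U = ⊥ := by
    refine (h U ?_).resolve_right fun htop => ?_
    · intro b v hv a
      have := hv (a * b)
      rw [map_mul] at this
      rw [← this]
      have h1 : ∀ M N : BlockMat α ℂ, ∑ k, M o' k * N.mulVec v k = ∑ k, (M * N) o' k * v k := by
        intro M N
        exact congrFun (Matrix.mulVec_mulVec v M N) o'
      exact h1 _ _
    · have hmem : (Pi.single o' 1 : K → ℂ) ∈ U := by rw [htop]; trivial
      have := hmem 1
      rw [map_one, Finset.sum_eq_single o'] at this
      · simp at this
      · intro k _ hk; simp [hk]
      · simp
  let W' : Submodule ℂ (K → ℂ) :=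
    { carrier := {v | ∃ a, v = fun k => ρ.toAlgHom a o' k}
      add_mem' := by
        rintro _ _ ⟨a, rfl⟩ ⟨b, rfl⟩
        exact ⟨a + b, by rw [map_add]; rfl⟩
      zero_mem' := ⟨0, by rw [map_zero]; rfl⟩
      smul_mem' := by
        rintro c _ ⟨a, rfl⟩
        exact ⟨c • a, by rw [_root_.map_smul]; rfl⟩ }
  -- If these covectors did not span, a nonzero functional vanishing on them would give a nonzero
  -- vector of `U`.
  have hW' : W' = ⊤ := by
    by_contra hne
    obtain ⟨l, hl0, hl⟩ := W'.exists_le_ker_of_lt_top (lt_top_iff_ne_top.mpr hne)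
    have hlin : ∀ v : K → ℂ, l v = ∑ k, v k * l (Pi.single k 1) := by
      intro v
      conv_lhs => rw [← Finset.univ_sum_single v, map_sum]
      refine Finset.sum_congr rfl fun k _ => ?_
      rw [← smul_eq_mul, ← _root_.map_smul, ← Pi.single_smul', smul_eq_mul, mul_one]
    have hmem : (fun k => l (Pi.single k 1)) ∈ U := fun a => by
      rw [← hlin fun k => ρ.toAlgHom a o' k]
      exact hl ⟨a, rfl⟩
    rw [hU, Submodule.mem_bot] at hmem
    apply hl0
    ext v
    rw [LinearMap.comp_apply, LinearMap.single_apply]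
    exact congrFun hmem _
  have hx : ∀ l : K, ∃ a, (Pi.single l 1 : K → ℂ) = fun k => ρ.toAlgHom a k o' := fun l => by
    have : (Pi.single l 1 : K → ℂ) ∈ W := by rw [hW]; trivial
    exact this
  have hy : ∀ l : K, ∃ a, (Pi.single l 1 : K → ℂ) = fun k => ρ.toAlgHom a o' k := fun l => by
    have : (Pi.single l 1 : K → ℂ) ∈ W' := by rw [hW']; trivial
    exact this
  choose x hx using hx
  choose y hy using hy
  refine ⟨x, y, ?_⟩
  have hframe : (χ : RepRing e α →+* ℂ).mapMatrix (frame e ho x) = 1 := by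
    ext k l
    change ρ.toAlgHom (e l.1 * x l) k o' = _
    rw [map_mul, ρ.map_idem, blockIdem_mul, ← congrFun (hx l) k, Matrix.one_apply, Pi.single_apply]
    by_cases hkl : k = l
    · subst hkl; simp
    · simp [hkl]
  have hcoframe : (χ : RepRing e α →+* ℂ).mapMatrix (coframe e ho y) = 1 := by
    ext k l
    change ρ.toAlgHom (y k * e k.1) o' l = _
    rw [map_mul, ρ.map_idem, mul_blockIdem, ← congrFun (hy k) l, Matrix.one_apply, Pi.single_apply]
    by_cases hkl : l = k
    · subst hkl; simp
    · simp [hkl, Ne.symm hkl]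
  have h1 : (((pairing e ho x y 1).det : quotientRing e α) : RepRing e α) =
      (coframe e ho y * (univPoint e α).toAlgHom 1 * frame e ho x).det := by
    rw [← pairing_eq]
    exact RingHom.map_det (quotientRing e α).val.toRingHom _
  have h2 : χ ((pairing e ho x y 1).det : quotientRing e α) = 1 := by
    rw [h1]
    refine (RingHom.map_det (χ : RepRing e α →+* ℂ) _).trans ?_
    rw [map_one, mul_one, map_mul, hframe, hcoframe, mul_one, Matrix.det_one]
  rw [h2]
  exact one_ne_zero

theorem smooth_of_localization_span {S : Type w} [CommRing S] [Algebra ℂ S] (s : Set S)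
    (hs : Ideal.span s = ⊤) (h : ∀ f : s, Algebra.Smooth ℂ (Localization.Away (f : S))) :
    Algebra.Smooth ℂ S := by
  -- Replaces `ℂ` by an isomorphic copy in the universe of `S`; smoothness is then checked on the
  -- localizations.
  let u : ULift.{w} ℂ ≃+* ℂ := ULift.ringEquiv
  have h1 : ((algebraMap ℂ S).comp u.toRingHom).Smooth := by
    refine RingHom.Smooth.ofLocalizationSpanTarget _ s hs fun f => ?_
    rw [← RingHom.comp_assoc, ← IsScalarTower.algebraMap_eq ℂ S]
    exact (RingHom.Smooth.of_bijective u.bijective).comp (RingHom.smooth_algebraMap.mpr (h f))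
  have h2 : algebraMap ℂ S = ((algebraMap ℂ S).comp u.toRingHom).comp u.symm.toRingHom := by
    ext c
    simp
  rw [← RingHom.smooth_algebraMap, h2]
  exact (RingHom.Smooth.of_bijective u.symm.bijective).comp h1

/-- If all points are irreducible and the representation space is formally smooth, the affine
quotient is smooth. -/
theorem smooth_quotientRing [Algebra.FiniteType ℂ A] [Algebra.FormallySmooth ℂ (RepRing e α)]
    (ho : α o = 1) (hirr : ∀ ρ : RepPoint e α ℂ, ρ.IsIrred) :
    Algebra.Smooth ℂ (quotientRing e α) := by
  have hR : Algebra.Smooth ℂ (RepRing e α) :=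
    ⟨inferInstance, Algebra.FinitePresentation.of_finiteType.mp inferInstance⟩
  let s : Set (quotientRing e α) := Set.range fun xy : ((Σ i, Fin (α i)) → A) × _ =>
    (pairing e ho xy.1 xy.2 1).det
  have hs : Ideal.span s = ⊤ := by
    -- It suffices to generate the unit ideal on the representation scheme, where at each complex
    -- point irreducibility makes some pairing nondegenerate.
    refine span_eq_top_of_span_eq_top s ?_
    by_contra hne
    obtain ⟨m, hm, hle⟩ := Ideal.exists_le_maximal _ hne
    obtain ⟨χ, hχ⟩ := exists_algHom_of_isMaximal m
    obtain ⟨x, y, hxy⟩ := (hirr ((univPoint e α).map χ)).exists_pairing_ne_zero ho χ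
    apply hxy
    have : (((pairing e ho x y 1).det : quotientRing e α) : RepRing e α) ∈ m :=
      hle (Ideal.subset_span ⟨_, ⟨(x, y), rfl⟩, rfl⟩)
    rwa [← hχ] at this
  refine smooth_of_localization_span s hs ?_
  rintro ⟨_, ⟨x, y⟩, rfl⟩
  obtain ⟨t, ht⟩ := exists_retraction (e := e) ho x y
  exact smooth_localization_of_retract (quotientRing e α) _ t ht

end Slice

/-! ### Parameters and finiteness of the framed quiver -/

section Main

variable {I : Type u} {W : I → Type v}

/-- The parameter at `∞` is chosen for this identity, which is the determinant of the moment
relation in dimension `(1, α)`. It makes the relation at `∞` follow from the others. -/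
theorem prod_framedParam [Fintype I] (α : I → ℕ) (q : I → ℂˣ) :
    ∏ j, framedParam W α q j ^ framedDim W α j = 1 := by
  rw [← (framedEquiv (I := I) (W := W)).symm.prod_comp, Fintype.prod_option]
  change (∏ i, q i ^ (-(α i : ℤ))) ^ 1 * ∏ i, q i ^ α i = 1
  rw [pow_one, ← Finset.prod_mul_distrib]
  exact Finset.prod_eq_one fun i _ => by rw [zpow_neg, zpow_natCast, inv_mul_cancel]

instance Framed.finite_hom [Quiver.{v} I] [∀ i j : I, Finite (i ⟶ j)] [∀ i, Finite (W i)] :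
    ∀ i j : Framed I W, Finite (i ⟶ j)
  | .vertex i, .vertex j => inferInstanceAs (Finite (i ⟶ j))
  | .vertex i, .infty => inferInstanceAs (Finite (W i))
  | .infty, .vertex _ => inferInstanceAs (Finite PEmpty)
  | .infty, .infty => inferInstanceAs (Finite PEmpty)

end Main

end MultQuiver

end

theorem proposition2p6
    {I : Type u} [Fintype I] [DecidableEq I] [Quiver.{v} I] [∀ i j : I, Finite (i ⟶ j)]
    (W : I → Type v) [∀ i, Finite (W i)]
    (ord : List (MultQuiver.DoubledArrow (MultQuiver.Framed I W)))
    (ord_nodup : ord.Nodup) (ord_all : ∀ a, a ∈ ord)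
    (α : I → ℕ) (q : I → ℂˣ) (hq : MultQuiver.IsRegular q) :
    (∀ (V : Type w) [AddCommGroup V] [Module ℂ V] [Module (MultQuiver.FramedMPA W ord α q) V]
        [IsScalarTower ℂ (MultQuiver.FramedMPA W ord α q) V],
      MultQuiver.HasDimVector (MultQuiver.framedVertex W ord α q) (MultQuiver.framedDim W α) V →
        IsSimpleModule (MultQuiver.FramedMPA W ord α q) V) ∧
    (∀ (ρ : MultQuiver.FramedRep W ord α q) (g : MultQuiver.GLdim α ℂ),
      MultQuiver.extendByOne W g • ρ = ρ → g = 1) ∧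
    Algebra.Smooth ℂ (MultQuiver.QuiverVarietyRing W ord α q) := by
  refine ⟨fun V _ _ _ _ hdim => ?_, fun ρ g hg => ?_, ?_⟩
  · exact MultQuiver.isSimpleModule_of_hasDimVector (q' := MultQuiver.framedParam W α q) ord_nodup
      ord_all hq α V hdim
  · exact MultQuiver.eq_one_of_smul_eq ord_nodup ord_all hq ρ g hg
  · have hirr : ∀ ρ : MultQuiver.FramedRep W ord α q, ρ.IsIrred := fun ρ =>
      MultQuiver.FramedRep.isIrred ord_nodup ord_all hq ρ
    have ho : MultQuiver.framedDim W α .infty = 1 := rfl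
    have := MultQuiver.RepRing.formallySmooth ord_nodup ord_all ho
      (MultQuiver.prod_framedParam α q) hirr
    exact MultQuiver.smooth_quotientRing ho hirr
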